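/- Let $n\ge 1$, $1<p<\infty$, $p'=p/(p-1)$. For a measure $\mu$ and a function $f$ on $\mathbb R^n$ put $$R_1(f\mu)(x)=\int_{\mathbb R^n}\frac{y_1-x_1}{|y-x|^{n+1}}\,f(y)\,d\mu(y),$$ the first Riesz transform up to its normalizing constant, and for $\delta>0$ let $R_1^{\delta}(f\mu)(x)$ be the same integral over $|y-x|>\delta$. Cubes $Q$ have sides parallel to the axes, side length $|Q|^{1/n}$ and centre $c_Q$. For locally finite positive Borel measures $\sigma,\omega$ consider: * the two-tailed Muckenhoupt condition $$A_p(\sigma,\omega):\quad \sup_Q\Big(\int\frac{|Q|^{p-1}}{(|Q|^{1/n}+\operatorname{dist}(x,Q))^{np}}d\omega\Big)^{1/p}\Big(\int\frac{|Q|^{p'-1}}{(|Q|^{1/n}+\operatorname{dist}(x,Q))^{np'}}d\sigma\Big)^{1/p'}<\infty;$$ * the testing conditions $$\int_Q|R_1(\mathbf 1_Q\sigma)|^p d\omega\le T^p\,\sigma(Q),\qquad \int_Q|R_1(\mathbf 1_Q\omega)|^{p'}d\sigma\le T^{p'}\omega(Q)$$ for all $Q$, and the same for $R_1^\delta$ uniformly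 in $\delta>0$; * the norm inequality $\|R_1(f\sigma)\|_{L^p(\omega)}\le C\|f\|_{L^p(\sigma)}$ for all bounded measurable $f$ of bounded support, and the uniform norm inequality, which is the same with $R_1^\delta$ in place of $R_1$ and one $C$ for all $\delta>0$; * the quadratic condition $A_p^{\ell^2}(\sigma,\omega)$: there is $A<\infty$ such that for all finite sequences of cubes $Q_i$ with centres $c_i$ and of functions $f_i$, $$\Big\|\Big(\sum_i\Big(\mathbf 1_{Q_i}\int_{\mathbb R^n\setminus Q_i}\frac{f_i(y)}{|y-c_i|^n}d\sigma(y)\Big)^2\Big)^{1/2}\Big\|_{L^p(\omega)}\le A\Big\|\Big(\sum_i f_i^2\Big)^{1/2}\Big\|_{L^p(\sigma)}.$$ Let $\omega$ be the middle-third Cantor probability measure on the segment $S=[0,1]\times\{0\}^{n-1}$, and let $G_j^k$ ($k\ge0$, $1\le j\le2^k$) be the open middle-third segments removed from the $2^k$ segments of generation $k$ in its construction. Then: 1. Every $G_j^k$ contains a zero of $R_1\omega$. 2. Let $z_j^k\in G_j^k$ be any choice of zeros of $R_1\omega$, and for $1<r<\infty$ put $$\sigma_r=\sum_{k,j}s_j^k\,\delta_{z_j^k},\qquad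 s_j^k=\frac{2^{k(r'-1)}}{3^{nkr'}},\qquad r'=\frac r{r-1}.$$ Then $\sigma_p$ and $\omega$ are locally finite measures carried by $S$; the integrals defining $R_1(f\sigma_p)$ at $\omega$-almost every point and $R_1(f\omega)$ at $\sigma_p$-almost every point converge absolutely for bounded $f$; and, for the exponent $p$, both pairs $(\sigma_p,\omega)$ and $(\omega,\sigma_{p'})$ satisfy the two-tailed Muckenhoupt condition and both testing conditions. 3. If $p>2$, then for the pair $(\sigma_p,\omega)$ the condition $A_p^{\ell^2}$, the norm inequality and the uniform norm inequality all fail. If $p<2$, the same three conditions fail for the dual pair $(\omega,\sigma_{p'})$. So for every $p\ne2$ there is a pair satisfying the Muckenhoupt and testing conditions for $R_1$ for which the norm inequality for $R_1$ fails. 4. For locally finite positive Borel measures $\mu,\nu$ carried by $S$ (in particular for the pairs above), the condition $A_p^{\ell^2}(\mu,\nu)$ is necessary for the uniform norm inequality for $R_1$ from $L^p(\mu)$ to $L^p(\nu)$. -/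

import Mathlib

open MeasureTheory Set
open scoped ENNReal NNReal

noncomputable section

namespace TwoWeightRiesz

/-! ### Cubes, Riesz transform, two weight conditions in `ℝⁿ`

Throughout, the first coordinate of `ℝⁿ` has index `0`. -/

/-- `Q` is a cube with sides parallel to the axes, centre `c` and side length `ℓ > 0`: a product of
`n` bounded intervals of length `ℓ` (each of them open, closed or half-open). -/
def IsCube {n : ℕ} (Q : Set (EuclideanSpace ℝ (Fin n))) (c : EuclideanSpace ℝ (Fin n)) (ℓ : ℝ) :
    Prop :=
  0 < ℓ ∧ ∃ J : Fin n → Set ℝ,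
    (∀ i, Ioo (c i - ℓ / 2) (c i + ℓ / 2) ⊆ J i ∧ J i ⊆ Icc (c i - ℓ / 2) (c i + ℓ / 2)) ∧
    Q = {x | ∀ i, x i ∈ J i}

/-- The kernel `(y₁ - x₁) / |y - x|ⁿ⁺¹` of the Riesz transform `R₁` (without its dimensional
normalizing constant); for `n = 1` it is the kernel `1 / (y - x)` of the Hilbert transform. -/
def rieszKernel {n : ℕ} [NeZero n] (x y : EuclideanSpace ℝ (Fin n)) : ℝ :=
  (y 0 - x 0) / ‖y - x‖ ^ (n + 1)

/-- The truncated Riesz transform `∫_{|y - x| > δ} K(x, y) f(y) dμ(y)` of `f μ`. For `δ = 0` this is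
`R₁(f μ)(x)` itself, because the kernel vanishes at `y = x`. -/
def rieszTrunc {n : ℕ} [NeZero n] (δ : ℝ) (μ : Measure (EuclideanSpace ℝ (Fin n)))
    (f : EuclideanSpace ℝ (Fin n) → ℝ) (x : EuclideanSpace ℝ (Fin n)) : ℝ :=
  ∫ y in {y | δ < ‖y - x‖}, rieszKernel x y * f y ∂μ

/-- `R₁(f μ)(x) = ∫ K(x, y) f(y) dμ(y)`. -/
def riesz {n : ℕ} [NeZero n] (μ : Measure (EuclideanSpace ℝ (Fin n)))
    (f : EuclideanSpace ℝ (Fin n) → ℝ) (x : EuclideanSpace ℝ (Fin n)) : ℝ :=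
  ∫ y, rieszKernel x y * f y ∂μ

theorem rieszTrunc_zero {n : ℕ} [NeZero n] (μ : Measure (EuclideanSpace ℝ (Fin n)))
    (f : EuclideanSpace ℝ (Fin n) → ℝ) (x : EuclideanSpace ℝ (Fin n)) :
    rieszTrunc 0 μ f x = riesz μ f x := by
  refine setIntegral_eq_integral_of_forall_compl_eq_zero fun y hy => ?_
  have hyx : y = x := by simpa [sub_eq_zero] using hy
  simp [rieszKernel, hyx]

/-- The tail integral `∫ |Q|^{r-1} / (|Q|^{1/n} + dist(x, Q))^{n r} dμ(x)` of a cube `Q` of side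
length `ℓ`, so that `|Q| = ℓⁿ`. -/
def tail {n : ℕ} (r : ℝ) (μ : Measure (EuclideanSpace ℝ (Fin n)))
    (Q : Set (EuclideanSpace ℝ (Fin n))) (ℓ : ℝ) : ℝ≥0∞ :=
  ∫⁻ x, ENNReal.ofReal (ℓ ^ (n * (r - 1)) / (ℓ + Metric.infDist x Q) ^ (n * r)) ∂μ

/-- The two-tailed Muckenhoupt condition `A_p(σ, ω) < ∞`. -/
def MuckenhouptAp {n : ℕ} (p : ℝ) (σ ω : Measure (EuclideanSpace ℝ (Fin n))) : Prop :=
  ∃ A : ℝ≥0, ∀ Q c ℓ, IsCube Q c ℓ →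
    tail p ω Q ℓ ^ (1 / p) * tail p.conjExponent σ Q ℓ ^ (1 / p.conjExponent) ≤ A

/-- The testing condition `∫_Q |R₁(1_Q σ)|^p dω ≤ T^p σ(Q)` over all cubes `Q`, for `R₁` itself
(`δ = 0`) and uniformly for all its truncations (`δ > 0`). -/
def TestingCondition {n : ℕ} [NeZero n] (p : ℝ) (σ ω : Measure (EuclideanSpace ℝ (Fin n))) :
    Prop :=
  ∃ T : ℝ≥0, ∀ δ : ℝ, 0 ≤ δ → ∀ Q c ℓ, IsCube Q c ℓ →
    ∫⁻ x in Q, ‖rieszTrunc δ σ (Q.indicator 1) x‖ₑ ^ p ∂ω ≤ (T : ℝ≥0∞) ^ p * σ Q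

/-- `‖R₁(f σ)‖_{L^p(ω)} ≤ C ‖f‖_{L^p(σ)}` for the truncation of `R₁` at `δ` (for `R₁` itself if
`δ = 0`) and all bounded measurable functions `f` of bounded support. -/
def NormBound {n : ℕ} [NeZero n] (δ p : ℝ) (σ ω : Measure (EuclideanSpace ℝ (Fin n)))
    (C : ℝ≥0) : Prop :=
  ∀ f : EuclideanSpace ℝ (Fin n) → ℝ, Measurable f → (∃ B : ℝ, ∀ x, |f x| ≤ B) →
    Bornology.IsBounded (Function.support f) →
    eLpNorm (rieszTrunc δ σ f) (ENNReal.ofReal p) ω ≤ C * eLpNorm f (ENNReal.ofReal p) σ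

/-- The norm inequality for `R₁` itself. It is meaningful if the integral `R₁(f σ)(x)` converges
absolutely at `ω`-almost every `x` (see `AbsConvergent`). -/
def NormInequality {n : ℕ} [NeZero n] (p : ℝ) (σ ω : Measure (EuclideanSpace ℝ (Fin n))) : Prop :=
  ∃ C : ℝ≥0, NormBound 0 p σ ω C

/-- The norm inequality for `R₁` in the sense of uniform bounds for its truncations. -/
def UniformNormInequality {n : ℕ} [NeZero n] (p : ℝ)
    (σ ω : Measure (EuclideanSpace ℝ (Fin n))) : Prop :=
  ∃ C : ℝ≥0, ∀ δ : ℝ, 0 < δ → NormBound δ p σ ω C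

/-- At `ω`-almost every `x` the kernel of `R₁` is absolutely integrable with respect to `σ`. -/
def AbsConvergent {n : ℕ} [NeZero n] (σ ω : Measure (EuclideanSpace ℝ (Fin n))) : Prop :=
  ∀ᵐ x ∂ω, Integrable (fun y => rieszKernel x y) σ

/-- The hypotheses of the scalar `T1` theorem for `R₁` and the exponent `p`: the two-tailed
Muckenhoupt condition, the testing condition and the dual testing condition. -/
def T1Conditions {n : ℕ} [NeZero n] (p : ℝ) (σ ω : Measure (EuclideanSpace ℝ (Fin n))) : Prop :=
  MuckenhouptAp p σ ω ∧ TestingCondition p σ ω ∧ TestingCondition p.conjExponent ω σ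

/-- The quadratic Muckenhoupt condition `A_p^{ℓ²}(σ, ω) < ∞`: one constant for all finite
sequences of cubes `Q i`, with centres `c i`, and of functions `f i`. Replacing `f i` by `|f i|`
only enlarges the left-hand side, so the functions are taken nonnegative. -/
def QuadraticAp {n : ℕ} (p : ℝ) (σ ω : Measure (EuclideanSpace ℝ (Fin n))) : Prop :=
  ∃ A : ℝ≥0, ∀ (M : ℕ) (Q : Fin M → Set (EuclideanSpace ℝ (Fin n)))
    (c : Fin M → EuclideanSpace ℝ (Fin n)) (ℓ : Fin M → ℝ)
    (f : Fin M → EuclideanSpace ℝ (Fin n) → ℝ≥0∞),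
    (∀ i, IsCube (Q i) (c i) (ℓ i)) → (∀ i, Measurable (f i)) →
    (∫⁻ x, (∑ i, (Q i).indicator
        (fun _ => ∫⁻ y in (Q i)ᶜ, f i y / ENNReal.ofReal (‖y - c i‖ ^ n) ∂σ) x ^ 2) ^ (p / 2)
        ∂ω) ^ (1 / p) ≤
      A * (∫⁻ y, (∑ i, f i y ^ 2) ^ (p / 2) ∂σ) ^ (1 / p)

/-! ### The Cantor measure on the line -/

/-- The point of the middle-third Cantor set with ternary digits `2 b₀, 2 b₁, …`. -/
def cantorPoint (b : ℕ → Bool) : ℝ :=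
  Real.ofDigits (fun i => cond (b i) (2 : Fin 3) 0)

/-- The Cantor measure on `[0, 1]`: the law of `∑ 2 bᵢ 3⁻⁽ⁱ⁺¹⁾` for independent fair bits. -/
def cantorMeasure : Measure ℝ :=
  (Measure.infinitePi fun _ : ℕ => (PMF.uniformOfFintype Bool).toMeasure).map cantorPoint

/-- Left endpoint of the `k`-th generation interval with address `w`. The `2 ^ k` words
`w : Fin k → Bool` index the `2 ^ k` intervals of that generation. -/
def leftEnd {k : ℕ} (w : Fin k → Bool) : ℝ :=
  ∑ i : Fin k, (if w i then 2 else 0) / 3 ^ ((i : ℕ) + 1)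

/-- The `k`-th generation closed interval of the Cantor construction with address `w`. -/
def cantorInterval {k : ℕ} (w : Fin k → Bool) : Set ℝ :=
  Icc (leftEnd w) (leftEnd w + 1 / 3 ^ k)

/-- The removed open middle third of `cantorInterval w`. -/
def cantorGap {k : ℕ} (w : Fin k → Bool) : Set ℝ :=
  Ioo (leftEnd w + 1 / 3 ^ (k + 1)) (leftEnd w + 2 / 3 ^ (k + 1))

theorem measurable_cantorPoint : Measurable cantorPoint := by
  refine Continuous.measurable (Real.continuous_ofDigits.comp ?_)
  refine continuous_pi fun i => ?_
  exact (continuous_of_discreteTopology (f := fun t : Bool => cond t (2 : Fin 3) 0)).comp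
    (continuous_apply i)

instance : IsProbabilityMeasure cantorMeasure :=
  Measure.isProbabilityMeasure_map measurable_cantorPoint.aemeasurable

theorem cantorMeasure_compl_cantorSet : cantorMeasure cantorSetᶜ = 0 := by
  rw [cantorMeasure, Measure.map_apply measurable_cantorPoint
    isClosed_cantorSet.measurableSet.compl]
  convert measure_empty (μ := Measure.infinitePi fun _ : ℕ => (PMF.uniformOfFintype Bool).toMeasure)
  ext b
  simpa [cantorPoint] using ofDigits_bool_to_fin_three_mem_cantorSet b

theorem cantorPoint_mem_cantorInterval_iff {k : ℕ} (w : Fin k → Bool) (b : ℕ → Bool) :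
    cantorPoint b ∈ cantorInterval w ↔ ∀ i : Fin k, b i = w i := by
  induction k generalizing b with
  | zero =>
    simp only [cantorInterval, leftEnd, mem_Icc, Finset.univ_eq_empty, Finset.sum_empty,
      pow_zero, IsEmpty.forall_iff, iff_true]
    exact ⟨Real.ofDigits_nonneg _, by simpa [cantorPoint] using Real.ofDigits_le_one _⟩
  | succ k ih =>
    have h1 : cantorPoint b = (if b 0 then 2 else 0) / 3 + cantorPoint (fun i => b (i + 1)) / 3 := by
      rw [cantorPoint, Real.ofDigits_eq_sum_add_ofDigits _ 1]
      simp only [Finset.range_one, Finset.sum_singleton, Real.ofDigitsTerm, cantorPoint]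
      cases b 0 <;> simp [div_eq_inv_mul, mul_comm]
    have h2 : leftEnd w = (if w 0 then 2 else 0) / 3 + leftEnd (fun i => w i.succ) / 3 := by
      rw [leftEnd, Fin.sum_univ_succ, leftEnd, Finset.sum_div]
      simp [pow_succ, div_div]
    have h3 : ∀ {m : ℕ} (v : Fin m → Bool), 0 ≤ leftEnd v ∧ leftEnd v + 1 / 3 ^ m ≤ 1 := by
      intro m
      induction m with
      | zero => intro v; simp [leftEnd]
      | succ m ihm =>
        intro v
        have h2 : leftEnd v = (if v 0 then 2 else 0) / 3 + leftEnd (fun i => v i.succ) / 3 := by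
          rw [leftEnd, Fin.sum_univ_succ, leftEnd, Finset.sum_div]
          simp [pow_succ, div_div]
        have := ihm (fun i => v i.succ)
        have e : (1 : ℝ) / 3 ^ (m + 1) = (1 / 3 ^ m) / 3 := by rw [pow_succ]; field_simp
        rw [h2, e]
        split_ifs <;> constructor <;> linarith
    have e : (1 : ℝ) / 3 ^ (k + 1) = (1 / 3 ^ k) / 3 := by rw [pow_succ]; field_simp
    have h4 := h3 (fun i => w i.succ)
    have h5 : 0 ≤ cantorPoint (fun i => b (i + 1)) := Real.ofDigits_nonneg _
    have h6 : cantorPoint (fun i => b (i + 1)) ≤ 1 := Real.ofDigits_le_one _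
    have hih := ih (fun i => w i.succ) (fun i => b (i + 1))
    simp only [cantorInterval, mem_Icc] at hih ⊢
    rw [Fin.forall_fin_succ]
    simp only [Fin.val_zero, Fin.val_succ]
    rw [← hih, h1, h2, e]
    have h7 : (0 : ℝ) < 1 / 3 ^ k := by positivity
    obtain ⟨h8, h9⟩ := h4
    generalize leftEnd (fun i => w i.succ) = l at *
    generalize cantorPoint (fun i => b (i + 1)) = c at *
    generalize (1 : ℝ) / 3 ^ k = r at *
    cases b 0 <;> cases w 0
    · simp only [Bool.false_eq_true, if_false, true_and]
      constructor <;> rintro ⟨h, h'⟩ <;> constructor <;> linarith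
    · simp only [Bool.false_eq_true, if_false, if_true, false_and, iff_false]
      rintro ⟨h, h'⟩; linarith
    · simp only [Bool.false_eq_true, if_false, if_true, Bool.true_eq_false, false_and, iff_false]
      rintro ⟨h, h'⟩; linarith
    · simp only [if_true, true_and]
      constructor <;> rintro ⟨h, h'⟩ <;> constructor <;> linarith

/-- The Cantor measure is equidistributed over the `2 ^ k` intervals of generation `k`. -/
theorem cantorMeasure_cantorInterval {k : ℕ} (w : Fin k → Bool) :
    cantorMeasure (cantorInterval w) = 2⁻¹ ^ k := by
  rw [cantorMeasure, Measure.map_apply measurable_cantorPoint (by exact measurableSet_Icc)]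
  have : cantorPoint ⁻¹' cantorInterval w =
      Set.pi (Finset.range k : Set ℕ) (fun i => {t | ∀ h : i < k, t = w ⟨i, h⟩}) := by
    ext b
    simp only [mem_preimage, cantorPoint_mem_cantorInterval_iff, Set.mem_pi, Finset.coe_range,
      mem_Iio, Set.mem_ofPred_eq]
    exact ⟨fun h i _ hi => h ⟨i, hi⟩, fun h i => h i i.2 i.2⟩
  rw [this, Measure.infinitePi_pi _ (fun _ _ => MeasurableSet.of_discrete)]
  rw [Finset.prod_congr rfl (g := fun _ => 2⁻¹)]
  · simp
  · intro i hi
    have hi' : i < k := by simpa using hi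
    have : {t | ∀ h : i < k, t = w ⟨i, h⟩} = {w ⟨i, hi'⟩} := by ext t; simp [hi']
    rw [this, PMF.toMeasure_apply_singleton _ _ (MeasurableSet.singleton _)]
    simp [PMF.uniformOfFintype_apply]

/-! ### The pair of measures in `ℝⁿ` -/

/-- The point `(t, 0, …, 0)` of `ℝⁿ`. -/
def axisPoint (n : ℕ) [NeZero n] (t : ℝ) : EuclideanSpace ℝ (Fin n) :=
  EuclideanSpace.single 0 t

/-- The segment `[0, 1] × {0}ⁿ⁻¹`. -/
def unitSegment (n : ℕ) [NeZero n] : Set (EuclideanSpace ℝ (Fin n)) :=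
  axisPoint n '' Icc 0 1

/-- The middle-third segment removed at generation `k` from the segment with address `w`. -/
def gapSegment (n : ℕ) [NeZero n] {k : ℕ} (w : Fin k → Bool) :
    Set (EuclideanSpace ℝ (Fin n)) :=
  axisPoint n '' cantorGap w

/-- The Cantor measure on the segment `[0, 1] × {0}ⁿ⁻¹`. -/
def omega (n : ℕ) [NeZero n] : Measure (EuclideanSpace ℝ (Fin n)) :=
  cantorMeasure.map (axisPoint n)

/-- The mass `2^{k (p' - 1)} / 3^{n k p'}` with `p' = p / (p - 1)`. -/
def mass (n : ℕ) (p : ℝ) (k : ℕ) : ℝ :=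
  2 ^ ((k : ℝ) * (p.conjExponent - 1)) / 3 ^ ((n : ℝ) * k * p.conjExponent)

/-- The discrete measure with mass `mass n p k` at `z k w` for all generations `k` and all
addresses `w` of generation `k`. -/
def sigma (n : ℕ) (p : ℝ) (z : ∀ k : ℕ, (Fin k → Bool) → EuclideanSpace ℝ (Fin n)) :
    Measure (EuclideanSpace ℝ (Fin n)) :=
  Measure.sum fun i : (k : ℕ) × (Fin k → Bool) =>
    ENNReal.ofReal (mass n p i.1) • Measure.dirac (z i.1 i.2)

/-- `z` selects, in each removed segment, a zero of `R₁ω`. -/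
def IsZeroSelection (n : ℕ) [NeZero n]
    (z : ∀ k : ℕ, (Fin k → Bool) → EuclideanSpace ℝ (Fin n)) : Prop :=
  ∀ (k : ℕ) (w : Fin k → Bool), z k w ∈ gapSegment n w ∧ riesz (omega n) 1 (z k w) = 0

end TwoWeightRiesz

end

/-! All integrals are pulled back to the space of fair bit sequences. Write `rate n` = 3ⁿ/2 and θ =
`rate n`^(-p'). Generation k of σ_p has total mass θᵏ, spread evenly over the words of length k
(`lintegral_sigma`). The analytic input on ω is that its potential of order n, seen at resolution
3⁻ᵏ, is at most a constant times `rate n`ᵏ: a sum of contributions of scales 3⁻ⁱ, each about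
(3ⁿ/2)ⁱ, is dominated by the finest scale (`lintegral_max_rpow_le`).

Zeros: near an end of a gap the adjacent small Cantor interval outweighs all the mass beyond the
gap, because `rate n` > 1. Hence R₁ω changes sign inside the gap, and its zeros keep a distance
c·3⁻ᵏ from the Cantor set with c independent of k (`exists_separation_of_zeros`). Everything about
the pair depends only on the properties collected in `IsSeparatedZeros`.

Testing for σ needs no cancellation. If k is the earliest generation with a zero in Q, all Cantor
points of Q lie below one word of length k, and there the absolute potential of σ restricted to Q is
O(`rate n`^(-(p'-1)k)). Its p-th power is O(θᵏ), and θᵏ2⁻ᵏ is the mass of a single atom of Q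
(`forward_testing`). Dual testing uses the zeros: at a zero z, R₁(1_Q ω)(z) = -R₁(1_{Qᶜ} ω)(z). If
the part of ω below an ancestor word of length k lies in Q, this is O(`rate n`ᵏ), so the sum over
descendants converges geometrically along each bit sequence; at most one further word remains
(`backward_testing`). The Muckenhoupt condition is a comparison of two radial tail integrals
(`exists_growth`).

Failure of the quadratic condition: the test families are normalized so that each of N generations
contributes a unit. The square function adds these units in ℓ² on the ω side and in ℓᵖ on the σ
side, because all generations overlap at a Cantor point while the atoms are disjoint. One obtains
N^(1/2) ≲ N^(1/p) for σ → ω and N^(1/p) ≲ N^(1/2) for ω → σ (`not_quadraticAp`,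
`not_quadraticAp_dual`).

Necessity of the quadratic condition: Gaussian averages extend a scalar bound to square functions
with the same constant (`NormBound.vectorValued`). On a line, the kernel has a fixed sign on each
side of a cube and dominates 2⁻ⁿ|y - c|⁻ⁿ there (`lintegral_cutoff_le`). -/

namespace TwoWeightRiesz

/-! ### Fair coin tosses and the Cantor set -/

/-- The law of a sequence of independent fair bits. -/
noncomputable def coin : Measure (ℕ → Bool) :=
  Measure.infinitePi fun _ : ℕ => (PMF.uniformOfFintype Bool).toMeasure

instance : IsProbabilityMeasure coin := by unfold coin; infer_instance

/-- The first `k` bits of a sequence. -/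
def word (b : ℕ → Bool) (k : ℕ) : Fin k → Bool := fun i => b i

theorem exists_word_eq {k : ℕ} (w : Fin k → Bool) : ∃ b, word b k = w :=
  ⟨fun i => if h : i < k then w ⟨i, h⟩ else false, by ext i; simp [word]⟩

theorem word_eq_iff {b b' : ℕ → Bool} {k : ℕ} : word b k = word b' k ↔ ∀ i < k, b i = b' i :=
  ⟨fun h i hi => congrFun h ⟨i, hi⟩, fun h => funext fun i => h i i.2⟩

theorem exists_first_difference {b b' : ℕ → Bool} {k : ℕ} (h : word b k ≠ word b' k) :
    ∃ i < k, word b i = word b' i ∧ b i ≠ b' i := by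
  classical
  have hex : ∃ i, i < k ∧ b i ≠ b' i := by
    by_contra! hc
    exact h (word_eq_iff.2 hc)
  refine ⟨Nat.find hex, (Nat.find_spec hex).1, word_eq_iff.2 fun i hi => ?_, (Nat.find_spec hex).2⟩
  by_contra hne
  exact Nat.find_min hex hi ⟨hi.trans (Nat.find_spec hex).1, hne⟩

theorem third_pow_succ (k : ℕ) : (1 : ℝ) / 3 ^ (k + 1) = 1 / 3 ^ k / 3 := by
  rw [pow_succ]; field_simp

theorem third_pow_pos (k : ℕ) : (0 : ℝ) < 1 / 3 ^ k := by positivity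

theorem third_pow_anti {k m : ℕ} (h : k ≤ m) : (1 : ℝ) / 3 ^ m ≤ 1 / 3 ^ k :=
  one_div_le_one_div_of_le (by positivity) (pow_le_pow_right₀ (by norm_num) h)

theorem leftEnd_word_succ (b : ℕ → Bool) (k : ℕ) :
    leftEnd (word b (k + 1)) = leftEnd (word b k) + (if b k then 2 else 0) * (1 / 3 ^ k / 3) := by
  rw [leftEnd, Fin.sum_univ_castSucc, leftEnd, ← third_pow_succ]
  rw [mul_one_div]
  rfl

theorem mem_cantorGap_word {b : ℕ → Bool} {k : ℕ} {t : ℝ} :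
    t ∈ cantorGap (word b k) ↔
      leftEnd (word b k) + 1 / 3 ^ k / 3 < t ∧ t < leftEnd (word b k) + 2 * (1 / 3 ^ k / 3) := by
  rw [cantorGap, mem_Ioo, ← third_pow_succ, mul_one_div]

theorem cantorPoint_mem_cantorInterval (b : ℕ → Bool) (k : ℕ) :
    cantorPoint b ∈ cantorInterval (word b k) :=
  (cantorPoint_mem_cantorInterval_iff _ _).2 fun _ => rfl

theorem cantorInterval_word_anti (b : ℕ → Bool) {k m : ℕ} (h : k ≤ m) :
    cantorInterval (word b m) ⊆ cantorInterval (word b k) := by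
  induction m, h using Nat.le_induction with
  | base => exact Subset.rfl
  | succ m _ ih =>
    refine Subset.trans (Icc_subset_Icc ?_ ?_) ih <;>
    · rw [leftEnd_word_succ]
      try rw [third_pow_succ]
      have := third_pow_pos m
      split_ifs <;> linarith

theorem mem_cantorInterval_lower {b : ℕ → Bool} {i k : ℕ} (hik : i < k) (hb : b i = false) {t : ℝ}
    (ht : t ∈ cantorInterval (word b k)) : t ≤ leftEnd (word b i) + 1 / 3 ^ i / 3 := by
  have h := (cantorInterval_word_anti b (Nat.succ_le_of_lt hik) ht).2
  rw [Nat.succ_eq_add_one, leftEnd_word_succ, third_pow_succ] at h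
  simpa [hb] using h

theorem mem_cantorInterval_upper {b : ℕ → Bool} {i k : ℕ} (hik : i < k) (hb : b i = true) {t : ℝ}
    (ht : t ∈ cantorInterval (word b k)) : leftEnd (word b i) + 2 * (1 / 3 ^ i / 3) ≤ t := by
  have h := (cantorInterval_word_anti b (Nat.succ_le_of_lt hik) ht).1
  rw [Nat.succ_eq_add_one, leftEnd_word_succ] at h
  simpa [hb] using h

theorem cantorPoint_lower {b : ℕ → Bool} {i : ℕ} (hb : b i = false) :
    cantorPoint b ≤ leftEnd (word b i) + 1 / 3 ^ i / 3 :=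
  mem_cantorInterval_lower (Nat.lt_succ_self i) hb (cantorPoint_mem_cantorInterval b _)

theorem cantorPoint_upper {b : ℕ → Bool} {i : ℕ} (hb : b i = true) :
    leftEnd (word b i) + 2 * (1 / 3 ^ i / 3) ≤ cantorPoint b :=
  mem_cantorInterval_upper (Nat.lt_succ_self i) hb (cantorPoint_mem_cantorInterval b _)

theorem cantorGap_subset_cantorInterval {k : ℕ} (w : Fin k → Bool) :
    cantorGap w ⊆ cantorInterval w := by
  obtain ⟨b, rfl⟩ := exists_word_eq w
  intro t ht
  rw [mem_cantorGap_word] at ht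
  have := third_pow_pos k
  exact ⟨by linarith, by linarith⟩

/-- At the first differing bit i < k the two points lie on opposite sides of the gap of the common
word of length i, whose length 3⁻⁽ⁱ⁺¹⁾ is at least 3⁻ᵏ. The points may belong to deeper intervals,
so that the bound also applies to points in gaps. -/
theorem le_abs_sub_of_word_ne {b b' : ℕ → Bool} {k m m' : ℕ} (hm : k ≤ m) (hm' : k ≤ m')
    (h : word b k ≠ word b' k) {s t : ℝ} (hs : s ∈ cantorInterval (word b m))
    (ht : t ∈ cantorInterval (word b' m')) : 1 / 3 ^ k ≤ |s - t| := by
  obtain ⟨i, hik, hw, hne⟩ := exists_first_difference h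
  have h1 : (1 : ℝ) / 3 ^ k ≤ 1 / 3 ^ i / 3 := by
    rw [← third_pow_succ]; exact third_pow_anti hik
  refine h1.trans ?_
  rw [le_abs]
  cases hb : b i <;> cases hb' : b' i <;> simp only [hb, hb', ne_eq, not_true_eq_false] at hne
  · have h2 := mem_cantorInterval_lower (hik.trans_le hm) hb hs
    have h3 := mem_cantorInterval_upper (hik.trans_le hm') hb' ht
    rw [← hw] at h3
    right; linarith
  · have h2 := mem_cantorInterval_upper (hik.trans_le hm) hb hs
    have h3 := mem_cantorInterval_lower (hik.trans_le hm') hb' ht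
    rw [← hw] at h3
    left; linarith

theorem word_eq_of_abs_sub_lt {b b' : ℕ → Bool} {k : ℕ}
    (h : |cantorPoint b - cantorPoint b'| < 1 / 3 ^ k) : word b k = word b' k := by
  by_contra hne
  exact h.not_ge (le_abs_sub_of_word_ne le_rfl le_rfl hne (cantorPoint_mem_cantorInterval b k)
    (cantorPoint_mem_cantorInterval b' k))

theorem injective_cantorPoint : Function.Injective cantorPoint := by
  intro b b' h
  funext i
  refine word_eq_iff.1 (word_eq_of_abs_sub_lt (k := i + 1) ?_) i (Nat.lt_succ_self i)
  rw [h, sub_self, abs_zero]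
  positivity

theorem continuous_cantorPoint : Continuous cantorPoint := by
  refine Real.continuous_ofDigits.comp (continuous_pi fun i => ?_)
  exact (continuous_of_discreteTopology (f := fun t : Bool => cond t (2 : Fin 3) 0)).comp
    (continuous_apply i)

theorem measurableEmbedding_cantorPoint : MeasurableEmbedding cantorPoint :=
  (continuous_cantorPoint.isClosedEmbedding injective_cantorPoint).measurableEmbedding

theorem cantorPoint_mem_Icc (b : ℕ → Bool) : cantorPoint b ∈ Icc (0 : ℝ) 1 := by
  have := cantorPoint_mem_cantorInterval b 0
  simpa [cantorInterval, leftEnd] using this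

theorem isCompact_range_cantorPoint : IsCompact (range cantorPoint) :=
  isCompact_range continuous_cantorPoint

theorem measurable_word (k : ℕ) : Measurable fun b => word b k :=
  measurable_pi_lambda _ fun i => measurable_pi_apply (i : ℕ)

theorem measurableSet_word_eq {k : ℕ} (w : Fin k → Bool) : MeasurableSet {b | word b k = w} :=
  measurable_word k (measurableSet_singleton w)

theorem coin_word_eq {k : ℕ} (w : Fin k → Bool) : coin {b | word b k = w} = 2⁻¹ ^ k := by
  rw [← cantorMeasure_cantorInterval w, cantorMeasure,
    Measure.map_apply measurable_cantorPoint (by exact measurableSet_Icc), coin]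
  congr 1
  ext b
  simp only [mem_preimage, cantorPoint_mem_cantorInterval_iff, mem_ofPred_eq]
  exact ⟨fun h i => congrFun h i, fun h => funext h⟩

theorem lintegral_word {k : ℕ} (g : (Fin k → Bool) → ℝ≥0∞) :
    ∫⁻ b, g (word b k) ∂coin = 2⁻¹ ^ k * ∑ w, g w := by
  rw [← lintegral_map (f := g) (Measurable.of_discrete) (measurable_word k), lintegral_fintype,
    Finset.mul_sum]
  refine Finset.sum_congr rfl fun w _ => ?_
  rw [Measure.map_apply (measurable_word k) (measurableSet_singleton w)]
  rw [show (fun b => word b k) ⁻¹' {w} = {b | word b k = w} from rfl, coin_word_eq, mul_comm]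

/-- The bit after the first k is fair and independent of them. This converts a sum over both
children of a word into twice the value at the child that the path follows, and allows pathwise
estimates. -/
theorem lintegral_word_bit {k : ℕ} (g : (Fin k → Bool) → Bool → ℝ≥0∞) :
    ∫⁻ b, (g (word b k) false + g (word b k) true) ∂coin =
      2 * ∫⁻ b, g (word b k) (b k) ∂coin := by
  have h := lintegral_word (k := k + 1) fun w => g (fun i => w i.castSucc) (w (Fin.last k))
  have h' : ∀ b, g (fun i => word b (k + 1) i.castSucc) (word b (k + 1) (Fin.last k)) =
    g (word b k) (b k) := fun b => rfl
  simp only [h'] at h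
  rw [h, lintegral_word fun w => g w false + g w true]
  have : ∑ w : Fin (k + 1) → Bool, g (fun i => w i.castSucc) (w (Fin.last k)) =
      ∑ w : Fin k → Bool, (g w false + g w true) := by
    rw [← (Fin.snocEquiv fun _ : Fin (k + 1) => Bool).sum_comp, Fintype.sum_prod_type_right]
    simp [Fin.snocEquiv]
    refine Finset.sum_congr rfl fun w _ => add_comm _ _
  rw [this, pow_succ, ← mul_assoc, mul_comm 2, mul_assoc (2⁻¹ ^ k), ENNReal.inv_mul_cancel] <;> simp

/-! ### Growth of the Cantor measure -/

/-- Two Cantor points in a ball of radius 3⁻⁽ᵏ⁺¹⁾ are closer than 3⁻ᵏ and therefore share their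
first k bits, so the ball carries at most the mass of one word of length k. -/
theorem coin_abs_sub_le (c : ℝ) (k : ℕ) :
    coin {b | |cantorPoint b - c| ≤ 1 / 3 ^ k} ≤ 2 * 2⁻¹ ^ k := by
  cases k with
  | zero =>
    refine prob_le_one.trans ?_
    simp
  | succ k =>
    rcases eq_empty_or_nonempty {b | |cantorPoint b - c| ≤ 1 / 3 ^ (k + 1)} with h | ⟨b₀, hb₀⟩
    · rw [h]; simp
    refine (measure_mono (t := {b | word b k = word b₀ k}) fun b hb => ?_).trans ?_
    · refine word_eq_of_abs_sub_lt ?_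
      simp only [mem_ofPred_eq, third_pow_succ] at hb hb₀
      have h1 := abs_sub_le (cantorPoint b) c (cantorPoint b₀)
      rw [abs_sub_comm c] at h1
      have := third_pow_pos k
      linarith
    · rw [coin_word_eq, pow_succ', ← mul_assoc, ENNReal.mul_inv_cancel] <;> simp

/-- The basic estimate for potentials of the Cantor measure. -/
theorem lintegral_max_rpow_le {a : ℝ} (ha : 1 ≤ a) (c : ℝ) (k : ℕ) :
    ∫⁻ b, ENNReal.ofReal ((max (1 / 3 ^ k) |cantorPoint b - c|) ^ (-a)) ∂coin ≤
      ENNReal.ofReal (12 * (3 ^ a / 2) ^ k) := by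
  have h3 : (3 : ℝ) ≤ 3 ^ a := by
    simpa using Real.rpow_le_rpow_of_exponent_le (x := 3) (by norm_num) ha
  induction k with
  | zero =>
    calc _ ≤ ∫⁻ _, 1 ∂coin := by
          refine lintegral_mono fun b => ?_
          rw [← ENNReal.ofReal_one]
          refine ENNReal.ofReal_le_ofReal ?_
          exact Real.rpow_le_one_of_one_le_of_nonpos (by simp) (by linarith)
      _ ≤ _ := by
          rw [lintegral_one, measure_univ, ← ENNReal.ofReal_one]
          exact ENNReal.ofReal_le_ofReal (by norm_num)
  | succ k ih =>
    -- Refining the resolution changes the integrand only within distance 3⁻ᵏ of c, where it is at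
    -- most 3^(a(k+1)).
    have hpt : ∀ b, ENNReal.ofReal ((max (1 / 3 ^ (k + 1)) |cantorPoint b - c|) ^ (-a)) ≤
        {b | |cantorPoint b - c| ≤ 1 / 3 ^ k}.indicator
          (fun _ => ENNReal.ofReal ((3 ^ a) ^ (k + 1))) b +
        ENNReal.ofReal ((max (1 / 3 ^ k) |cantorPoint b - c|) ^ (-a)) := by
      intro b
      by_cases hb : |cantorPoint b - c| ≤ 1 / 3 ^ k
      · rw [indicator_of_mem (by exact hb)]
        refine le_add_right (ENNReal.ofReal_le_ofReal ?_)
        refine (Real.rpow_le_rpow_of_nonpos (third_pow_pos (k + 1)) (le_max_left _ _)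
          (by linarith)).trans_eq ?_
        rw [Real.rpow_neg (by positivity), one_div, Real.inv_rpow (by positivity), inv_inv,
          ← Real.rpow_natCast, ← Real.rpow_mul (by norm_num), mul_comm, Real.rpow_mul (by norm_num),
          Real.rpow_natCast]
      · rw [indicator_of_notMem (by exact hb), zero_add]
        rw [max_eq_right (le_of_lt (not_le.1 hb)),
          max_eq_right ((third_pow_anti k.le_succ).trans (not_le.1 hb).le)]
    have hms : MeasurableSet {b | |cantorPoint b - c| ≤ 1 / 3 ^ k} :=
      measurableSet_le (measurable_cantorPoint.sub_const c).abs measurable_const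
    calc _ ≤ _ := lintegral_mono hpt
      _ = _ := lintegral_add_left (measurable_const.indicator hms) _
      _ ≤ ENNReal.ofReal ((3 ^ a) ^ (k + 1)) * (2 * 2⁻¹ ^ k) +
          ENNReal.ofReal (12 * (3 ^ a / 2) ^ k) := by
        gcongr
        rw [lintegral_indicator_const hms]
        gcongr
        exact coin_abs_sub_le c k
      _ = ENNReal.ofReal ((3 ^ a) ^ (k + 1) * (2 * 2⁻¹ ^ k) + 12 * (3 ^ a / 2) ^ k) := by
        rw [ENNReal.ofReal_add (by positivity) (by positivity),
          ENNReal.ofReal_mul (p := (3 ^ a) ^ (k + 1)) (by positivity),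
          ENNReal.ofReal_mul (p := 2) (by norm_num), ENNReal.ofReal_pow (p := 2⁻¹) (by norm_num),
          ENNReal.ofReal_inv_of_pos two_pos, ENNReal.ofReal_ofNat]
      _ ≤ _ := by
        refine ENNReal.ofReal_le_ofReal ?_
        -- The induction closes if 2·3ᵃ + 12 ≤ 12·3ᵃ/2, that is 3 ≤ 3ᵃ; this is where a ≥ 1 enters
        -- and why 12 is large enough.
        have : (3 ^ a : ℝ) ^ (k + 1) * (2 * 2⁻¹ ^ k) + 12 * (3 ^ a / 2) ^ k =
          (2 * 3 ^ a + 12) * (3 ^ a / 2) ^ k := by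
          rw [div_pow, inv_pow, pow_succ]; field_simp
        rw [this, pow_succ', ← mul_assoc]
        gcongr
        linarith

/-! ### The kernel on the axis -/

section Axis

variable (n : ℕ) [NeZero n]

@[simp] theorem axisPoint_apply_zero (t : ℝ) : axisPoint n t 0 = t := by simp [axisPoint]

theorem axisPoint_apply_of_ne (t : ℝ) {i : Fin n} (hi : i ≠ 0) : axisPoint n t i = 0 := by
  simp [axisPoint, hi]

theorem axisPoint_sub (s t : ℝ) : axisPoint n s - axisPoint n t = axisPoint n (s - t) := by
  ext i; by_cases hi : i = 0 <;> simp [axisPoint, hi]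

theorem norm_axisPoint (t : ℝ) : ‖axisPoint n t‖ = |t| := by simp [axisPoint]

theorem norm_axisPoint_sub (s t : ℝ) : ‖axisPoint n s - axisPoint n t‖ = |s - t| := by
  rw [axisPoint_sub, norm_axisPoint]

theorem isometry_axisPoint : Isometry (axisPoint n) :=
  Isometry.of_dist_eq fun s t => by rw [dist_eq_norm, norm_axisPoint_sub, Real.dist_eq]

theorem measurableEmbedding_axisPoint : MeasurableEmbedding (axisPoint n) :=
  (isometry_axisPoint n).isClosedEmbedding.measurableEmbedding

theorem measurableEmbedding_axisPoint_cantorPoint :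
    MeasurableEmbedding fun b => axisPoint n (cantorPoint b) :=
  (measurableEmbedding_axisPoint n).comp measurableEmbedding_cantorPoint

theorem omega_eq_map_coin : omega n = coin.map fun b => axisPoint n (cantorPoint b) :=
  Measure.map_map (measurableEmbedding_axisPoint n).measurable measurable_cantorPoint

theorem lintegral_omega (F : EuclideanSpace ℝ (Fin n) → ℝ≥0∞) :
    ∫⁻ x, F x ∂omega n = ∫⁻ b, F (axisPoint n (cantorPoint b)) ∂coin := by
  rw [omega_eq_map_coin, (measurableEmbedding_axisPoint_cantorPoint n).lintegral_map]

theorem integral_omega (F : EuclideanSpace ℝ (Fin n) → ℝ) :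
    ∫ x, F x ∂omega n = ∫ b, F (axisPoint n (cantorPoint b)) ∂coin := by
  rw [omega_eq_map_coin, (measurableEmbedding_axisPoint_cantorPoint n).integral_map]

theorem omega_apply (s : Set (EuclideanSpace ℝ (Fin n))) :
    omega n s = coin {b | axisPoint n (cantorPoint b) ∈ s} := by
  rw [omega_eq_map_coin, (measurableEmbedding_axisPoint_cantorPoint n).map_apply]
  rfl

instance : IsProbabilityMeasure (omega n) :=
  Measure.isProbabilityMeasure_map (measurableEmbedding_axisPoint n).measurable.aemeasurable

theorem ae_omega_iff {P : EuclideanSpace ℝ (Fin n) → Prop} :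
    (∀ᵐ x ∂omega n, P x) ↔ ∀ᵐ b ∂coin, P (axisPoint n (cantorPoint b)) := by
  rw [omega_eq_map_coin, (measurableEmbedding_axisPoint_cantorPoint n).ae_map_iff]

end Axis

/-- The restriction of the Riesz kernel to the axis. -/
noncomputable def lineKernel (n : ℕ) (s t : ℝ) : ℝ := (t - s) / |t - s| ^ (n + 1)

theorem rieszKernel_axisPoint (n : ℕ) [NeZero n] (s t : ℝ) :
    rieszKernel (axisPoint n s) (axisPoint n t) = lineKernel n s t := by
  simp [rieszKernel, lineKernel, norm_axisPoint_sub]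

theorem abs_lineKernel {n : ℕ} [NeZero n] (s t : ℝ) :
    |lineKernel n s t| = |t - s| ^ (-(n : ℝ)) := by
  rw [lineKernel, abs_div, abs_of_nonneg (a := |t - s| ^ (n + 1)) (by positivity)]
  -- At t = s both sides are 0, by the conventions for division by zero and for real powers of zero
  -- with nonzero exponent.
  rcases eq_or_ne (t - s) 0 with h | h
  · have : -(n : ℝ) ≠ 0 := by simpa using NeZero.ne n
    simp [h, Real.zero_rpow this]
  · have := abs_pos.2 h
    rw [Real.rpow_neg this.le, Real.rpow_natCast, pow_succ]
    field_simp

theorem measurable_lineKernel (n : ℕ) (s : ℝ) : Measurable (lineKernel n s) := by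
  unfold lineKernel; fun_prop

theorem abs_lineKernel_le {n : ℕ} [NeZero n] {s t c M : ℝ} (hc : 0 < c) (hM : 0 < M)
    (h : c * M ≤ |t - s|) : |lineKernel n s t| ≤ c ^ (-(n : ℝ)) * M ^ (-(n : ℝ)) := by
  rw [abs_lineKernel, ← Real.mul_rpow hc.le hM.le]
  exact Real.rpow_le_rpow_of_nonpos (by positivity) h (by simp)

/-- The growth rate of the potentials of the Cantor measure. -/
noncomputable def rate (n : ℕ) : ℝ := 3 ^ n / 2

theorem one_lt_rate (n : ℕ) [NeZero n] : 1 < rate n := by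
  have : (3 : ℝ) ^ 1 ≤ 3 ^ n := pow_le_pow_right₀ (by norm_num) (NeZero.one_le)
  unfold rate
  linarith

theorem rate_pos (n : ℕ) [NeZero n] : 0 < rate n := zero_lt_one.trans (one_lt_rate n)

theorem lintegral_le_of_le_max_rpow {a A : ℝ} (ha : 1 ≤ a) (hA : 0 ≤ A) {c : ℝ} {k : ℕ}
    {F : (ℕ → Bool) → ℝ≥0∞}
    (hF : ∀ b, F b ≤ ENNReal.ofReal (A * (max (1 / 3 ^ k) |cantorPoint b - c|) ^ (-a))) :
    ∫⁻ b, F b ∂coin ≤ ENNReal.ofReal (12 * A * (3 ^ a / 2) ^ k) := by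
  refine (lintegral_mono hF).trans ?_
  simp only [ENNReal.ofReal_mul hA]
  rw [lintegral_const_mul' _ _ ENNReal.ofReal_ne_top]
  refine (mul_le_mul_right (lintegral_max_rpow_le ha c k) _).trans_eq ?_
  rw [← ENNReal.ofReal_mul hA]
  congr 1
  ring

theorem one_le_cast (n : ℕ) [NeZero n] : (1 : ℝ) ≤ n := by exact_mod_cast NeZero.one_le

/-- The source point `v b` need not be the Cantor point of b: it suffices that its distance from t
is bounded below by that of the Cantor point from u at resolution 3⁻ᵏ. The hypothesis is asked only
where `F` is nonzero, so that `F` may contain indicators. -/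
theorem lintegral_le_of_le_lineKernel {n : ℕ} [NeZero n] {c : ℝ} (hc : 0 < c) (t u : ℝ) (k : ℕ)
    {v : (ℕ → Bool) → ℝ} {F : (ℕ → Bool) → ℝ≥0∞}
    (hF : ∀ b, F b ≠ 0 → F b ≤ ENNReal.ofReal |lineKernel n t (v b)| ∧
      c * max (1 / 3 ^ k) |cantorPoint b - u| ≤ |v b - t|) :
    ∫⁻ b, F b ∂coin ≤ ENNReal.ofReal (12 * c ^ (-(n : ℝ)) * rate n ^ k) := by
  have := lintegral_le_of_le_max_rpow (one_le_cast n) (A := c ^ (-(n : ℝ))) (by positivity)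
    (c := u) (k := k) (F := F) fun b => ?_
  · simpa [rate] using this
  · by_cases h : F b = 0
    · simp [h]
    · refine (hF b h).1.trans (ENNReal.ofReal_le_ofReal ?_)
      exact abs_lineKernel_le hc (lt_max_of_lt_left (third_pow_pos k)) (hF b h).2

theorem mul_max_le {c d r : ℝ} (hc : c ≤ 1) (hr : 0 ≤ r) (h : c * d ≤ r) : c * max d r ≤ r := by
  rcases le_total d r with h' | h'
  · rw [max_eq_right h']; nlinarith
  · rwa [max_eq_left h']

/-- The kernel integrated over Cantor points at distance at least `c 3⁻ᵏ`. -/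
theorem lintegral_le_of_separated {n : ℕ} [NeZero n] {c : ℝ} (hc : 0 < c) (hc1 : c ≤ 1) (t : ℝ)
    (k : ℕ) {F : (ℕ → Bool) → ℝ≥0∞}
    (hF : ∀ b, F b ≠ 0 → F b ≤ ENNReal.ofReal |lineKernel n t (cantorPoint b)| ∧
      c * (1 / 3 ^ k) ≤ |cantorPoint b - t|) :
    ∫⁻ b, F b ∂coin ≤ ENNReal.ofReal (12 * c ^ (-(n : ℝ)) * rate n ^ k) :=
  lintegral_le_of_le_lineKernel hc t t k fun b hb =>
    ⟨(hF b hb).1, mul_max_le hc1 (abs_nonneg _) (hF b hb).2⟩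

theorem integrable_lineKernel {n : ℕ} [NeZero n] {r t : ℝ} (hr : 0 < r)
    (h : ∀ b, r ≤ |cantorPoint b - t|) :
    Integrable (fun b => lineKernel n t (cantorPoint b)) coin := by
  refine Integrable.of_bound ((measurable_lineKernel n t).comp
    measurable_cantorPoint).aestronglyMeasurable (r ^ (-(n : ℝ)) * 1 ^ (-(n : ℝ)))
    (ae_of_all _ fun b => ?_)
  exact abs_lineKernel_le hr one_pos (by simpa using h b)

/-! ### Zeros of the Riesz transform of the Cantor measure -/

/-- No Cantor point lies in a gap. If the first k bits agree with those of `b₀`, the next bit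
decides the side; otherwise the first difference puts the whole interval of `b₀` on one side of the
point. -/
theorem cantorPoint_le_or_ge (b₀ b : ℕ → Bool) (k : ℕ) :
    cantorPoint b ≤ leftEnd (word b₀ k) + 1 / 3 ^ k / 3 ∨
      leftEnd (word b₀ k) + 2 * (1 / 3 ^ k / 3) ≤ cantorPoint b := by
  have hk := third_pow_pos k
  by_cases h : word b k = word b₀ k
  · rw [← h]
    cases hb : b k
    · exact Or.inl (cantorPoint_lower hb)
    · exact Or.inr (cantorPoint_upper hb)
  · obtain ⟨i, hik, hw, hne⟩ := exists_first_difference h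
    have hi := third_pow_pos i
    have hl : leftEnd (word b₀ k) ∈ cantorInterval (word b₀ k) := ⟨le_rfl, by linarith⟩
    have hr : leftEnd (word b₀ k) + 1 / 3 ^ k ∈ cantorInterval (word b₀ k) := ⟨by linarith, le_rfl⟩
    cases hb : b i <;> cases hb' : b₀ i <;> simp only [hb, hb', ne_eq, not_true_eq_false] at hne
    · left
      have h1 := cantorPoint_lower hb
      have h2 := mem_cantorInterval_upper hik hb' hl
      rw [← hw] at h2
      linarith
    · right
      have h1 := cantorPoint_upper hb
      have h2 := mem_cantorInterval_lower hik hb' hr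
      rw [← hw] at h2
      linarith

/-- Comparison of the two sides of a point: the mass of a word near `t` outweighs everything on the
other side of `t`. -/
theorem lintegral_lineKernel_lt {n : ℕ} [NeZero n] {ε t : ℝ} (hε : ε = 1 ∨ ε = -1) {j k : ℕ}
    (hj : 12 * 2 ^ n * rate n ^ (k + 2) < rate n ^ j) (b₀ : ℕ → Bool)
    (hnear : ∀ b, word b j = word b₀ j → 0 < ε * (cantorPoint b - t) ∧
      ε * (cantorPoint b - t) ≤ 2 * (1 / 3 ^ j))
    (hfar : ∀ b, ε * (cantorPoint b - t) < 0 → 1 / 3 ^ (k + 2) ≤ |cantorPoint b - t|) :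
    ∫⁻ b, ENNReal.ofReal (-(ε * lineKernel n t (cantorPoint b))) ∂coin <
      ∫⁻ b, ENNReal.ofReal (ε * lineKernel n t (cantorPoint b)) ∂coin := by
  have hε1 : |ε| = 1 := by rcases hε with rfl | rfl <;> simp
  have hsign : ∀ b, ε * lineKernel n t (cantorPoint b) =
      ε * (cantorPoint b - t) / |cantorPoint b - t| ^ (n + 1) := fun b => by
    rw [lineKernel, mul_div_assoc]
  have habs : ∀ b, |ε * lineKernel n t (cantorPoint b)| = |lineKernel n t (cantorPoint b)| :=
    fun b => by rw [abs_mul, hε1, one_mul]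
  -- The integrand is nonzero only on the far side of t, where `hfar` gives the separation 3⁻⁽ᵏ⁺²⁾.
  have hupper := lintegral_le_of_separated (n := n) one_pos le_rfl t (k + 2)
    (F := fun b => ENNReal.ofReal (-(ε * lineKernel n t (cantorPoint b)))) fun b hb => by
      refine ⟨ENNReal.ofReal_le_ofReal ((neg_le_abs _).trans_eq (habs b)), ?_⟩
      rw [one_mul]
      refine hfar b ?_
      by_contra! hcon
      refine hb (ENNReal.ofReal_of_nonpos ?_)
      rw [hsign, neg_nonpos]
      positivity
  -- The word of length j has mass 2⁻ʲ and its points are within 2·3⁻ʲ of t, which yields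
  -- 2⁻ʲ(3ʲ/2)ⁿ.
  have hlower : ENNReal.ofReal (rate n ^ j / 2 ^ n) ≤
      ∫⁻ b, ENNReal.ofReal (ε * lineKernel n t (cantorPoint b)) ∂coin := by
    calc _ = ∫⁻ b, {b | word b j = word b₀ j}.indicator
          (fun _ => ENNReal.ofReal (3 ^ (n * j) / 2 ^ n)) b ∂coin := by
          rw [lintegral_indicator_const (measurableSet_word_eq _), coin_word_eq, rate, div_pow,
            show (2⁻¹ : ℝ≥0∞) = ENNReal.ofReal 2⁻¹ by
              rw [ENNReal.ofReal_inv_of_pos two_pos, ENNReal.ofReal_ofNat],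
            ← ENNReal.ofReal_pow (by norm_num), ← ENNReal.ofReal_mul (by positivity), pow_mul,
            inv_pow]
          congr 1
          field_simp
      _ ≤ _ := by
          refine lintegral_mono fun b => ?_
          by_cases hb : word b j = word b₀ j
          · rw [indicator_of_mem (by exact hb)]
            refine ENNReal.ofReal_le_ofReal ?_
            obtain ⟨h1, h2⟩ := hnear b hb
            have h3 : ε * (cantorPoint b - t) = |cantorPoint b - t| := by
              rw [← abs_of_pos h1, abs_mul, hε1, one_mul]
            rw [hsign, h3]
            rw [h3] at h1 h2
            rw [pow_succ, div_mul_cancel_right₀ h1.ne', ← one_div,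
              div_le_div_iff₀ (by positivity) (by positivity)]
            calc _ ≤ (3 : ℝ) ^ (n * j) * (2 * (1 / 3 ^ j)) ^ n := by gcongr
              _ = _ := by rw [mul_comm n j, pow_mul, ← mul_pow, one_mul]; congr 1; field_simp
          · rw [indicator_of_notMem (by exact hb)]; exact zero_le
  refine hupper.trans_lt (lt_of_lt_of_le ?_ hlower)
  rw [Real.one_rpow, mul_one]
  have hr := rate_pos n
  rw [ENNReal.ofReal_lt_ofReal_iff (by positivity), lt_div_iff₀ (by positivity)]
  linarith

theorem integral_lineKernel_pos {n : ℕ} [NeZero n] {ε t r : ℝ} (hr : 0 < r)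
    (h : ∀ b, r ≤ |cantorPoint b - t|)
    (hlt : ∫⁻ b, ENNReal.ofReal (-(ε * lineKernel n t (cantorPoint b))) ∂coin <
      ∫⁻ b, ENNReal.ofReal (ε * lineKernel n t (cantorPoint b)) ∂coin) :
    0 < ε * ∫ b, lineKernel n t (cantorPoint b) ∂coin := by
  have hint := (integrable_lineKernel (n := n) hr h).const_mul ε
  rw [← integral_const_mul, integral_eq_lintegral_pos_part_sub_lintegral_neg_part hint, sub_pos]
  refine (ENNReal.toReal_lt_toReal hlt.ne_top ?_).2 hlt
  exact (hint.lintegral_lt_top).ne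

theorem exists_separation_of_mem_cantorGap {k : ℕ} {w : Fin k → Bool} {t : ℝ}
    (ht : t ∈ cantorGap w) : ∃ r > 0, ∀ b, r ≤ |cantorPoint b - t| := by
  obtain ⟨b₀, rfl⟩ := exists_word_eq w
  obtain ⟨h1, h2⟩ := mem_cantorGap_word.1 ht
  refine ⟨min (t - (leftEnd (word b₀ k) + 1 / 3 ^ k / 3))
    (leftEnd (word b₀ k) + 2 * (1 / 3 ^ k / 3) - t), lt_min (by linarith) (by linarith),
    fun b => ?_⟩
  rcases cantorPoint_le_or_ge b₀ b k with h | h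
  · exact (min_le_left _ _).trans (le_abs.2 (Or.inr (by linarith)))
  · exact (min_le_right _ _).trans (le_abs.2 (Or.inl (by linarith)))

/-- The sequence that follows `b` for `k` steps, then takes the branch `e` and stays as close as
possible to the gap. -/
def branch (b : ℕ → Bool) (k : ℕ) (e : Bool) : ℕ → Bool :=
  fun i => if i < k then b i else if i = k then e else !e

theorem word_branch (b : ℕ → Bool) (k : ℕ) (e : Bool) : word (branch b k e) k = word b k :=
  word_eq_iff.2 fun i hi => by simp [branch, hi]

theorem branch_self (b : ℕ → Bool) (k : ℕ) (e : Bool) : branch b k e k = e := by simp [branch]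

theorem branch_add (b : ℕ → Bool) (k j : ℕ) (e : Bool) : branch b k e (k + 1 + j) = !e := by
  have h1 : ¬ k + 1 + j < k := by omega
  have h2 : ¬ k + 1 + j = k := by omega
  simp [branch, h1, h2]

/-- After the branch `false` the bits are all `true`, so these nested intervals share their right
end, which is the left end of the gap. -/
theorem leftEnd_branch_false (b : ℕ → Bool) (k j : ℕ) :
    leftEnd (word (branch b k false) (k + 1 + j)) + 1 / 3 ^ (k + 1 + j) =
      leftEnd (word b k) + 1 / 3 ^ k / 3 := by
  induction j with
  | zero => simp [leftEnd_word_succ, branch_self, word_branch, third_pow_succ, -one_div]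
  | succ j ih =>
    rw [← ih, ← add_assoc, leftEnd_word_succ, branch_add, third_pow_succ (k + 1 + j)]
    simp only [Bool.not_false, if_true]
    ring

theorem leftEnd_branch_true (b : ℕ → Bool) (k j : ℕ) :
    leftEnd (word (branch b k true) (k + 1 + j)) = leftEnd (word b k) + 2 * (1 / 3 ^ k / 3) := by
  induction j with
  | zero => simp [leftEnd_word_succ, branch_self, word_branch, -one_div]
  | succ j ih =>
    rw [← ih, ← add_assoc, leftEnd_word_succ, branch_add]
    simp

theorem third_pow_add_le {k j : ℕ} (hj : 1 ≤ j) : (1 : ℝ) / 3 ^ (k + 1 + j) ≤ 1 / 3 ^ k / 9 := by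
  refine (third_pow_anti (show k + 2 ≤ k + 1 + j by omega)).trans_eq ?_
  rw [third_pow_succ, third_pow_succ]; ring

/-- The interval of generation k+1+j that ends at the left end of the gap is within 2·3⁻⁽ᵏ⁺¹⁺ʲ⁾ of
t. As t has moved at most a third of the way into the gap, all mass to its right is at least 3⁻⁽ᵏ⁺²⁾
away. The hypothesis `hj` makes the left side win. -/
theorem integral_lineKernel_neg_of_near_left {n : ℕ} [NeZero n] {j k : ℕ} (hj1 : 1 ≤ j)
    (hj : 12 * 2 ^ n * rate n ^ (k + 2) < rate n ^ (k + 1 + j)) {b₀ : ℕ → Bool} {t : ℝ}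
    (ht : t ∈ cantorGap (word b₀ k))
    (htj : t ≤ leftEnd (word b₀ k) + 1 / 3 ^ k / 3 + 1 / 3 ^ (k + 1 + j)) :
    ∫ b, lineKernel n t (cantorPoint b) ∂coin < 0 := by
  obtain ⟨r, hr, hrb⟩ := exists_separation_of_mem_cantorGap ht
  obtain ⟨h1, h2⟩ := mem_cantorGap_word.1 ht
  have h9 := third_pow_add_le (k := k) hj1
  have h8 := third_pow_pos k
  have := integral_lineKernel_pos (n := n) hr hrb (lintegral_lineKernel_lt (Or.inr rfl) hj
    (branch b₀ k false) (fun b hb => ?_) fun b hb => ?_)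
  · linarith
  · have h3 := cantorPoint_mem_cantorInterval b (k + 1 + j)
    rw [hb, cantorInterval, leftEnd_branch_false, mem_Icc] at h3
    have h4 := leftEnd_branch_false b₀ k j
    constructor <;> linarith
  · have h3 : leftEnd (word b₀ k) + 2 * (1 / 3 ^ k / 3) ≤ cantorPoint b :=
      (cantorPoint_le_or_ge b₀ b k).resolve_left fun h => by linarith
    rw [le_abs, third_pow_succ, third_pow_succ]
    left; linarith

theorem integral_lineKernel_pos_of_near_right {n : ℕ} [NeZero n] {j k : ℕ} (hj1 : 1 ≤ j)
    (hj : 12 * 2 ^ n * rate n ^ (k + 2) < rate n ^ (k + 1 + j)) {b₀ : ℕ → Bool} {t : ℝ}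
    (ht : t ∈ cantorGap (word b₀ k))
    (htj : leftEnd (word b₀ k) + 2 * (1 / 3 ^ k / 3) - 1 / 3 ^ (k + 1 + j) ≤ t) :
    0 < ∫ b, lineKernel n t (cantorPoint b) ∂coin := by
  obtain ⟨r, hr, hrb⟩ := exists_separation_of_mem_cantorGap ht
  obtain ⟨h1, h2⟩ := mem_cantorGap_word.1 ht
  have h9 := third_pow_add_le (k := k) hj1
  have h8 := third_pow_pos k
  have := integral_lineKernel_pos (n := n) hr hrb (lintegral_lineKernel_lt (Or.inl rfl) hj
    (branch b₀ k true) (fun b hb => ?_) fun b hb => ?_)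
  · linarith
  · have h3 := cantorPoint_mem_cantorInterval b (k + 1 + j)
    rw [hb, cantorInterval, leftEnd_branch_true, mem_Icc] at h3
    constructor <;> linarith
  · have h3 : cantorPoint b ≤ leftEnd (word b₀ k) + 1 / 3 ^ k / 3 :=
      (cantorPoint_le_or_ge b₀ b k).resolve_right fun h => by linarith
    rw [le_abs, third_pow_succ, third_pow_succ]
    right; linarith

/-- Both sides scale like `rate n`ᵏ, so one j serves all generations. This uniformity makes the
separation constant of the zeros independent of k. -/
theorem exists_rate_pow_lt (n : ℕ) [NeZero n] :
    ∃ j, 1 ≤ j ∧ ∀ k, 12 * 2 ^ n * rate n ^ (k + 2) < rate n ^ (k + 1 + j) := by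
  obtain ⟨j, hj⟩ := pow_unbounded_of_one_lt (12 * 2 ^ n * rate n) (one_lt_rate n)
  refine ⟨j + 1, by omega, fun k => ?_⟩
  have hr := rate_pos n
  have h1 := one_lt_rate n
  calc _ = rate n ^ (k + 1) * (12 * 2 ^ n * rate n) := by ring
    _ < rate n ^ (k + 1) * rate n ^ j := by gcongr
    _ ≤ rate n ^ (k + 1) * rate n ^ (j + 1) := by gcongr <;> linarith
    _ = _ := by ring

/-- Zeros of the Riesz transform of the Cantor measure keep away from the Cantor set. -/
theorem exists_separation_of_zeros (n : ℕ) [NeZero n] :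
    ∃ c : ℝ, 0 < c ∧ c ≤ 1 ∧ ∀ (k : ℕ) (w : Fin k → Bool) (t : ℝ), t ∈ cantorGap w →
      ∫ b, lineKernel n t (cantorPoint b) ∂coin = 0 →
      ∀ b, c * (1 / 3 ^ k) ≤ |cantorPoint b - t| := by
  obtain ⟨j, hj1, hj⟩ := exists_rate_pow_lt n
  -- Within 3⁻⁽ᵏ⁺¹⁺ʲ⁾ of either end of the gap the sign of the transform is forced, so no zero can
  -- be there.
  refine ⟨1 / 3 ^ (1 + j), third_pow_pos _, ?_, fun k w t ht h0 b => ?_⟩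
  · exact (third_pow_anti (Nat.zero_le _)).trans_eq (by simp)
  obtain ⟨b₀, rfl⟩ := exists_word_eq w
  have he : (1 : ℝ) / 3 ^ (1 + j) * (1 / 3 ^ k) = 1 / 3 ^ (k + 1 + j) := by
    rw [add_assoc, pow_add 3 k]; field_simp
  rw [he]
  rcases cantorPoint_le_or_ge b₀ b k with h | h
  · by_contra hcon
    rw [le_abs, not_or] at hcon
    exact (integral_lineKernel_neg_of_near_left hj1 (hj k) ht (by linarith)).ne h0
  · by_contra hcon
    rw [le_abs, not_or] at hcon
    exact (integral_lineKernel_pos_of_near_right hj1 (hj k) ht (by linarith)).ne' h0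

/-- The transform is negative near the left end of the gap and positive near the right end. It is
continuous on the gap shrunk by ε at both ends, where the kernel is bounded uniformly, and the
intermediate value theorem applies. -/
theorem exists_zero_mem_cantorGap (n : ℕ) [NeZero n] {k : ℕ} (w : Fin k → Bool) :
    ∃ t ∈ cantorGap w, ∫ b, lineKernel n t (cantorPoint b) ∂coin = 0 := by
  obtain ⟨j, hj1, hj⟩ := exists_rate_pow_lt n
  obtain ⟨b₀, rfl⟩ := exists_word_eq w
  have h9 := third_pow_add_le (k := k) hj1
  have h8 := third_pow_pos k
  have h7 := third_pow_pos (k + 1 + j)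
  set ε : ℝ := 1 / 3 ^ (k + 1 + j)
  obtain ⟨l, hl⟩ : ∃ l, l = leftEnd (word b₀ k) + 1 / 3 ^ k / 3 + ε := ⟨_, rfl⟩
  obtain ⟨u, hu⟩ : ∃ u, u = leftEnd (word b₀ k) + 2 * (1 / 3 ^ k / 3) - ε := ⟨_, rfl⟩
  have hsub : Icc l u ⊆ cantorGap (word b₀ k) := fun t ht => mem_cantorGap_word.2
    ⟨by linarith [ht.1], by linarith [ht.2]⟩
  have hlu : l ≤ u := by linarith
  have hsep : ∀ t ∈ Icc l u, ∀ b, ε * 1 ≤ |cantorPoint b - t| := fun t ht b => by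
    rw [mul_one, le_abs]
    rcases cantorPoint_le_or_ge b₀ b k with h | h
    · right; linarith [ht.1]
    · left; linarith [ht.2]
  have hcont : ContinuousOn (fun t => ∫ b, lineKernel n t (cantorPoint b) ∂coin) (Icc l u) := by
    refine continuousOn_of_dominated (bound := fun _ => ε ^ (-(n : ℝ)) * 1 ^ (-(n : ℝ)))
      (fun t _ => ((measurable_lineKernel n t).comp
        measurable_cantorPoint).aestronglyMeasurable) (fun t ht => ae_of_all _ fun b => ?_)
      (integrable_const _) (ae_of_all _ fun b => ?_)
    · exact abs_lineKernel_le h7 one_pos (hsep t ht b)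
    · unfold lineKernel
      refine ContinuousOn.div (by fun_prop) (by fun_prop) fun t ht => ?_
      have := hsep t ht b
      have : 0 < |cantorPoint b - t| := by linarith
      positivity
  obtain ⟨t, ht, h0⟩ := intermediate_value_Icc hlu hcont
    (show (0 : ℝ) ∈ Icc _ _ from
      ⟨(integral_lineKernel_neg_of_near_left hj1 (hj k) (hsub (left_mem_Icc.2 hlu)) hl.le).le,
       (integral_lineKernel_pos_of_near_right hj1 (hj k) (hsub (right_mem_Icc.2 hlu)) hu.ge).le⟩)
  exact ⟨t, hsub ht, h0⟩

theorem riesz_omega_axisPoint (n : ℕ) [NeZero n] (t : ℝ) :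
    riesz (omega n) 1 (axisPoint n t) = ∫ b, lineKernel n t (cantorPoint b) ∂coin := by
  simp [riesz, integral_omega, rieszKernel_axisPoint]

theorem exists_isZeroSelection (n : ℕ) [NeZero n] : ∃ z, IsZeroSelection n z := by
  choose t ht h0 using fun (k : ℕ) (w : Fin k → Bool) => exists_zero_mem_cantorGap n w
  exact ⟨fun k w => axisPoint n (t k w), fun k w =>
    ⟨mem_image_of_mem _ (ht k w), by rw [riesz_omega_axisPoint, h0]⟩⟩

/-- Points of the gaps, as close to the Cantor set as their gap is long, up to the factor `c`, at
which the Riesz transform of the Cantor measure vanishes. -/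
structure IsSeparatedZeros (n : ℕ) (c : ℝ) (ζ : ∀ k : ℕ, (Fin k → Bool) → ℝ) : Prop where
  pos : 0 < c
  le_one : c ≤ 1
  mem_gap : ∀ k w, ζ k w ∈ cantorGap w
  sep : ∀ k w b, c * (1 / 3 ^ k) ≤ |cantorPoint b - ζ k w|
  zero : ∀ k w, ∫ b, lineKernel n (ζ k w) (cantorPoint b) ∂coin = 0

theorem IsZeroSelection.exists_isSeparatedZeros {n : ℕ} [NeZero n]
    {z : ∀ k : ℕ, (Fin k → Bool) → EuclideanSpace ℝ (Fin n)} (hz : IsZeroSelection n z) :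
    ∃ c ζ, IsSeparatedZeros n c ζ ∧ z = fun k w => axisPoint n (ζ k w) := by
  obtain ⟨c, hc, hc1, h⟩ := exists_separation_of_zeros n
  choose ζ hζ hzζ using fun k w => (hz k w).1
  have h0 : ∀ k w, ∫ b, lineKernel n (ζ k w) (cantorPoint b) ∂coin = 0 := fun k w => by
    rw [← riesz_omega_axisPoint, hzζ]; exact (hz k w).2
  exact ⟨c, ζ, ⟨hc, hc1, hζ, fun k w => h k w _ (hζ k w) (h0 k w), h0⟩,
    funext fun k => funext fun w => (hzζ k w).symm⟩

/-! ### The discrete measure -/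

/-- The ratio of the masses at consecutive generations, times two. -/
noncomputable def theta (n : ℕ) (q : ℝ) : ℝ := rate n ^ (-q)

theorem theta_pos (n : ℕ) [NeZero n] (q : ℝ) : 0 < theta n q := Real.rpow_pos_of_pos (rate_pos n) _

theorem theta_lt_one (n : ℕ) [NeZero n] {q : ℝ} (hq : 0 < q) : theta n q < 1 :=
  Real.rpow_lt_one_of_one_lt_of_neg (one_lt_rate n) (by linarith)

theorem rate_pow_rpow (n : ℕ) [NeZero n] (q : ℝ) (k : ℕ) : (rate n ^ k) ^ q = (theta n q ^ k)⁻¹ := by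
  have h := (rate_pos n).le
  rw [theta, Real.rpow_neg h, inv_pow, inv_inv, ← Real.rpow_natCast, ← Real.rpow_mul h, mul_comm,
    Real.rpow_mul h, Real.rpow_natCast]

theorem mass_eq (n : ℕ) (p : ℝ) (k : ℕ) : mass n p k = 2⁻¹ ^ k * theta n p.conjExponent ^ k := by
  rw [mass, theta, rate]
  generalize p.conjExponent = q
  rw [Real.rpow_neg (by positivity), Real.div_rpow (by positivity) (by positivity), inv_div,
    ← mul_pow, ← Real.rpow_natCast (_ * _), mul_div_assoc', Real.div_rpow (by positivity)
    (by positivity), ← Real.rpow_natCast 3 n, ← Real.rpow_mul (by norm_num),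
    ← Real.rpow_mul (by norm_num)]
  congr 1
  · rw [← Real.rpow_neg_one, ← Real.rpow_add (by norm_num), ← Real.rpow_mul (by norm_num)]
    congr 1; ring
  · congr 1; ring

section Sigma

variable {n : ℕ} {p : ℝ} {z : ∀ k : ℕ, (Fin k → Bool) → EuclideanSpace ℝ (Fin n)}

/-- Each of the 2ᵏ atoms of generation k has mass 2⁻ᵏθᵏ, so generation k is θᵏ times the law of the
zero attached to the first k bits of a random sequence. -/
theorem lintegral_sigma (F : EuclideanSpace ℝ (Fin n) → ℝ≥0∞) :
    ∫⁻ x, F x ∂sigma n p z = ∑' k, ENNReal.ofReal (theta n p.conjExponent ^ k) *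
      ∫⁻ b, F (z k (word b k)) ∂coin := by
  rw [sigma, lintegral_sum_measure, ENNReal.tsum_sigma fun k (w : Fin k → Bool) =>
    ∫⁻ x, F x ∂(ENNReal.ofReal (mass n p k) • Measure.dirac (z k w))]
  refine tsum_congr fun k => ?_
  rw [tsum_fintype, lintegral_word fun w => F (z k w), ← mul_assoc, Finset.mul_sum]
  refine Finset.sum_congr rfl fun w _ => ?_
  rw [lintegral_smul_measure, lintegral_dirac, smul_eq_mul, mass_eq, mul_comm (2⁻¹ ^ k),
    ENNReal.ofReal_mul' (by positivity), ENNReal.ofReal_pow (p := 2⁻¹) (by norm_num),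
    ENNReal.ofReal_inv_of_pos two_pos, ENNReal.ofReal_ofNat]

theorem sigma_apply {s : Set (EuclideanSpace ℝ (Fin n))} (hs : MeasurableSet s) :
    sigma n p z s = ∑' k, ENNReal.ofReal (theta n p.conjExponent ^ k) *
      ∫⁻ b, s.indicator 1 (z k (word b k)) ∂coin := by
  rw [← lintegral_sigma, lintegral_indicator_one hs]

theorem ae_sigma_of_forall {P : EuclideanSpace ℝ (Fin n) → Prop} (h : ∀ k w, P (z k w)) :
    ∀ᵐ x ∂sigma n p z, P x := by
  rw [sigma, Measure.ae_sum_iff]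
  intro i
  refine Measure.ae_smul_measure ?_ _
  rw [ae_dirac_eq]
  exact h i.1 i.2

theorem tsum_geometric_tail {θ A : ℝ} (hθ : 0 < θ) (hθ1 : θ < 1) (hA : 0 ≤ A) (J : ℕ) :
    ∑' m, (if J ≤ m then ENNReal.ofReal (A * θ ^ m) else 0) =
      ENNReal.ofReal (A * θ ^ J / (1 - θ)) := by
  rw [← ENNReal.summable.sum_add_tsum_nat_add' (k := J)]
  rw [Finset.sum_eq_zero fun i hi => by
    rw [if_neg (not_le.2 (Finset.mem_range.1 hi))], zero_add]
  simp only [le_add_iff_nonneg_left, Nat.zero_le, if_true]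
  rw [← ENNReal.ofReal_tsum_of_nonneg (fun m => by positivity)]
  · congr 1
    simp_rw [pow_add]
    rw [tsum_mul_left, tsum_mul_right, tsum_geometric_of_lt_one hθ.le hθ1]
    field_simp
  · simp_rw [pow_add]
    exact ((summable_geometric_of_lt_one hθ.le hθ1).mul_right _).mul_left _

theorem tsum_geometric {θ A : ℝ} (hθ : 0 < θ) (hθ1 : θ < 1) (hA : 0 ≤ A) :
    ∑' m : ℕ, ENNReal.ofReal (A * θ ^ m) = ENNReal.ofReal (A / (1 - θ)) := by
  simpa using tsum_geometric_tail hθ hθ1 hA 0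

theorem sigma_univ [NeZero n] (hp : 1 < p) :
    sigma n p z univ = ENNReal.ofReal (1 / (1 - theta n p.conjExponent)) := by
  have hq := (Real.HolderConjugate.conjExponent hp).symm.pos
  rw [sigma_apply MeasurableSet.univ,
    ← tsum_geometric (theta_pos n _) (theta_lt_one n hq) zero_le_one]
  simp

theorem isFiniteMeasure_sigma [NeZero n] (hp : 1 < p) : IsFiniteMeasure (sigma n p z) :=
  ⟨by rw [sigma_univ hp]; exact ENNReal.ofReal_lt_top⟩

end Sigma

/-! ### The forward testing condition -/

theorem measurable_rieszKernel {n : ℕ} [NeZero n] :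
    Measurable fun q : EuclideanSpace ℝ (Fin n) × EuclideanSpace ℝ (Fin n) =>
      rieszKernel q.1 q.2 := by
  have h : ∀ i : Fin n, Measurable fun x : EuclideanSpace ℝ (Fin n) => x i := fun i =>
    (EuclideanSpace.proj (𝕜 := ℝ) i).continuous.measurable
  unfold rieszKernel
  exact ((h 0).comp measurable_snd |>.sub ((h 0).comp measurable_fst)).div
    ((measurable_snd.sub measurable_fst).norm.pow_const _)

theorem measurableSet_lt_norm_sub {n : ℕ} (δ : ℝ) (x : EuclideanSpace ℝ (Fin n)) :
    MeasurableSet {y | δ < ‖y - x‖} :=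
  measurableSet_lt measurable_const (measurable_id.sub_const x).norm

theorem enorm_rieszTrunc_indicator_le {n : ℕ} [NeZero n] (δ : ℝ)
    (μ : Measure (EuclideanSpace ℝ (Fin n))) (Q : Set (EuclideanSpace ℝ (Fin n)))
    (x : EuclideanSpace ℝ (Fin n)) :
    ‖rieszTrunc δ μ (Q.indicator 1) x‖ₑ ≤
      ∫⁻ y, (Q ∩ {y | δ < ‖y - x‖}).indicator (fun y => ‖rieszKernel x y‖ₑ) y ∂μ := by
  refine (enorm_integral_le_lintegral_enorm _).trans_eq ?_
  rw [← lintegral_indicator (measurableSet_lt_norm_sub δ x)]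
  congr 1 with y
  by_cases h1 : y ∈ Q <;> by_cases h2 : y ∈ {y | δ < ‖y - x‖} <;> simp [indicator, h1, h2]

theorem enorm_rieszKernel_axisPoint (n : ℕ) [NeZero n] (s t : ℝ) :
    ‖rieszKernel (axisPoint n s) (axisPoint n t)‖ₑ = ENNReal.ofReal |lineKernel n s t| := by
  rw [rieszKernel_axisPoint, Real.enorm_eq_ofReal_abs]

namespace IsSeparatedZeros

variable {n : ℕ} {c : ℝ} {ζ : ∀ k : ℕ, (Fin k → Bool) → ℝ} (hζ : IsSeparatedZeros n c ζ)
include hζ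

theorem mem_interval (k : ℕ) (w : Fin k → Bool) : ζ k w ∈ cantorInterval w :=
  cantorGap_subset_cantorInterval w (hζ.mem_gap k w)

theorem abs_sub_le (b : ℕ → Bool) (m : ℕ) : |cantorPoint b - ζ m (word b m)| ≤ 1 / 3 ^ m := by
  have h1 := cantorPoint_mem_cantorInterval b m
  have h2 := hζ.mem_interval m (word b m)
  rw [cantorInterval, mem_Icc] at h1 h2
  rw [abs_le]
  constructor <;> linarith

/-- The zero lies within 3⁻ᵐ of the Cantor point of b but at least c·3⁻ᵐ from every Cantor point.
Seen from the Cantor set, it can be replaced by that Cantor point at resolution 3⁻ᵐ. -/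
theorem mul_max_le_abs_sub (b b₀ : ℕ → Bool) (m : ℕ) :
    c / 3 * max (1 / 3 ^ m) |cantorPoint b - cantorPoint b₀| ≤
      |ζ m (word b m) - cantorPoint b₀| := by
  have h1 := hζ.sep m (word b m) b₀
  rw [abs_sub_comm] at h1
  have h2 := hζ.abs_sub_le b m
  have h3 := _root_.abs_sub_le (cantorPoint b) (ζ m (word b m)) (cantorPoint b₀)
  have hc := hζ.pos
  have hc1 := hζ.le_one
  have hm := third_pow_pos m
  rw [mul_max_of_nonneg _ _ (by positivity), max_le_iff]
  constructor <;> nlinarith [abs_nonneg (ζ m (word b m) - cantorPoint b₀)]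

theorem lintegral_lineKernel_le [NeZero n] (b₀ : ℕ → Bool) (m : ℕ) :
    ∫⁻ b, ENNReal.ofReal |lineKernel n (cantorPoint b₀) (ζ m (word b m))| ∂coin ≤
      ENNReal.ofReal (12 * (c / 3) ^ (-(n : ℝ)) * rate n ^ m) :=
  lintegral_le_of_le_lineKernel (by have := hζ.pos; positivity) (cantorPoint b₀) (cantorPoint b₀) m
    (v := fun b => ζ m (word b m)) fun b _ => ⟨le_rfl, hζ.mul_max_le_abs_sub b b₀ m⟩

/-- Generation m contributes at most a constant times θ(q)ᵐ·`rate n`ᵐ = θ(q-1)ᵐ, and generations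
before k do not meet S. What is left is a geometric tail. -/
theorem potential_le [NeZero n] {p q : ℝ} (hq : 1 < q) (hpq : p.conjExponent = q)
    (b₀ : ℕ → Bool) (S : Set (EuclideanSpace ℝ (Fin n))) (k : ℕ)
    (hk : ∀ m < k, ∀ w, axisPoint n (ζ m w) ∉ S) :
    ∫⁻ y, S.indicator (fun y => ‖rieszKernel (axisPoint n (cantorPoint b₀)) y‖ₑ) y
        ∂sigma n p (fun k w => axisPoint n (ζ k w)) ≤
      ENNReal.ofReal (12 * (c / 3) ^ (-(n : ℝ)) * theta n (q - 1) ^ k / (1 - theta n (q - 1))) := by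
  have hc := hζ.pos
  have hr := rate_pos n
  rw [lintegral_sigma, hpq, ← tsum_geometric_tail (theta_pos n (q - 1))
    (theta_lt_one n (by linarith)) (by positivity)]
  refine ENNReal.tsum_le_tsum fun m => ?_
  split_ifs with hm
  · calc _ ≤ ENNReal.ofReal (theta n q ^ m) *
        ENNReal.ofReal (12 * (c / 3) ^ (-(n : ℝ)) * rate n ^ m) := by
          gcongr
          refine (lintegral_mono fun b => ?_).trans (hζ.lintegral_lineKernel_le b₀ m)
          rw [← enorm_rieszKernel_axisPoint]
          exact indicator_le_self _ _ _
      _ = _ := by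
          rw [← ENNReal.ofReal_mul (by have := theta_pos n q; positivity), mul_left_comm,
            ← mul_pow]
          congr 4
          rw [theta, theta, ← Real.rpow_add_one hr.ne']
          congr 1; ring
  · rw [lintegral_eq_zero_of_ae_eq_zero, mul_zero]
    exact ae_of_all _ fun b => indicator_of_notMem (hk m (not_le.1 hm) _) _

/-- The gap of the common word separates s from t, so its zero lies between them, and an interval
that contains both contains it. -/
theorem mem_of_first_difference {I : Set ℝ} (hI : I.OrdConnected) {b b' : ℕ → Bool} {i k m : ℕ}
    (hik : i < k) (him : i < m) (hw : word b i = word b' i) (hne : b i ≠ b' i) {s t : ℝ}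
    (hs : s ∈ cantorInterval (word b k)) (ht : t ∈ cantorInterval (word b' m))
    (hsI : s ∈ I) (htI : t ∈ I) : ζ i (word b i) ∈ I := by
  obtain ⟨h1, h2⟩ := mem_cantorGap_word.1 (hζ.mem_gap i (word b i))
  cases hb : b i <;> cases hb' : b' i <;> simp only [hb, hb', ne_eq, not_true_eq_false] at hne
  · have h3 := mem_cantorInterval_lower hik hb hs
    have h4 := mem_cantorInterval_upper him hb' ht
    rw [← hw] at h4
    exact hI.out hsI htI ⟨by linarith, by linarith⟩
  · have h3 := mem_cantorInterval_upper hik hb hs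
    have h4 := mem_cantorInterval_lower him hb' ht
    rw [← hw] at h4
    exact hI.out htI hsI ⟨by linarith, by linarith⟩

/-- An absolute-value estimate. With k the earliest generation of a zero in Q, any two points of Q
among Cantor points and this zero share k bits, since a separating gap would have an earlier zero in
Q. The mass of the one atom then dominates the left-hand side. -/
theorem forward_testing [NeZero n] {p q : ℝ} (hpq : p.HolderConjugate q) :
    ∃ T : ℝ≥0, ∀ (δ : ℝ) (Q : Set (EuclideanSpace ℝ (Fin n))), MeasurableSet Q →
      (axisPoint n ⁻¹' Q).OrdConnected →
      ∫⁻ x in Q, ‖rieszTrunc δ (sigma n p fun k w => axisPoint n (ζ k w)) (Q.indicator 1) x‖ₑ ^ p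
        ∂omega n ≤ (T : ℝ≥0∞) ^ p * sigma n p (fun k w => axisPoint n (ζ k w)) Q := by
  classical
  have hη := theta_lt_one n (q := q - 1) hpq.symm.sub_one_pos
  have hη0 := theta_pos n (q - 1)
  have hθ0 := theta_pos n q
  have hc := hζ.pos
  have hsub : 0 < 1 - theta n (q - 1) := by linarith
  set σ := sigma n p fun k w => axisPoint n (ζ k w)
  refine ⟨Real.toNNReal (12 * (c / 3) ^ (-(n : ℝ)) / (1 - theta n (q - 1))), fun δ Q hQ hI => ?_⟩
  rw [← lintegral_indicator hQ, lintegral_omega]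
  have hle : ∀ x, ‖rieszTrunc δ σ (Q.indicator 1) x‖ₑ ≤
      ∫⁻ y, Q.indicator (fun y => ‖rieszKernel x y‖ₑ) y ∂σ := fun x =>
    (enorm_rieszTrunc_indicator_le δ σ Q x).trans (lintegral_mono
      (indicator_le_indicator_of_subset inter_subset_left fun _ => zero_le))
  by_cases hex : ∃ k w, axisPoint n (ζ k w) ∈ Q
  swap
  · push Not at hex
    have hz : ∀ x, ‖rieszTrunc δ σ (Q.indicator 1) x‖ₑ = 0 := fun x => by
      refine le_antisymm ((hle x).trans_eq ?_) zero_le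
      refine lintegral_eq_zero_of_ae_eq_zero ?_
      exact ae_sigma_of_forall fun k w => indicator_of_notMem (hex k w) _
    simp [hz, ENNReal.zero_rpow_of_pos hpq.pos]
  obtain ⟨k, ⟨w, hw⟩, hmin⟩ : ∃ k, (∃ w, axisPoint n (ζ k w) ∈ Q) ∧
      ∀ m < k, ∀ w, axisPoint n (ζ m w) ∉ Q :=
    ⟨Nat.find hex, Nat.find_spec hex, fun m hm w hmem => Nat.find_min hex hm ⟨w, hmem⟩⟩
  obtain ⟨b₀, rfl⟩ := exists_word_eq w
  have hword : ∀ b, axisPoint n (cantorPoint b) ∈ Q → word b k = word b₀ k := fun b hb => by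
    by_contra hne
    obtain ⟨i, hik, hwi, hi⟩ := exists_first_difference hne
    exact hmin i hik _ (hζ.mem_of_first_difference hI hik hik hwi hi
      (cantorPoint_mem_cantorInterval b k) (hζ.mem_interval k _) hb hw)
  set C := 12 * (c / 3) ^ (-(n : ℝ)) / (1 - theta n (q - 1)) with hC
  have hC0 : 0 ≤ C := by positivity
  -- The identity (q - 1)p = q turns the p-th power of the potential bound into θ(q)ᵏ, the factor in
  -- the mass of an atom of generation k.
  have hpow : (C * theta n (q - 1) ^ k) ^ p = C ^ p * theta n q ^ k := by
    rw [Real.mul_rpow hC0 (by positivity), ← Real.rpow_natCast, ← Real.rpow_mul hη0.le,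
      mul_comm (k : ℝ), Real.rpow_mul hη0.le, Real.rpow_natCast]
    congr 2
    rw [theta, theta, ← Real.rpow_mul (rate_pos n).le]
    congr 1
    have := hpq.symm.sub_one_mul_conj
    linarith
  calc _ ≤ ∫⁻ b, {b | word b k = word b₀ k}.indicator
        (fun _ => ENNReal.ofReal (C ^ p * theta n q ^ k)) b ∂coin := by
        refine lintegral_mono fun b => ?_
        by_cases hb : axisPoint n (cantorPoint b) ∈ Q
        · rw [indicator_of_mem hb, indicator_of_mem (by exact hword b hb), ← hpow,
            ← ENNReal.ofReal_rpow_of_nonneg (by positivity) hpq.nonneg]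
          refine ENNReal.rpow_le_rpow ((hle _).trans ?_) hpq.nonneg
          refine (hζ.potential_le hpq.symm.lt hpq.conjExponent_eq b Q k hmin).trans_eq ?_
          rw [hC]; congr 1; ring
        · rw [indicator_of_notMem hb]; exact zero_le
    _ = ENNReal.ofReal (C ^ p) * (ENNReal.ofReal (theta n q ^ k) * 2⁻¹ ^ k) := by
        rw [lintegral_indicator_const (measurableSet_word_eq _), coin_word_eq,
          ENNReal.ofReal_mul (by positivity), mul_assoc]
    _ ≤ ENNReal.ofReal (C ^ p) * σ Q := by
        gcongr
        rw [sigma_apply hQ, hpq.conjExponent_eq]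
        refine le_trans ?_ (ENNReal.le_tsum k)
        gcongr
        rw [← coin_word_eq (word b₀ k), ← lintegral_indicator_one (measurableSet_word_eq _)]
        refine lintegral_mono fun b => ?_
        by_cases hb : word b k = word b₀ k
        · rw [hb, indicator_of_mem hw]
          exact indicator_le_self' (fun _ _ => zero_le) _
        · rw [indicator_of_notMem (by exact hb)]; exact zero_le
    _ = _ := by
        rw [← ENNReal.ofReal_rpow_of_nonneg hC0 hpq.nonneg]
        rfl

end IsSeparatedZeros

/-! ### The backward testing condition -/

theorem measurableSet_cantorPoint_mem {n : ℕ} [NeZero n] {Q : Set (EuclideanSpace ℝ (Fin n))}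
    (hQ : MeasurableSet Q) : MeasurableSet {b | axisPoint n (cantorPoint b) ∈ Q} :=
  (measurableEmbedding_axisPoint_cantorPoint n).measurable hQ

theorem enorm_rieszTrunc_omega_le (n : ℕ) [NeZero n] (δ t : ℝ)
    (Q : Set (EuclideanSpace ℝ (Fin n))) :
    ‖rieszTrunc δ (omega n) (Q.indicator 1) (axisPoint n t)‖ₑ ≤
      ∫⁻ b, {b | axisPoint n (cantorPoint b) ∈ Q ∧ δ < |cantorPoint b - t|}.indicator
        (fun b => ENNReal.ofReal |lineKernel n t (cantorPoint b)|) b ∂coin := by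
  refine (enorm_rieszTrunc_indicator_le _ _ _ _).trans_eq ?_
  rw [lintegral_omega]
  congr 1 with b
  have h : axisPoint n (cantorPoint b) ∈ Q ∩ {y | δ < ‖y - axisPoint n t‖} ↔
      b ∈ {b | axisPoint n (cantorPoint b) ∈ Q ∧ δ < |cantorPoint b - t|} := by
    simp only [mem_inter_iff, mem_ofPred_eq, norm_axisPoint_sub]
  by_cases hb : b ∈ {b | axisPoint n (cantorPoint b) ∈ Q ∧ δ < |cantorPoint b - t|}
  · rw [indicator_of_mem hb, indicator_of_mem (h.2 hb), enorm_rieszKernel_axisPoint]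
  · rw [indicator_of_notMem hb, indicator_of_notMem (mt h.1 hb)]

/-- Below the distance to the Cantor set and at a zero of `R₁ω`, the truncated transform of `1_Q ω`
is controlled by the part of `ω` outside `Q`. -/
theorem enorm_rieszTrunc_omega_le_of_zero {n : ℕ} [NeZero n] {δ r t : ℝ} (hr : 0 < r)
    {Q : Set (EuclideanSpace ℝ (Fin n))} (hQ : MeasurableSet Q)
    (hsep : ∀ b, r ≤ |cantorPoint b - t|) (hδ : δ < r)
    (h0 : ∫ b, lineKernel n t (cantorPoint b) ∂coin = 0) :
    ‖rieszTrunc δ (omega n) (Q.indicator 1) (axisPoint n t)‖ₑ ≤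
      ∫⁻ b, {b | axisPoint n (cantorPoint b) ∉ Q}.indicator
        (fun b => ENNReal.ofReal |lineKernel n t (cantorPoint b)|) b ∂coin := by
  have hint := integrable_lineKernel (n := n) hr hsep
  set E : Set (ℕ → Bool) := {b | axisPoint n (cantorPoint b) ∈ Q}
  have hE : MeasurableSet E := measurableSet_cantorPoint_mem hQ
  have h1 : rieszTrunc δ (omega n) (Q.indicator 1) (axisPoint n t) =
      ∫ b in E, lineKernel n t (cantorPoint b) ∂coin := by
    rw [rieszTrunc, ← integral_indicator (measurableSet_lt_norm_sub _ _), integral_omega,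
      ← integral_indicator hE]
    congr 1 with b
    rw [indicator_of_mem (by
      rw [mem_ofPred_eq, norm_axisPoint_sub]; exact hδ.trans_le (hsep b)), rieszKernel_axisPoint]
    by_cases hb : b ∈ E
    · rw [indicator_of_mem hb, indicator_of_mem (by exact hb)]; simp
    · rw [indicator_of_notMem hb, indicator_of_notMem (by exact hb)]; simp
  have h2 := integral_add_compl hE hint
  rw [h0] at h2
  rw [h1, eq_neg_of_add_eq_zero_left h2, enorm_neg]
  refine (enorm_integral_le_lintegral_enorm _).trans_eq ?_
  rw [← lintegral_indicator hE.compl]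
  congr 1 with b
  simp only [indicator, Real.enorm_eq_ofReal_abs]
  rfl

/-- All Cantor points below the word formed by the first `k` bits of `b` belong to `Q`. -/
def IsFull (n : ℕ) [NeZero n] (Q : Set (EuclideanSpace ℝ (Fin n))) {k : ℕ} (w : Fin k → Bool) :
    Prop :=
  ∀ b, word b k = w → axisPoint n (cantorPoint b) ∈ Q

/-- The child of a word. -/
def child {k : ℕ} (w : Fin k → Bool) (e : Bool) : Fin (k + 1) → Bool := Fin.snoc w e

theorem word_succ_eq_child_iff {b : ℕ → Bool} {k : ℕ} {w : Fin k → Bool} {e : Bool} :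
    word b (k + 1) = child w e ↔ word b k = w ∧ b k = e := by
  constructor
  · intro h
    refine ⟨funext fun i => ?_, ?_⟩
    · simpa [child, word] using congrFun h i.castSucc
    · simpa [child, word] using congrFun h (Fin.last k)
  · rintro ⟨rfl, rfl⟩
    funext i
    refine Fin.lastCases ?_ (fun i => ?_) i <;> simp [child, word]

/-- Truncation at δ can interfere only from the first generation J with c·3⁻ᴶ ≤ δ on. From there on
the truncated transform is O(`rate n`ᴶ), whose q-th power θ⁻ᴶ is absorbed by the tail of the series
of θᵐ. -/
theorem tsum_truncation_le {n : ℕ} [NeZero n] {q c δ D : ℝ} (hq : 1 < q) (hD : 0 ≤ D)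
    {F : ℕ → ℝ≥0∞}
    (hF : ∀ J m, c * (1 / 3 ^ J) ≤ δ → F m ≤ ENNReal.ofReal (D * rate n ^ J)) :
    ∑' m, (if c * (1 / 3 ^ m) ≤ δ then ENNReal.ofReal (theta n q ^ m) * F m ^ q else 0) ≤
      ENNReal.ofReal (D ^ q / (1 - theta n q)) := by
  classical
  have hθ := theta_pos n q
  have hr := rate_pos n
  by_cases hex : ∃ J : ℕ, c * (1 / 3 ^ J) ≤ δ
  swap
  · push Not at hex
    rw [ENNReal.tsum_eq_zero.2 fun m => if_neg (not_le.2 (hex m))]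
    exact zero_le
  set J := Nat.find hex with hJ
  have h1 : D ^ q / (1 - theta n q) =
      D ^ q * (theta n q ^ J)⁻¹ * theta n q ^ J / (1 - theta n q) := by
    field_simp
  rw [h1, ← tsum_geometric_tail hθ (theta_lt_one n (by linarith)) (by positivity)]
  refine ENNReal.tsum_le_tsum fun m => ?_
  split_ifs with h2 h3
  · calc _ ≤ ENNReal.ofReal (theta n q ^ m) * ENNReal.ofReal (D * rate n ^ J) ^ q := by
          gcongr
          exact hF J m (Nat.find_spec hex)
      _ = _ := by
          rw [ENNReal.ofReal_rpow_of_nonneg (by positivity) (by linarith),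
            Real.mul_rpow hD (by positivity), rate_pow_rpow, mul_comm,
            ENNReal.ofReal_mul (q := theta n q ^ m) (by positivity)]
  · exact absurd (Nat.find_min' hex h2) h3
  all_goals exact zero_le

namespace IsSeparatedZeros

variable {n : ℕ} [NeZero n] {c : ℝ} {ζ : ∀ k : ℕ, (Fin k → Bool) → ℝ}
  (hζ : IsSeparatedZeros n c ζ)
include hζ

omit [NeZero n] in
-- If the words disagree within their common length, the zero and the interval are separated. If the
-- word of the zero is a proper prefix, the zero lies in the middle third, which the deeper interval
-- avoids.
theorem word_eq_of_mem_cantorInterval {k m : ℕ} {b b₀ : ℕ → Bool}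
    (h : ζ m (word b m) ∈ cantorInterval (word b₀ k)) : k ≤ m ∧ word b k = word b₀ k := by
  have hagree : ∀ j, j ≤ k → j ≤ m → word b j = word b₀ j := fun j hjk hjm => by
    by_contra hne
    have := le_abs_sub_of_word_ne hjm hjk hne (hζ.mem_interval m (word b m)) h
    rw [sub_self, abs_zero] at this
    exact (third_pow_pos j).not_ge this
  have hkm : k ≤ m := by
    by_contra! hmk
    have hw := hagree m hmk.le le_rfl
    obtain ⟨h1, h2⟩ := mem_cantorGap_word.1 (hζ.mem_gap m (word b m))
    rw [hw] at h1 h2 h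
    cases hb : b₀ m
    · exact h1.not_ge (mem_cantorInterval_lower hmk hb h)
    · exact h2.not_ge (mem_cantorInterval_upper hmk hb h)
  exact ⟨hkm, hagree k le_rfl hkm⟩

variable {Q : Set (EuclideanSpace ℝ (Fin n))}

theorem enorm_le_rate (δ : ℝ) (b : ℕ → Bool) (m : ℕ) :
    ‖rieszTrunc δ (omega n) (Q.indicator 1) (axisPoint n (ζ m (word b m)))‖ₑ ≤
      ENNReal.ofReal (12 * c ^ (-(n : ℝ)) * rate n ^ m) :=
  (enorm_rieszTrunc_omega_le n δ _ Q).trans <|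
    lintegral_le_of_separated hζ.pos hζ.le_one _ m fun b' _ =>
      ⟨indicator_le_self _ _ _, hζ.sep _ _ b'⟩

theorem enorm_le_of_le_delta {δ : ℝ} {J : ℕ} (hJ : c * (1 / 3 ^ J) ≤ δ) (t : ℝ) :
    ‖rieszTrunc δ (omega n) (Q.indicator 1) (axisPoint n t)‖ₑ ≤
      ENNReal.ofReal (12 * c ^ (-(n : ℝ)) * rate n ^ J) :=
  (enorm_rieszTrunc_omega_le n δ _ Q).trans <|
    lintegral_le_of_separated hζ.pos hζ.le_one _ J fun _ hb' =>
      ⟨indicator_le_self _ _ _, hJ.trans (mem_of_indicator_ne_zero hb').2.le⟩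

/-- For δ below the separation the truncation removes nothing of ω. For k ≤ m the vanishing of R₁ω
moves the integral to the Cantor points outside Q; these differ from b within k bits and are at
least 3⁻ᵏ from the zero. -/
theorem enorm_le_of_isFull (hQ : MeasurableSet Q) {δ : ℝ} {b : ℕ → Bool} {k m : ℕ}
    (hδ : δ < c * (1 / 3 ^ m)) (hkm : k ≤ m + 1) (hk : IsFull n Q (word b k)) :
    ‖rieszTrunc δ (omega n) (Q.indicator 1) (axisPoint n (ζ m (word b m)))‖ₑ ≤
      ENNReal.ofReal (12 * c ^ (-(n : ℝ)) * rate n ^ k) := by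
  have hc := hζ.pos
  rcases Nat.le_or_eq_of_le_succ hkm with hkm | rfl
  · refine (enorm_rieszTrunc_omega_le_of_zero (mul_pos hc (third_pow_pos m)) hQ
      (hζ.sep _ _) hδ (hζ.zero _ _)).trans ?_
    refine lintegral_le_of_separated hc hζ.le_one _ k fun b' hb' =>
      ⟨indicator_le_self _ _ _, ?_⟩
    have hne : word b' k ≠ word b k := fun h => mem_of_indicator_ne_zero hb' (hk b' h)
    refine le_trans ?_ (le_abs_sub_of_word_ne le_rfl hkm hne (cantorPoint_mem_cantorInterval b' k)
      (hζ.mem_interval m (word b m)))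
    have := third_pow_pos k
    nlinarith [hζ.le_one]
  -- For k = m + 1 only a child of the word is known to be full. The bound without cancellation
  -- loses at most one factor `rate n`.
  · refine (hζ.enorm_le_rate δ b m).trans (ENNReal.ofReal_le_ofReal ?_)
    have h1 := one_lt_rate n
    gcongr
    · exact h1.le
    · omega

/-- The pathwise bound for the contributions of the words with a child contained in `Q`. -/
theorem tsum_isFull_le {q : ℝ} (hq : 1 < q) (hQ : MeasurableSet Q) (δ : ℝ) (b : ℕ → Bool) :
    ∑' m, {b | IsFull n Q (word b (m + 1))}.indicator (fun b => ENNReal.ofReal (theta n q ^ m) *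
        ‖rieszTrunc δ (omega n) (Q.indicator 1) (axisPoint n (ζ m (word b m)))‖ₑ ^ q) b ≤
      {b | axisPoint n (cantorPoint b) ∈ Q}.indicator (fun _ => ENNReal.ofReal
        ((12 * c ^ (-(n : ℝ))) ^ q * ((theta n q)⁻¹ + 1) / (1 - theta n q))) b := by
  classical
  have hθ := theta_pos n q
  have hθ1 := theta_lt_one n (show 0 < q by linarith)
  have hc := hζ.pos
  have hr := rate_pos n
  set D := 12 * c ^ (-(n : ℝ)) with hD
  have hD0 : 0 ≤ D := by positivity
  set F : ℕ → ℝ≥0∞ := fun m =>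
    ‖rieszTrunc δ (omega n) (Q.indicator 1) (axisPoint n (ζ m (word b m)))‖ₑ with hF
  by_cases hex : ∃ k, IsFull n Q (word b k)
  swap
  · push Not at hex
    rw [ENNReal.tsum_eq_zero.2 fun m => indicator_of_notMem (by exact hex _) _]
    exact zero_le
  set k := Nat.find hex with hk
  have hkfull : IsFull n Q (word b k) := Nat.find_spec hex
  rw [indicator_of_mem (by exact hkfull b rfl)]
  -- Generations whose zeros are farther than δ from the Cantor set use cancellation and the first
  -- full prefix, of length k; the others are left to `tsum_truncation_le`.
  have hsplit : ∀ m, {b | IsFull n Q (word b (m + 1))}.indicator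
      (fun b => ENNReal.ofReal (theta n q ^ m) *
        ‖rieszTrunc δ (omega n) (Q.indicator 1) (axisPoint n (ζ m (word b m)))‖ₑ ^ q) b ≤
      (if k - 1 ≤ m then ENNReal.ofReal (D ^ q * (theta n q ^ k)⁻¹ * theta n q ^ m) else 0) +
      (if c * (1 / 3 ^ m) ≤ δ then ENNReal.ofReal (theta n q ^ m) * F m ^ q else 0) := by
    intro m
    by_cases hm : IsFull n Q (word b (m + 1))
    swap
    · rw [indicator_of_notMem (by exact hm)]; exact zero_le
    rw [indicator_of_mem (by exact hm)]
    have hkm : k ≤ m + 1 := Nat.find_min' hex hm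
    rw [if_pos (by omega)]
    split_ifs with hδ
    · exact le_add_self
    · rw [add_zero]
      calc _ ≤ ENNReal.ofReal (theta n q ^ m) * ENNReal.ofReal (D * rate n ^ k) ^ q := by
            gcongr
            exact hζ.enorm_le_of_isFull hQ (not_le.1 hδ) hkm hkfull
        _ = _ := by
            rw [ENNReal.ofReal_rpow_of_nonneg (by positivity) (by linarith),
              Real.mul_rpow hD0 (by positivity), rate_pow_rpow, mul_comm,
              ENNReal.ofReal_mul (q := theta n q ^ m) (by positivity)]
  calc _ ≤ _ := ENNReal.tsum_le_tsum hsplit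
    _ ≤ ENNReal.ofReal (D ^ q * (theta n q ^ k)⁻¹ * theta n q ^ (k - 1) / (1 - theta n q)) +
        ENNReal.ofReal (D ^ q / (1 - theta n q)) := by
      rw [ENNReal.tsum_add, tsum_geometric_tail hθ hθ1 (by positivity)]
      gcongr
      exact tsum_truncation_le hq hD0 fun J m hJ => hζ.enorm_le_of_le_delta hJ _
    _ ≤ _ := by
      have h1 : 0 < 1 - theta n q := by linarith
      rw [← ENNReal.ofReal_add (by positivity) (by positivity), ← add_div, mul_assoc, mul_add,
        mul_one]
      refine ENNReal.ofReal_le_ofReal ?_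
      gcongr
      -- The subtraction in k - 1 is truncated: for k = 0 the quotient of the powers of θ is 1,
      -- which is still at most θ⁻¹.
      rw [inv_mul_le_iff₀ (by positivity), ← div_eq_mul_inv, le_div_iff₀ hθ, ← pow_succ]
      exact pow_le_pow_of_le_one hθ.le hθ1.le (by omega)

/-- A word is special if its zero belongs to `Q` but both of its children stick out of `Q`. -/
theorem special_bound {q : ℝ} (hq : 1 < q) (hI : (axisPoint n ⁻¹' Q).OrdConnected)
    (hQ : MeasurableSet Q) (δ : ℝ) :
    ∑' m, ∫⁻ b, {b | axisPoint n (ζ m (word b m)) ∈ Q ∧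
          ∀ e, ¬ IsFull n Q (child (word b m) e)}.indicator
        (fun b => ENNReal.ofReal (theta n q ^ m) *
          ‖rieszTrunc δ (omega n) (Q.indicator 1) (axisPoint n (ζ m (word b m)))‖ₑ ^ q) b ∂coin ≤
      ENNReal.ofReal ((c ^ (-(n : ℝ))) ^ q) * omega n Q := by
  classical
  have hθ := theta_pos n q
  have hc := hζ.pos
  -- Each child has a Cantor point outside Q, one on each side of the zero, which is in Q. Since the
  -- trace of Q on the axis is an interval, it cannot pass these points and stays in the interval of
  -- the word.
  have hloc : ∀ {k : ℕ} {b₀ : ℕ → Bool}, axisPoint n (ζ k (word b₀ k)) ∈ Q →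
      (∀ e, ¬ IsFull n Q (child (word b₀ k) e)) →
      ∀ t, axisPoint n t ∈ Q → t ∈ cantorInterval (word b₀ k) := by
    intro k b₀ hmem hsp t ht
    have h0 := hsp false
    have h1 := hsp true
    simp only [IsFull, word_succ_eq_child_iff, not_forall] at h0 h1
    obtain ⟨y₀, ⟨hw₀, hy₀⟩, hyQ₀⟩ := h0
    obtain ⟨y₁, ⟨hw₁, hy₁⟩, hyQ₁⟩ := h1
    obtain ⟨hg1, hg2⟩ := mem_cantorGap_word.1 (hζ.mem_gap k (word b₀ k))
    have hl := cantorPoint_lower hy₀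
    have hu := cantorPoint_upper hy₁
    have hl' := cantorPoint_mem_cantorInterval y₀ k
    have hu' := cantorPoint_mem_cantorInterval y₁ k
    rw [hw₀] at hl hl'
    rw [hw₁] at hu hu'
    refine ⟨hl'.1.trans ?_, le_trans ?_ hu'.2⟩
    · by_contra! hlt
      exact hyQ₀ (hI.out ht hmem ⟨hlt.le, by linarith⟩)
    · by_contra! hlt
      exact hyQ₁ (hI.out hmem ht ⟨by linarith, hlt.le⟩)
  by_cases hex : ∃ k b₀, axisPoint n (ζ k (word b₀ k)) ∈ Q ∧
    ∀ e, ¬ IsFull n Q (child (word b₀ k) e)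
  swap
  · push Not at hex
    rw [ENNReal.tsum_eq_zero.2 fun m => lintegral_eq_zero_of_ae_eq_zero <| ae_of_all _ fun b =>
      indicator_of_notMem (fun h => by obtain ⟨e, he⟩ := hex m b h.1; exact h.2 e he) _]
    exact zero_le
  obtain ⟨k, b₀, hmem, hsp⟩ := hex
  -- The zeros of two special words lie in each other's intervals, so the words coincide.
  have huniq : ∀ m b, axisPoint n (ζ m (word b m)) ∈ Q →
      (∀ e, ¬ IsFull n Q (child (word b m) e)) → m = k ∧ word b k = word b₀ k := by
    intro m b hm hms
    obtain ⟨h1, h2⟩ := hζ.word_eq_of_mem_cantorInterval (hloc hmem hsp _ hm)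
    obtain ⟨h3, -⟩ := hζ.word_eq_of_mem_cantorInterval (hloc hm hms _ hmem)
    exact ⟨le_antisymm h3 h1, h2⟩
  have hωk : omega n Q ≤ 2⁻¹ ^ k := by
    rw [omega_apply, ← coin_word_eq (word b₀ k)]
    refine measure_mono fun b hb => ?_
    exact funext ((cantorPoint_mem_cantorInterval_iff _ _).1 (hloc hmem hsp _ hb))
  have hval : ‖rieszTrunc δ (omega n) (Q.indicator 1) (axisPoint n (ζ k (word b₀ k)))‖ₑ ≤
      ENNReal.ofReal (c ^ (-(n : ℝ)) * 3 ^ (n * k)) * omega n Q := by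
    refine (enorm_rieszTrunc_omega_le n δ _ Q).trans ?_
    rw [omega_apply, ← lintegral_indicator_const (measurableSet_cantorPoint_mem hQ)]
    refine lintegral_mono fun b => ?_
    by_cases hb : axisPoint n (cantorPoint b) ∈ Q
    · rw [indicator_of_mem (show b ∈ {b | axisPoint n (cantorPoint b) ∈ Q} from hb)]
      refine (indicator_le_self _ _ _).trans (ENNReal.ofReal_le_ofReal ?_)
      refine (abs_lineKernel_le hc (third_pow_pos k) (hζ.sep k _ b)).trans_eq ?_
      rw [Real.rpow_neg (x := 1 / 3 ^ k) (by positivity), Real.rpow_natCast, one_div, inv_pow,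
        inv_inv, ← pow_mul, mul_comm k]
    · rw [indicator_of_notMem (fun h => hb h.1)]; exact zero_le
  rw [tsum_eq_single k fun m hm => lintegral_eq_zero_of_ae_eq_zero <| ae_of_all _ fun b =>
    indicator_of_notMem (fun h => hm (huniq m b h.1 h.2).1) _]
  calc _ ≤ ∫⁻ b, {b | word b k = word b₀ k}.indicator
        (fun _ => ENNReal.ofReal (theta n q ^ k) *
          (ENNReal.ofReal (c ^ (-(n : ℝ)) * 3 ^ (n * k)) * omega n Q) ^ q) b ∂coin := by
        refine lintegral_mono fun b => ?_
        by_cases h : axisPoint n (ζ k (word b k)) ∈ Q ∧ ∀ e, ¬ IsFull n Q (child (word b k) e)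
        · have hw := (huniq k b h.1 h.2).2
          rw [indicator_of_mem (by exact h), indicator_of_mem (by exact hw), hw]
          gcongr
        · rw [indicator_of_notMem (by exact h)]; exact zero_le
    _ = ENNReal.ofReal (theta n q ^ k * (c ^ (-(n : ℝ)) * 3 ^ (n * k)) ^ q) *
          2⁻¹ ^ k * omega n Q ^ q := by
        rw [lintegral_indicator_const (measurableSet_word_eq _), coin_word_eq,
          ENNReal.mul_rpow_of_nonneg _ _ (by linarith),
          ENNReal.ofReal_rpow_of_nonneg (by positivity) (by linarith),
          ENNReal.ofReal_mul (by positivity)]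
        ring
    -- Here θ(q)ᵏ·3^(nkq) = 2^(kq): the choice of the masses cancels the size of the kernel.
    _ = ENNReal.ofReal ((c ^ (-(n : ℝ))) ^ q) *
          (ENNReal.ofReal (2 ^ k * 2 ^ (k * (q - 1))) * 2⁻¹ ^ k * omega n Q ^ q) := by
        rw [← mul_assoc, ← mul_assoc, ← ENNReal.ofReal_mul (by positivity)]
        congr 3
        rw [Real.mul_rpow (by positivity) (by positivity), mul_left_comm]
        congr 1
        have h2 : (2 : ℝ) ^ k * 2 ^ (k * (q - 1)) = (2 ^ q) ^ k := by
          rw [← Real.rpow_natCast, ← Real.rpow_natCast, ← Real.rpow_mul (by norm_num),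
            ← Real.rpow_add (by norm_num)]
          congr 1; ring
        have h3 : ((3 : ℝ) ^ (n * k)) ^ q = ((3 ^ n) ^ q) ^ k := by
          rw [pow_mul, ← Real.rpow_natCast (3 ^ n) k, ← Real.rpow_natCast ((3 ^ n) ^ q) k,
            ← Real.rpow_mul (by positivity), ← Real.rpow_mul (by positivity), mul_comm]
        rw [h2, h3, ← mul_pow, theta, rate, Real.rpow_neg (by positivity),
          Real.div_rpow (by positivity) (by positivity), inv_div, div_mul_cancel₀]
        positivity
    _ ≤ _ := by
        gcongr
        have h1 : ENNReal.ofReal (2 ^ k * 2 ^ (k * (q - 1))) * 2⁻¹ ^ k =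
            (2 ^ k) ^ (q - 1) := by
          rw [mul_comm (2 ^ k : ℝ), ENNReal.ofReal_mul (by positivity),
            ENNReal.ofReal_pow (p := 2) (by norm_num), ENNReal.ofReal_ofNat, mul_assoc,
            ← mul_pow, ENNReal.mul_inv_cancel (by norm_num) (by norm_num), one_pow, mul_one,
            Real.rpow_mul (by norm_num), Real.rpow_natCast,
            ← ENNReal.ofReal_rpow_of_nonneg (by positivity) (by linarith),
            ENNReal.ofReal_pow (p := 2) (by norm_num), ENNReal.ofReal_ofNat]
        rw [h1]
        have h2 : omega n Q ^ q = omega n Q ^ (q - 1) * omega n Q := by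
          nth_rewrite 3 [← ENNReal.rpow_one (omega n Q)]
          rw [← ENNReal.rpow_add_of_nonneg _ _ (by linarith) (by norm_num), sub_add_cancel]
        rw [h2, ← mul_assoc, ← ENNReal.mul_rpow_of_nonneg _ _ (by linarith)]
        -- What remains is (2ᵏω(Q))^(q-1), at most 1 because Q carries at most the mass of one word
        -- of length k.
        refine mul_le_of_le_one_left zero_le (ENNReal.rpow_le_one ?_ (by linarith))
        calc _ ≤ 2 ^ k * 2⁻¹ ^ k := by gcongr
          _ = (1 : ℝ≥0∞) := by
            rw [← mul_pow, ENNReal.mul_inv_cancel (by norm_num) (by norm_num), one_pow]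

/-- Every word with its zero in Q either has a full child or is special. The full case is summed
along bit sequences, where the bound vanishes unless the Cantor point itself is in Q; integration
then produces ω(Q). -/
theorem backward_testing {p q : ℝ} (hpq : p.HolderConjugate q) :
    ∃ T : ℝ≥0, ∀ (δ : ℝ) (Q : Set (EuclideanSpace ℝ (Fin n))), MeasurableSet Q →
      (axisPoint n ⁻¹' Q).OrdConnected →
      ∫⁻ x in Q, ‖rieszTrunc δ (omega n) (Q.indicator 1) x‖ₑ ^ q
        ∂sigma n p (fun k w => axisPoint n (ζ k w)) ≤ (T : ℝ≥0∞) ^ q * omega n Q := by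
  classical
  have hq := hpq.symm.lt
  have hθ := theta_pos n q
  have hc := hζ.pos
  set C : ℝ := (12 * c ^ (-(n : ℝ))) ^ q * ((theta n q)⁻¹ + 1) / (1 - theta n q) with hC
  set A : ℝ≥0∞ := 2 * ENNReal.ofReal C + ENNReal.ofReal ((c ^ (-(n : ℝ))) ^ q) with hA
  have hAt : A ≠ ⊤ := by simp [hA, ENNReal.mul_eq_top]
  refine ⟨(A ^ q⁻¹).toNNReal, fun δ Q hQ hI => ?_⟩
  rw [ENNReal.coe_toNNReal (ENNReal.rpow_ne_top_of_nonneg (by simpa using hpq.symm.nonneg) hAt),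
    ENNReal.rpow_inv_rpow hpq.symm.ne_zero, ← lintegral_indicator hQ, lintegral_sigma,
    hpq.conjExponent_eq]
  set Φ : ∀ m : ℕ, (Fin m → Bool) → ℝ≥0∞ := fun m w =>
    ENNReal.ofReal (theta n q ^ m) *
      ‖rieszTrunc δ (omega n) (Q.indicator 1) (axisPoint n (ζ m w))‖ₑ ^ q with hΦ
  -- Recording which child is full allows the contribution of a word to be charged to the bit
  -- sequences through that child.
  set g : ∀ m : ℕ, (Fin m → Bool) → Bool → ℝ≥0∞ := fun m w e =>
    if IsFull n Q (child w e) then Φ m w else 0 with hg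
  have hchild : ∀ (b : ℕ → Bool) m, child (word b m) (b m) = word b (m + 1) := fun b m =>
    (word_succ_eq_child_iff.2 ⟨rfl, rfl⟩).symm
  have hgm : ∀ m, Measurable fun b : ℕ → Bool => g m (word b m) (b m) := fun m =>
    (Measurable.of_discrete (f := fun v : Fin (m + 1) → Bool =>
      g m (fun i => v i.castSucc) (v (Fin.last m)))).comp (measurable_word (m + 1))
  calc _ ≤ ∑' m, (∫⁻ b, (g m (word b m) false + g m (word b m) true) ∂coin +
        ∫⁻ b, {b | axisPoint n (ζ m (word b m)) ∈ Q ∧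
          ∀ e, ¬ IsFull n Q (child (word b m) e)}.indicator (fun b => Φ m (word b m)) b ∂coin) := by
        refine ENNReal.tsum_le_tsum fun m => ?_
        have hmeas : Measurable fun b => g m (word b m) false + g m (word b m) true :=
          (Measurable.of_discrete (f := fun w : Fin m → Bool =>
            g m w false + g m w true)).comp (measurable_word m)
        rw [← lintegral_const_mul' _ _ ENNReal.ofReal_ne_top, ← lintegral_add_left hmeas]
        refine lintegral_mono fun b => ?_
        by_cases hmem : axisPoint n (ζ m (word b m)) ∈ Q
        swap
        · rw [indicator_of_notMem hmem, mul_zero]; exact zero_le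
        rw [indicator_of_mem hmem]
        by_cases hsp : ∀ e, ¬ IsFull n Q (child (word b m) e)
        · rw [indicator_of_mem (by exact ⟨hmem, hsp⟩)]
          exact le_add_self
        · push Not at hsp
          obtain ⟨e, he⟩ := hsp
          refine le_add_right ?_
          have : Φ m (word b m) = g m (word b m) e := by simp [hg, he]
          change Φ m (word b m) ≤ _
          rw [this]
          cases e
          · exact le_self_add
          · exact le_add_self
    _ = 2 * ∫⁻ b, ∑' m, g m (word b m) (b m) ∂coin +
        ∑' m, ∫⁻ b, {b | axisPoint n (ζ m (word b m)) ∈ Q ∧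
          ∀ e, ¬ IsFull n Q (child (word b m) e)}.indicator (fun b => Φ m (word b m)) b ∂coin := by
        rw [ENNReal.tsum_add, lintegral_tsum fun m => (hgm m).aemeasurable, ← ENNReal.tsum_mul_left]
        congr 1
        exact tsum_congr fun m => lintegral_word_bit (g m)
    _ ≤ 2 * (ENNReal.ofReal C * omega n Q) +
        ENNReal.ofReal ((c ^ (-(n : ℝ))) ^ q) * omega n Q := by
        gcongr
        · rw [omega_apply, ← lintegral_indicator_const (measurableSet_cantorPoint_mem hQ)]
          refine lintegral_mono fun b => le_trans (le_of_eq ?_) (hζ.tsum_isFull_le hq hQ δ b)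
          refine tsum_congr fun m => ?_
          simp only [hg, hΦ, indicator, hchild]
          rfl
        · exact hζ.special_bound hq hI hQ δ
    _ = _ := by rw [hA]; ring

end IsSeparatedZeros

/-! ### Cubes -/

namespace IsCube

variable {n : ℕ} {Q : Set (EuclideanSpace ℝ (Fin n))} {c : EuclideanSpace ℝ (Fin n)} {ℓ : ℝ}

theorem measurableSet (h : IsCube Q c ℓ) : MeasurableSet Q := by
  obtain ⟨-, J, hJ, rfl⟩ := h
  have hm : ∀ i, MeasurableSet (J i) := fun i => by
    refine OrdConnected.measurableSet ⟨fun x hx y hy t ht => ?_⟩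
    have hx' := (hJ i).2 hx
    have hy' := (hJ i).2 hy
    rcases eq_or_lt_of_le ht.1 with rfl | h1
    · exact hx
    rcases eq_or_lt_of_le ht.2 with rfl | h2
    · exact hy
    exact (hJ i).1 ⟨hx'.1.trans_lt h1, h2.trans_le hy'.2⟩
  rw [ofPred_forall]
  exact MeasurableSet.iInter fun i =>
    (EuclideanSpace.proj (𝕜 := ℝ) i).continuous.measurable (hm i)

theorem ordConnected_preimage [NeZero n] (h : IsCube Q c ℓ) :
    (axisPoint n ⁻¹' Q).OrdConnected := by
  obtain ⟨-, J, hJ, rfl⟩ := h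
  refine ⟨fun x hx y hy t ht i => ?_⟩
  have hx' := hx i
  have hy' := hy i
  by_cases hi : i = 0
  · subst hi
    rw [axisPoint_apply_zero] at hx' hy' ⊢
    have hx2 := (hJ 0).2 hx'
    have hy2 := (hJ 0).2 hy'
    rcases eq_or_lt_of_le ht.1 with rfl | h1
    · exact hx'
    rcases eq_or_lt_of_le ht.2 with rfl | h2
    · exact hy'
    exact (hJ 0).1 ⟨hx2.1.trans_lt h1, h2.trans_le hy2.2⟩
  · rw [axisPoint_apply_of_ne n _ hi] at hx' ⊢
    exact hx'

theorem abs_apply_sub_le (h : IsCube Q c ℓ) {x : EuclideanSpace ℝ (Fin n)} (hx : x ∈ Q)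
    (i : Fin n) : |x i - c i| ≤ ℓ / 2 := by
  obtain ⟨-, J, hJ, rfl⟩ := h
  have := (hJ i).2 (hx i)
  rw [abs_le]
  constructor <;> linarith [this.1, this.2]

theorem center_mem (h : IsCube Q c ℓ) : c ∈ Q := by
  obtain ⟨hℓ, J, hJ, rfl⟩ := h
  exact fun i => (hJ i).1 ⟨by linarith, by linarith⟩

theorem abs_sub_le_add_infDist [NeZero n] (h : IsCube Q c ℓ) (t : ℝ) :
    |t - c 0| ≤ ℓ + Metric.infDist (axisPoint n t) Q := by
  have hℓ := h.1
  suffices |t - c 0| - ℓ / 2 ≤ Metric.infDist (axisPoint n t) Q by linarith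
  refine (Metric.le_infDist ⟨c, h.center_mem⟩).2 fun y hy => ?_
  have h1 := h.abs_apply_sub_le hy 0
  have h2 := PiLp.norm_apply_le (axisPoint n t - y) 0
  rw [PiLp.sub_apply, axisPoint_apply_zero, Real.norm_eq_abs, ← dist_eq_norm] at h2
  have h3 := abs_sub_le t (y 0) (c 0)
  linarith

end IsCube

/-! ### The Muckenhoupt condition -/

namespace IsSeparatedZeros

variable {n : ℕ} [NeZero n] {c : ℝ} {ζ : ∀ k : ℕ, (Fin k → Bool) → ℝ}
  (hζ : IsSeparatedZeros n c ζ)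
include hζ

omit [NeZero n] in
-- For m ≥ k the zero is within 3⁻ᵏ of the Cantor point of b, and R is comparable to or larger than
-- 3⁻ᵏ. For m ≤ k the zero is c·3⁻ᵐ away from the Cantor point of `b₀`, which is within R of u;
-- without such a point near u, a small ball around an early zero would violate the bound.
theorem mul_max_le_max {u R : ℝ} {k : ℕ} (hR : 1 / 3 ^ (k + 1) ≤ R)
    {b₀ : ℕ → Bool} (hb₀ : |cantorPoint b₀ - u| ≤ R) (b : ℕ → Bool) (m : ℕ) :
    c / 9 * max (1 / 3 ^ min m k) |cantorPoint b - u| ≤ max R |ζ m (word b m) - u| := by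
  have hc := hζ.pos
  have hc1 := hζ.le_one
  obtain ⟨M, hM⟩ : ∃ M, M = max R |ζ m (word b m) - u| := ⟨_, rfl⟩
  have h1 : R ≤ M := hM ▸ le_max_left _ _
  have h2 : |ζ m (word b m) - u| ≤ M := hM ▸ le_max_right _ _
  have h3 := hζ.abs_sub_le b m
  have h4 := _root_.abs_sub_le (cantorPoint b) (ζ m (word b m)) u
  have hk := third_pow_pos k
  have hm := third_pow_pos m
  rw [third_pow_succ] at hR
  rw [← hM, mul_max_of_nonneg _ _ (by positivity), max_le_iff]
  rcases le_total k m with hkm | hmk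
  · rw [min_eq_right hkm]
    have h5 := third_pow_anti hkm
    constructor <;> nlinarith
  · rw [min_eq_left hmk]
    have h5 := hζ.sep m (word b m) b₀
    have h6 := _root_.abs_sub_le (cantorPoint b₀) u (ζ m (word b m))
    rw [abs_sub_comm u] at h6
    constructor <;> nlinarith

/-- Generation m contributes θ(q)ᵐβ^min(m,k) with θ(q)β = 2^(q-1) > 1 and θ(q) < 1. The terms grow
geometrically up to k and decay after it, so the sum is of the order of the term m = k. -/
theorem lintegral_sigma_max_rpow_le {p q : ℝ} (hpq : p.HolderConjugate q) {u R : ℝ} {k : ℕ}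
    (hR : 1 / 3 ^ (k + 1) ≤ R) {b₀ : ℕ → Bool} (hb₀ : |cantorPoint b₀ - u| ≤ R) :
    ∫⁻ x, ENNReal.ofReal ((max R |x 0 - u|) ^ (-(n * q)))
        ∂sigma n p (fun k w => axisPoint n (ζ k w)) ≤
      ENNReal.ofReal (12 * (c / 9) ^ (-(n * q)) *
        (1 / (2 ^ (q - 1) - 1) + 1 / (1 - theta n q)) * (2 ^ (q - 1)) ^ k) := by
  have hc := hζ.pos
  have hq := hpq.symm.lt
  have hn := one_le_cast n
  have hθ := theta_pos n q
  have hθ1 := theta_lt_one n hpq.symm.pos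
  have hτ : 1 < (2 : ℝ) ^ (q - 1) := Real.one_lt_rpow (by norm_num) (by linarith)
  set D := 12 * (c / 9) ^ (-(n * q)) with hD
  set β : ℝ := 3 ^ (n * q) / 2 with hβ
  have hβ0 : 0 < β := by positivity
  have hθβ : theta n q * β = 2 ^ (q - 1) := by
    rw [theta, rate, hβ, Real.rpow_neg (by positivity), Real.div_rpow (by positivity)
      (by positivity), inv_div, ← Real.rpow_natCast 3 n, ← Real.rpow_mul (by norm_num),
      Real.rpow_sub_one (by norm_num)]
    field_simp
  have hD0 : 0 ≤ D := by positivity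
  have hs1 : 0 < 1 - theta n q := by linarith
  have hs2 : 0 < (2 : ℝ) ^ (q - 1) - 1 := by linarith
  rw [lintegral_sigma, hpq.conjExponent_eq]
  have hterm : ∀ m, ENNReal.ofReal (theta n q ^ m) * ∫⁻ b, ENNReal.ofReal
      ((max R |axisPoint n (ζ m (word b m)) 0 - u|) ^ (-(n * q))) ∂coin ≤
      (if m ∈ Finset.range k then ENNReal.ofReal (D * (2 ^ (q - 1)) ^ m) else 0) +
      (if k ≤ m then ENNReal.ofReal (D * β ^ k * theta n q ^ m) else 0) := by
    intro m
    have h1 : ∫⁻ b, ENNReal.ofReal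
        ((max R |axisPoint n (ζ m (word b m)) 0 - u|) ^ (-(n * q))) ∂coin ≤
        ENNReal.ofReal (D * β ^ min m k) := by
      refine lintegral_le_of_le_max_rpow (c := u) (k := min m k)
        (show 1 ≤ (n : ℝ) * q by nlinarith) (by positivity) fun b => ?_
      refine ENNReal.ofReal_le_ofReal ?_
      have hmax := third_pow_pos (min m k)
      rw [← Real.mul_rpow (by positivity) (by positivity), axisPoint_apply_zero]
      exact Real.rpow_le_rpow_of_nonpos (mul_pos (by positivity) (lt_max_of_lt_left hmax))
        (hζ.mul_max_le_max hR hb₀ b m) (by have := hpq.symm.pos; simp; positivity)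
    calc _ ≤ ENNReal.ofReal (theta n q ^ m) * ENNReal.ofReal (D * β ^ min m k) := by gcongr
      _ = ENNReal.ofReal (theta n q ^ m * (D * β ^ min m k)) :=
        (ENNReal.ofReal_mul (by positivity)).symm
      _ ≤ _ := by
        by_cases hm : m < k
        · rw [if_pos (Finset.mem_range.2 hm), if_neg (not_le.2 hm), add_zero, min_eq_left hm.le,
            mul_left_comm, ← mul_pow, hθβ]
        · rw [if_neg (by simpa using hm), if_pos (not_lt.1 hm), zero_add,
            min_eq_right (not_lt.1 hm), mul_comm]
  refine (ENNReal.tsum_le_tsum hterm).trans ?_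
  rw [ENNReal.tsum_add, tsum_geometric_tail hθ hθ1 (by positivity),
    tsum_eq_sum (s := Finset.range k) (fun m hm => if_neg hm), Finset.sum_ite_mem,
    Finset.inter_self, ← ENNReal.ofReal_sum_of_nonneg (fun m _ => by positivity),
    ← Finset.mul_sum, geom_sum_eq hτ.ne', ← ENNReal.ofReal_add
      (mul_nonneg hD0 (div_nonneg (by linarith [one_le_pow₀ hτ.le (n := k)]) hs2.le))
      (by positivity)]
  refine ENNReal.ofReal_le_ofReal ?_
  rw [mul_assoc D (β ^ k), ← mul_pow, mul_comm β, hθβ, mul_div_assoc D, ← mul_add, mul_assoc D]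
  refine mul_le_mul_of_nonneg_left ?_ hD0
  rw [add_mul, one_div_mul_eq_div, one_div_mul_eq_div]
  gcongr
  linarith

/-- A single parameter G ties the two tails together: the product of their p-th and q-th roots is at
most a constant times R⁻ⁿ, which is the Muckenhoupt balance at scale R. -/
theorem exists_growth {p q : ℝ} (hpq : p.HolderConjugate q) :
    ∃ C₁ C₂ : ℝ, 0 ≤ C₁ ∧ 0 ≤ C₂ ∧ ∀ (u R : ℝ) (b₀ : ℕ → Bool), 0 < R →
      |cantorPoint b₀ - u| ≤ R → ∃ G : ℝ, 0 < G ∧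
      ∫⁻ b, ENNReal.ofReal ((max R |cantorPoint b - u|) ^ (-(n * p))) ∂coin ≤
        ENNReal.ofReal (C₁ * G ^ p) ∧
      ∫⁻ x, ENNReal.ofReal ((max R |x 0 - u|) ^ (-(n * q)))
        ∂sigma n p (fun k w => axisPoint n (ζ k w)) ≤ ENNReal.ofReal (C₂ * (R ^ n * G) ^ (-q)) := by
  have hc := hζ.pos
  have hn := one_le_cast n
  have hp := hpq.lt
  have hq := hpq.symm.lt
  have hτ : 1 < (2 : ℝ) ^ (q - 1) := Real.one_lt_rpow (by norm_num) (by linarith)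
  have hs1 : 0 < 1 - theta n q := by linarith [theta_lt_one n hpq.symm.pos]
  have hs2 : 0 < (2 : ℝ) ^ (q - 1) - 1 := by linarith
  obtain ⟨B, hB⟩ : ∃ B, B = 12 * (c / 9) ^ (-(n * q)) *
        (1 / (2 ^ (q - 1) - 1) + 1 / (1 - theta n q)) := ⟨_, rfl⟩
  have hB0 : 0 ≤ B := by rw [hB]; positivity
  have hD1 : 1 ≤ 12 * (1 / 3 : ℝ) ^ (-(n * p)) := by
    have : 1 ≤ (1 / 3 : ℝ) ^ (-(n * p)) :=
      Real.one_le_rpow_of_pos_of_le_one_of_nonpos (by norm_num) (by norm_num)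
        (by have := hpq.pos; simp; positivity)
    linarith
  refine ⟨12 * (1 / 3) ^ (-(n * p)), B + 1 / (1 - theta n q), by positivity, by positivity,
    fun u R b₀ hR hb₀ => ?_⟩
  rcases le_or_gt R 1 with hR1 | hR1
  · obtain ⟨k, hk1, hk2⟩ := exists_nat_pow_near_of_lt_one hR hR1 (y := 1 / 3) (by norm_num)
      (by norm_num)
    rw [one_div_pow] at hk1 hk2
    -- For R about 3⁻ᵏ, G is the value with Gᵖ = (3^(np)/2)ᵏ. Then RⁿG is at most 2^(-k/p), and its
    -- power -q is at least 2^(k(q-1)), the bound for σ.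
    refine ⟨3 ^ (n * k) * 2 ^ (-(k / p)), by positivity, ?_, ?_⟩
    · refine (lintegral_le_of_le_max_rpow (a := n * p) (A := (1 / 3) ^ (-(n * p))) (c := u)
        (k := k) (by nlinarith) (by positivity) fun b => ENNReal.ofReal_le_ofReal ?_).trans_eq ?_
      · have hk := third_pow_pos k
        rw [← Real.mul_rpow (by positivity) (by positivity)]
        refine Real.rpow_le_rpow_of_nonpos (mul_pos (by positivity) (lt_max_of_lt_left hk)) ?_
          (by have := hpq.pos; simp; positivity)
        rw [third_pow_succ] at hk1
        rw [mul_max_of_nonneg _ _ (by norm_num)]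
        refine max_le_max (by linarith) ?_
        have := abs_nonneg (cantorPoint b - u)
        linarith
      · congr 2
        rw [Real.mul_rpow (by positivity) (by positivity), ← Real.rpow_natCast 3,
          ← Real.rpow_mul (by norm_num), ← Real.rpow_mul (by norm_num), neg_mul,
          div_mul_cancel₀ _ hpq.ne_zero, div_pow, ← Real.rpow_natCast, ← Real.rpow_mul (by norm_num),
          Real.rpow_neg (by norm_num), Real.rpow_natCast, div_eq_mul_inv]
        push_cast
        congr 2
        ring
    · refine (hζ.lintegral_sigma_max_rpow_le hpq hk1.le hb₀).trans (ENNReal.ofReal_le_ofReal ?_)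
      rw [← hB]
      have h1 : R ^ n * (3 ^ (n * k) * 2 ^ (-(k / p))) ≤ 2 ^ (-(k / p)) := by
        calc _ ≤ (1 / 3 ^ k) ^ n * (3 ^ (n * k) * (2 : ℝ) ^ (-(k / p))) := by gcongr
          _ = _ := by rw [mul_comm n k, pow_mul, ← mul_assoc, ← mul_pow, one_div,
                        inv_mul_cancel₀ (by positivity), one_pow, one_mul]
      have h2 := Real.rpow_le_rpow_of_nonpos (by positivity) h1 (neg_nonpos.2 hpq.symm.nonneg)
      rw [← Real.rpow_mul (by norm_num), neg_mul_neg] at h2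
      have h3 : (k : ℝ) / p * q = (q - 1) * k := by
        have := hpq.symm.sub_one_mul_conj
        field_simp [hpq.ne_zero]
        linear_combination -(k : ℝ) * this
      rw [h3, Real.rpow_mul (by norm_num), Real.rpow_natCast] at h2
      have h4 : 0 < 1 / (1 - theta n q) := by positivity
      exact mul_le_mul (by linarith) h2 (by positivity) (by linarith)
  -- At scales above 1 only the total masses matter, both of which are finite.
  · refine ⟨(R ^ n)⁻¹, by positivity, ?_, ?_⟩
    · have : (1 : ℝ≥0∞) * ENNReal.ofReal (((R ^ n)⁻¹) ^ p) ≤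
          ENNReal.ofReal (12 * (1 / 3) ^ (-(n * p)) * ((R ^ n)⁻¹) ^ p) := by
        rw [ENNReal.ofReal_mul (by positivity)]
        gcongr
        exact ENNReal.ofReal_one.symm.trans_le (ENNReal.ofReal_le_ofReal hD1)
      refine le_trans ?_ this
      have h1 : ∀ b, ENNReal.ofReal ((max R |cantorPoint b - u|) ^ (-(n * p))) ≤
          ENNReal.ofReal (((R ^ n)⁻¹) ^ p) := fun b => by
        refine ENNReal.ofReal_le_ofReal ?_
        rw [Real.inv_rpow (by positivity), ← Real.rpow_natCast, ← Real.rpow_mul hR.le,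
          ← Real.rpow_neg hR.le]
        exact Real.rpow_le_rpow_of_nonpos hR (le_max_left _ _)
          (by have := hpq.pos; simp; positivity)
      refine (lintegral_mono h1).trans_eq ?_
      simp
    · rw [mul_inv_cancel₀ (by positivity), Real.one_rpow, mul_one]
      have h1 : ∀ x : EuclideanSpace ℝ (Fin n), ENNReal.ofReal ((max R |x 0 - u|) ^ (-(n * q))) ≤
          1 := fun x => by
        rw [← ENNReal.ofReal_one]
        refine ENNReal.ofReal_le_ofReal ?_
        exact Real.rpow_le_one_of_one_le_of_nonpos (hR1.le.trans (le_max_left _ _))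
          (by have := hpq.symm.pos; simp; positivity)
      refine (lintegral_mono h1).trans ?_
      rw [lintegral_one, sigma_univ hp, hpq.conjExponent_eq]
      exact ENNReal.ofReal_le_ofReal (by linarith)

/-- The growth bounds need a ball that reaches the Cantor set. Enlarging the scale from ℓ to R costs
nothing for ω and a factor (ℓ/R)⁻ⁿ for σ, which is exactly what the normalization ℓⁿ allows. -/
theorem muckenhouptAp {p q : ℝ} (hpq : p.HolderConjugate q) :
    MuckenhouptAp p (sigma n p fun k w => axisPoint n (ζ k w)) (omega n) := by
  obtain ⟨C₁, C₂, hC₁, hC₂, hgrow⟩ := hζ.exists_growth hpq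
  refine ⟨Real.toNNReal (C₁ ^ (1 / p) * C₂ ^ (1 / q)), fun Q c₀ ℓ hQ => ?_⟩
  have hℓ := hQ.1
  rw [hpq.conjExponent_eq]
  obtain ⟨_, ⟨b₀, rfl⟩, hb₀⟩ := isCompact_range_cantorPoint.exists_infDist_eq_dist
    (range_nonempty _) (c₀ 0)
  rw [Real.dist_eq, abs_sub_comm] at hb₀
  -- The larger of the side length and the distance from the first coordinate of the centre to the
  -- Cantor set.
  obtain ⟨R, hRdef⟩ : ∃ R, R = max ℓ |cantorPoint b₀ - c₀ 0| := ⟨_, rfl⟩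
  have hℓR : ℓ ≤ R := hRdef ▸ le_max_left _ _
  have hR : 0 < R := hℓ.trans_le hℓR
  obtain ⟨G, hG, hω, hσ⟩ := hgrow (c₀ 0) R b₀ hR (hRdef ▸ le_max_right _ _)
  have hdist : ∀ t, max ℓ |t - c₀ 0| ≤ ℓ + Metric.infDist (axisPoint n t) Q := fun t =>
    max_le (by linarith [Metric.infDist_nonneg (x := axisPoint n t) (s := Q)])
      (hQ.abs_sub_le_add_infDist t)
  -- No Cantor point is closer to the centre than the nearest one, so R may replace ℓ here for free.
  have hdistω : ∀ b, max R |cantorPoint b - c₀ 0| ≤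
      ℓ + Metric.infDist (axisPoint n (cantorPoint b)) Q := fun b => by
    refine le_trans (max_le (hRdef ▸ max_le (le_max_left _ _) ?_) (le_max_right _ _)) (hdist _)
    refine le_max_of_le_right ?_
    rw [← hb₀, abs_sub_comm, ← Real.dist_eq]
    exact Metric.infDist_le_dist_of_mem (mem_range_self b)
  have hdistσ : ∀ t, ℓ / R * max R |t - c₀ 0| ≤ ℓ + Metric.infDist (axisPoint n t) Q := fun t => by
    refine le_trans ?_ (hdist t)
    rw [mul_max_of_nonneg _ _ (by positivity), div_mul_cancel₀ _ hR.ne']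
    refine max_le_max le_rfl (mul_le_of_le_one_left (abs_nonneg _) ?_)
    exact (div_le_one hR).2 hℓR
  have hX : tail p (omega n) Q ℓ ≤ ENNReal.ofReal (ℓ ^ (n * (p - 1)) * (C₁ * G ^ p)) := by
    rw [tail, lintegral_omega, ENNReal.ofReal_mul (by positivity)]
    refine le_trans ?_ (mul_le_mul_right hω _)
    rw [← lintegral_const_mul' _ _ ENNReal.ofReal_ne_top]
    refine lintegral_mono fun b => ?_
    rw [← ENNReal.ofReal_mul (by positivity), Real.rpow_neg (by positivity), ← div_eq_mul_inv]
    refine ENNReal.ofReal_le_ofReal ?_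
    have := hpq.nonneg
    gcongr
    exact hdistω b
  have hY : tail q (sigma n p fun k w => axisPoint n (ζ k w)) Q ℓ ≤
      ENNReal.ofReal (ℓ ^ (n * (q - 1)) * (ℓ / R) ^ (-(n * q)) * (C₂ * (R ^ n * G) ^ (-q))) := by
    rw [tail, ENNReal.ofReal_mul (by positivity)]
    refine le_trans ?_ (mul_le_mul_right hσ _)
    rw [← lintegral_const_mul' _ _ ENNReal.ofReal_ne_top]
    refine lintegral_mono_ae (ae_sigma_of_forall fun k w => ?_)
    rw [← ENNReal.ofReal_mul (by positivity), axisPoint_apply_zero, mul_assoc,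
      ← Real.mul_rpow (by positivity) (by positivity), Real.rpow_neg (by positivity),
      ← div_eq_mul_inv]
    refine ENNReal.ofReal_le_ofReal ?_
    have := hpq.symm.nonneg
    gcongr
    exact hdistσ _
  have hp' : 0 ≤ 1 / p := by have := hpq.pos; positivity
  have hq' : 0 ≤ 1 / q := by have := hpq.symm.pos; positivity
  refine (mul_le_mul' (ENNReal.rpow_le_rpow hX hp') (ENNReal.rpow_le_rpow hY hq')).trans_eq ?_
  rw [ENNReal.ofReal_rpow_of_nonneg (by positivity) hp', ENNReal.ofReal_rpow_of_nonneg
    (by positivity) hq', ← ENNReal.ofReal_mul (by positivity)]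
  change _ = ENNReal.ofReal _
  congr 1
  have e1 : (ℓ ^ (n * (p - 1)) * (C₁ * G ^ p)) ^ (1 / p) =
      ℓ ^ (n * (1 / q)) * (C₁ ^ (1 / p) * G) := by
    rw [Real.mul_rpow (by positivity) (by positivity), Real.mul_rpow hC₁ (by positivity),
      ← Real.rpow_mul hℓ.le, ← Real.rpow_mul hG.le, mul_one_div_cancel hpq.ne_zero, Real.rpow_one]
    congr 2
    rw [mul_assoc, sub_mul, mul_one_div_cancel hpq.ne_zero, one_mul]
    congr 1
    have := hpq.inv_add_inv_eq_one
    rw [one_div, one_div]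
    linarith
  have e2 : (ℓ ^ (n * (q - 1)) * (ℓ / R) ^ (-(n * q)) * (C₂ * (R ^ n * G) ^ (-q))) ^ (1 / q) =
      ℓ ^ (n * (1 / p)) * ((ℓ / R) ^ n)⁻¹ * (C₂ ^ (1 / q) * (R ^ n * G)⁻¹) := by
    rw [Real.mul_rpow (by positivity) (by positivity), Real.mul_rpow (by positivity)
      (by positivity), Real.mul_rpow hC₂ (by positivity), ← Real.rpow_mul hℓ.le,
      ← Real.rpow_mul (by positivity), ← Real.rpow_mul (by positivity), neg_mul, neg_mul,
      mul_assoc (n : ℝ) q, mul_one_div_cancel hpq.symm.ne_zero, mul_one, Real.rpow_neg_one,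
      Real.rpow_neg (by positivity), Real.rpow_natCast]
    congr 3
    rw [mul_assoc, sub_mul, mul_one_div_cancel hpq.symm.ne_zero, one_mul]
    congr 1
    have := hpq.inv_add_inv_eq_one
    rw [one_div, one_div]
    linarith
  have e3 : ℓ ^ (n * (1 / q)) * ℓ ^ (n * (1 / p)) = ℓ ^ n := by
    rw [← Real.rpow_add hℓ, ← mul_add, one_div, one_div, add_comm, hpq.inv_add_inv_eq_one, mul_one,
      Real.rpow_natCast]
  rw [e1, e2, div_pow]
  calc _ = (ℓ ^ (n * (1 / q)) * ℓ ^ (n * (1 / p))) * (C₁ ^ (1 / p) * C₂ ^ (1 / q)) *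
        (G * (ℓ ^ n / R ^ n)⁻¹ * (R ^ n * G)⁻¹) := by ring
    _ = _ := by rw [e3]; field_simp

theorem t1Conditions {p : ℝ} (hp : 1 < p) :
    T1Conditions p (sigma n p fun k w => axisPoint n (ζ k w)) (omega n) := by
  have hpq := Real.HolderConjugate.conjExponent hp
  obtain ⟨T₁, h₁⟩ := hζ.forward_testing hpq
  obtain ⟨T₂, h₂⟩ := hζ.backward_testing hpq
  exact ⟨hζ.muckenhouptAp hpq,
    ⟨T₁, fun δ _ Q _ _ hQ => h₁ δ Q hQ.measurableSet hQ.ordConnected_preimage⟩,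
    ⟨T₂, fun δ _ Q _ _ hQ => h₂ δ Q hQ.measurableSet hQ.ordConnected_preimage⟩⟩

theorem absConvergent_sigma_omega {p : ℝ} (hp : 1 < p) :
    AbsConvergent (sigma n p fun k w => axisPoint n (ζ k w)) (omega n) := by
  have hpq := Real.HolderConjugate.conjExponent hp
  rw [AbsConvergent, ae_omega_iff]
  refine ae_of_all _ fun b => ⟨(measurable_rieszKernel.comp
    measurable_prodMk_left).aestronglyMeasurable, ?_⟩
  have := hζ.potential_le hpq.symm.lt hpq.conjExponent_eq b univ 0 (by simp)
  simp only [indicator_univ] at this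
  exact this.trans_lt ENNReal.ofReal_lt_top

theorem absConvergent_omega_sigma (p : ℝ) :
    AbsConvergent (omega n) (sigma n p fun k w => axisPoint n (ζ k w)) := by
  refine ae_sigma_of_forall fun k w => ⟨(measurable_rieszKernel.comp
    measurable_prodMk_left).aestronglyMeasurable, ?_⟩
  rw [HasFiniteIntegral, lintegral_omega]
  simp only [enorm_rieszKernel_axisPoint]
  exact (lintegral_le_of_separated hζ.pos hζ.le_one _ k fun b _ =>
    ⟨le_rfl, hζ.sep k w b⟩).trans_lt ENNReal.ofReal_lt_top

end IsSeparatedZeros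

theorem T1Conditions.symm {n : ℕ} [NeZero n] {p : ℝ} (hp : 1 < p)
    {σ ω : Measure (EuclideanSpace ℝ (Fin n))} (h : T1Conditions p.conjExponent σ ω) :
    T1Conditions p ω σ := by
  obtain ⟨⟨A, hA⟩, h2, h3⟩ := h
  rw [(Real.HolderConjugate.conjExponent hp).symm.conjExponent_eq] at h3 hA
  exact ⟨⟨A, fun Q c ℓ hQ => (mul_comm _ _).trans_le (hA Q c ℓ hQ)⟩, h3, h2⟩

/-! ### Gaussian averages and vector-valued extensions -/

/-- The absolute moment of order `p` of a standard Gaussian variable. -/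
noncomputable def gaussianMoment (p : ℝ) : ℝ≥0∞ :=
  ∫⁻ t, ‖t‖ₑ ^ p ∂ProbabilityTheory.gaussianReal 0 1

theorem gaussianMoment_ne_top {p : ℝ} (hp : 0 < p) : gaussianMoment p ≠ ⊤ := by
  have h := (ProbabilityTheory.memLp_id_gaussianReal' (μ := 0) (v := 1) (ENNReal.ofReal p)
    ENNReal.ofReal_ne_top).eLpNorm_lt_top
  have := lintegral_rpow_enorm_lt_top_of_eLpNorm_lt_top (by simpa using hp)
    ENNReal.ofReal_ne_top h
  rw [ENNReal.toReal_ofReal hp.le] at this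
  exact this.ne

theorem gaussianMoment_ne_zero {p : ℝ} (hp : 0 < p) : gaussianMoment p ≠ 0 := by
  intro h
  rw [gaussianMoment, lintegral_eq_zero_iff (by fun_prop)] at h
  have := ProbabilityTheory.nullSingletonClass_gaussianReal (μ := 0) (v := 1) one_ne_zero
  have h0 : ∀ᵐ t ∂ProbabilityTheory.gaussianReal 0 1, t ≠ 0 := by
    rw [ae_iff]
    simp
  have hfalse : ∀ᵐ t ∂ProbabilityTheory.gaussianReal 0 1, False := by
    filter_upwards [h, h0] with t h1 h2
    simp [ENNReal.rpow_eq_zero_iff, h2, hp.not_gt] at h1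
  rw [Filter.eventually_false_iff_eq_bot, ae_eq_bot] at hfalse
  exact IsProbabilityMeasure.ne_zero _ hfalse

/-- A linear combination of independent standard Gaussians is Gaussian with variance the sum of the
squared coefficients, so its p-th moment depends on the coefficients only through their ℓ² norm. -/
theorem lintegral_stdGaussian {ι : Type*} [Fintype ι] {p : ℝ} (hp : 0 < p) (a : ι → ℝ) :
    ∫⁻ g, ‖∑ i, g i * a i‖ₑ ^ p ∂ProbabilityTheory.stdGaussian (EuclideanSpace ℝ ι) =
      gaussianMoment p * (∑ i, ‖a i‖ₑ ^ 2) ^ (p / 2) := by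
  set v : EuclideanSpace ℝ ι := WithLp.toLp 2 a
  have hL : ∀ g : EuclideanSpace ℝ ι, ∑ i, g i * a i = innerSL ℝ v g := fun g => by
    simp [v, PiLp.inner_apply]
  have hmap : (ProbabilityTheory.stdGaussian (EuclideanSpace ℝ ι)).map (innerSL ℝ v) =
      (ProbabilityTheory.gaussianReal 0 1).map (‖v‖ * ·) := by
    rw [ProbabilityTheory.IsGaussian.map_eq_gaussianReal,
      ProbabilityTheory.integral_strongDual_stdGaussian,
      ProbabilityTheory.variance_dual_stdGaussian, ProbabilityTheory.gaussianReal_map_const_mul,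
      innerSL_apply_norm]
    congr 1
    · simp
    · ext
      simp
  simp_rw [hL]
  rw [← lintegral_map (f := fun t : ℝ => ‖t‖ₑ ^ p) (by fun_prop)
    (innerSL ℝ v).continuous.measurable, hmap, lintegral_map (by fun_prop) (by fun_prop)]
  simp_rw [enorm_mul, ENNReal.mul_rpow_of_nonneg _ _ hp.le]
  rw [lintegral_const_mul' _ _ (by
    exact ENNReal.rpow_ne_top_of_nonneg hp.le (by simp)), mul_comm]
  congr 1
  have h1 : ‖‖v‖‖ₑ ^ 2 = ∑ i, ‖a i‖ₑ ^ 2 := by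
    rw [Real.enorm_eq_ofReal (norm_nonneg _), ← ENNReal.ofReal_pow (norm_nonneg _),
      EuclideanSpace.norm_sq_eq, ENNReal.ofReal_sum_of_nonneg (fun i _ => by positivity)]
    refine Finset.sum_congr rfl fun i _ => ?_
    rw [ENNReal.ofReal_pow (norm_nonneg _), ofReal_norm]
  rw [← h1, ← ENNReal.rpow_two, ← ENNReal.rpow_mul]
  congr 1
  ring

section VectorValued

variable {n : ℕ} [NeZero n] {μ ν : Measure (EuclideanSpace ℝ (Fin n))}

/-- The kernel of the truncated transform is locally integrable, for almost all base points. -/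
def TruncConvergent (δ : ℝ) (μ ν : Measure (EuclideanSpace ℝ (Fin n))) : Prop :=
  ∀ᵐ x ∂ν, ∀ r, IntegrableOn (rieszKernel x) ({y | δ < ‖y - x‖} ∩ Metric.closedBall 0 r) μ

theorem AbsConvergent.truncConvergent (h : AbsConvergent μ ν) (δ : ℝ) :
    TruncConvergent δ μ ν := by
  filter_upwards [h] with x hx r using hx.integrableOn

theorem truncConvergent_of_pos [IsLocallyFiniteMeasure μ] {δ : ℝ} (hδ : 0 < δ) :
    TruncConvergent δ μ ν := by
  refine ae_of_all _ fun x r => ?_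
  have hfin : μ ({y | δ < ‖y - x‖} ∩ Metric.closedBall 0 r) < ⊤ :=
    (measure_mono inter_subset_right).trans_lt (isCompact_closedBall _ _).measure_lt_top
  refine Measure.integrableOn_of_bounded (M := (δ ^ n)⁻¹) hfin.ne
    (measurable_rieszKernel.comp measurable_prodMk_left).aestronglyMeasurable ?_
  refine (ae_restrict_iff' ((measurableSet_lt_norm_sub δ x).inter measurableSet_closedBall)).2
    (ae_of_all _ fun y hy => ?_)
  have hy1 : δ < ‖y - x‖ := hy.1
  have hy0 := hδ.trans hy1
  have h1 := PiLp.norm_apply_le (y - x) 0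
  rw [PiLp.sub_apply] at h1
  rw [rieszKernel, norm_div, norm_pow, norm_norm]
  calc _ ≤ ‖y - x‖ / ‖y - x‖ ^ (n + 1) := by gcongr
    _ = (‖y - x‖ ^ n)⁻¹ := by rw [pow_succ]; field_simp
    _ ≤ _ := by gcongr

theorem integrable_rieszKernel_mul {δ : ℝ} {x : EuclideanSpace ℝ (Fin n)}
    (hx : ∀ r, IntegrableOn (rieszKernel x) ({y | δ < ‖y - x‖} ∩ Metric.closedBall 0 r) μ)
    {f : EuclideanSpace ℝ (Fin n) → ℝ} (hf : Measurable f) (hb : ∃ B : ℝ, ∀ x, |f x| ≤ B)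
    (hs : Bornology.IsBounded (Function.support f)) :
    Integrable (fun y => rieszKernel x y * f y) (μ.restrict {y | δ < ‖y - x‖}) := by
  obtain ⟨r, hr⟩ := hs.subset_closedBall 0
  obtain ⟨B, hB⟩ := hb
  have h1 : Integrable ((Metric.closedBall 0 r).indicator (rieszKernel x))
      (μ.restrict {y | δ < ‖y - x‖}) := by
    rw [integrable_indicator_iff measurableSet_closedBall, IntegrableOn,
      Measure.restrict_restrict measurableSet_closedBall, inter_comm]
    exact hx r
  refine (h1.mul_bdd hf.aestronglyMeasurable (ae_of_all _ hB)).congr (ae_of_all _ fun y => ?_)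
  by_cases hy : y ∈ Metric.closedBall (0 : EuclideanSpace ℝ (Fin n)) r
  · simp only [indicator_of_mem hy]
  · have : f y = 0 := by
      by_contra hne
      exact hy (hr hne)
    simp [this]

theorem stronglyMeasurable_rieszTrunc [SFinite μ] (δ : ℝ) {f : EuclideanSpace ℝ (Fin n) → ℝ}
    (hf : Measurable f) : StronglyMeasurable (rieszTrunc δ μ f) := by
  have h : Measurable fun q : EuclideanSpace ℝ (Fin n) × EuclideanSpace ℝ (Fin n) =>
      {q : EuclideanSpace ℝ (Fin n) × EuclideanSpace ℝ (Fin n) | δ < ‖q.2 - q.1‖}.indicator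
        (fun q => rieszKernel q.1 q.2 * f q.2) q :=
    (measurable_rieszKernel.mul (hf.comp measurable_snd)).indicator
      (measurableSet_lt measurable_const (measurable_snd.sub measurable_fst).norm)
  have h2 := h.stronglyMeasurable.integral_prod_right' (ν := μ)
  convert h2 using 1
  funext x
  rw [rieszTrunc, ← integral_indicator (measurableSet_lt_norm_sub δ x)]
  rfl

theorem rieszTrunc_sum_mul {ι : Type*} [Fintype ι] {δ : ℝ} {x : EuclideanSpace ℝ (Fin n)}
    (hx : ∀ r, IntegrableOn (rieszKernel x) ({y | δ < ‖y - x‖} ∩ Metric.closedBall 0 r) μ)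
    {f : ι → EuclideanSpace ℝ (Fin n) → ℝ} (hf : ∀ i, Measurable (f i))
    (hb : ∀ i, ∃ B : ℝ, ∀ x, |f i x| ≤ B)
    (hs : ∀ i, Bornology.IsBounded (Function.support (f i))) (g : ι → ℝ) :
    rieszTrunc δ μ (fun y => ∑ i, g i * f i y) x = ∑ i, g i * rieszTrunc δ μ (f i) x := by
  simp only [rieszTrunc, ← integral_const_mul]
  rw [← integral_finsetSum _ fun i _ =>
    (integrable_rieszKernel_mul hx (hf i) (hb i) (hs i)).const_mul (g i)]
  congr 1 with y
  rw [Finset.mul_sum]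
  exact Finset.sum_congr rfl fun i _ => by ring

theorem NormBound.lintegral_le {δ p : ℝ} {C : ℝ≥0} (hp : 0 < p) (h : NormBound δ p μ ν C)
    {f : EuclideanSpace ℝ (Fin n) → ℝ} (hf : Measurable f) (hb : ∃ B : ℝ, ∀ x, |f x| ≤ B)
    (hs : Bornology.IsBounded (Function.support f)) :
    ∫⁻ x, ‖rieszTrunc δ μ f x‖ₑ ^ p ∂ν ≤ (C : ℝ≥0∞) ^ p * ∫⁻ y, ‖f y‖ₑ ^ p ∂μ := by
  have h1 := h f hf hb hs
  have hp0 : ENNReal.ofReal p ≠ 0 := by simpa using hp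
  rw [eLpNorm_eq_lintegral_rpow_enorm_toReal hp0 ENNReal.ofReal_ne_top,
    eLpNorm_eq_lintegral_rpow_enorm_toReal hp0 ENNReal.ofReal_ne_top,
    ENNReal.toReal_ofReal hp.le] at h1
  have h2 := ENNReal.rpow_le_rpow h1 hp.le
  rwa [ENNReal.mul_rpow_of_nonneg _ _ hp.le, one_div, ENNReal.rpow_inv_rpow hp.ne',
    ENNReal.rpow_inv_rpow hp.ne'] at h2

/-- Bounds for a truncated Riesz transform extend to square functions with the same constant. -/
theorem NormBound.vectorValued [SFinite μ] [SFinite ν] {ι : Type*} [Fintype ι] {δ p : ℝ} {C : ℝ≥0}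
    (hp : 0 < p) (h : NormBound δ p μ ν C) (hT : TruncConvergent δ μ ν)
    {f : ι → EuclideanSpace ℝ (Fin n) → ℝ} (hf : ∀ i, Measurable (f i))
    (hb : ∀ i, ∃ B : ℝ, ∀ x, |f i x| ≤ B)
    (hs : ∀ i, Bornology.IsBounded (Function.support (f i))) :
    ∫⁻ x, (∑ i, ‖rieszTrunc δ μ (f i) x‖ₑ ^ 2) ^ (p / 2) ∂ν ≤
      (C : ℝ≥0∞) ^ p * ∫⁻ y, (∑ i, ‖f i y‖ₑ ^ 2) ^ (p / 2) ∂μ := by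
  set γ := ProbabilityTheory.stdGaussian (EuclideanSpace ℝ ι)
  have hc := gaussianMoment_ne_zero hp
  have hct := gaussianMoment_ne_top hp
  have hm : ∀ {F : ι → EuclideanSpace ℝ (Fin n) → ℝ}, (∀ i, Measurable (F i)) →
      Measurable fun q : EuclideanSpace ℝ (Fin n) × EuclideanSpace ℝ ι =>
        ‖∑ i, q.2 i * F i q.1‖ₑ ^ p := fun {F} hF => by
    refine Measurable.pow_const (Measurable.enorm ?_) _
    exact Finset.measurable_fun_sum _ fun i _ =>
      ((EuclideanSpace.proj (𝕜 := ℝ) i).continuous.measurable.comp measurable_snd).mul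
        ((hF i).comp measurable_fst)
  have hTm : ∀ i, Measurable (rieszTrunc δ μ (f i)) := fun i =>
    (stronglyMeasurable_rieszTrunc δ (hf i)).measurable
  -- For fixed g this is the scalar bound for one function, the combination of the `f i` with
  -- coefficients `g i`; linearity holds almost everywhere, where the integrals converge.
  have key : ∀ g : EuclideanSpace ℝ ι, ∫⁻ x, ‖∑ i, g i * rieszTrunc δ μ (f i) x‖ₑ ^ p ∂ν ≤
      (C : ℝ≥0∞) ^ p * ∫⁻ y, ‖∑ i, g i * f i y‖ₑ ^ p ∂μ := by
    intro g
    have h1 : ∫⁻ x, ‖∑ i, g i * rieszTrunc δ μ (f i) x‖ₑ ^ p ∂ν =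
        ∫⁻ x, ‖rieszTrunc δ μ (fun y => ∑ i, g i * f i y) x‖ₑ ^ p ∂ν := by
      refine lintegral_congr_ae ?_
      filter_upwards [hT] with x hx
      rw [rieszTrunc_sum_mul hx hf hb hs]
    rw [h1]
    refine h.lintegral_le hp (Finset.measurable_fun_sum _ fun i _ => (hf i).const_mul _) ?_ ?_
    · choose B hB using hb
      refine ⟨∑ i, |g i| * B i, fun x => (Finset.abs_sum_le_sum_abs _ _).trans ?_⟩
      refine Finset.sum_le_sum fun i _ => ?_
      rw [abs_mul]
      exact mul_le_mul_of_nonneg_left (hB i x) (abs_nonneg _)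
    · refine ((Bornology.isBounded_iUnion (s := fun i => Function.support (f i))).2 hs).subset ?_
      intro y hy
      obtain ⟨i, -, hi⟩ := Finset.exists_ne_zero_of_sum_ne_zero hy
      exact mem_iUnion.2 ⟨i, right_ne_zero_of_mul hi⟩
  -- Averaging `key` over g and exchanging integrals puts the same Gaussian moment on both sides. It
  -- is finite and nonzero, so it cancels.
  have h2 : gaussianMoment p * ∫⁻ x, (∑ i, ‖rieszTrunc δ μ (f i) x‖ₑ ^ 2) ^ (p / 2) ∂ν ≤
      gaussianMoment p * ((C : ℝ≥0∞) ^ p * ∫⁻ y, (∑ i, ‖f i y‖ₑ ^ 2) ^ (p / 2) ∂μ) := by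
    rw [mul_left_comm, ← lintegral_const_mul' _ _ hct, ← lintegral_const_mul' _ _ hct]
    simp_rw [← lintegral_stdGaussian hp]
    rw [lintegral_lintegral_swap (μ := ν) (ν := γ)
        (f := fun x (g : EuclideanSpace ℝ ι) => ‖∑ i, g i * rieszTrunc δ μ (f i) x‖ₑ ^ p) (hm hTm).aemeasurable,
      lintegral_lintegral_swap (μ := μ) (ν := γ)
        (f := fun y (g : EuclideanSpace ℝ ι) => ‖∑ i, g i * f i y‖ₑ ^ p) (hm hf).aemeasurable,
      ← lintegral_const_mul' _ _ (ENNReal.rpow_ne_top_of_nonneg hp.le ENNReal.coe_ne_top)]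
    exact lintegral_mono key
  exact (ENNReal.mul_le_mul_iff_right hc hct).1 h2

end VectorValued

/-! ### Necessity of the quadratic Muckenhoupt condition -/

theorem eq_axisPoint_of_mem_unitSegment {n : ℕ} [NeZero n] {x : EuclideanSpace ℝ (Fin n)}
    (hx : x ∈ unitSegment n) : x = axisPoint n (x 0) := by
  obtain ⟨t, -, rfl⟩ := hx
  rw [axisPoint_apply_zero]

/-- All coordinates but the first vanish on the axis and are admissible because the cube meets it at
t; hence s can only fail the condition on the first coordinate. -/
theorem IsCube.half_le_abs_sub {n : ℕ} [NeZero n] {Q : Set (EuclideanSpace ℝ (Fin n))}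
    {c : EuclideanSpace ℝ (Fin n)} {ℓ s t : ℝ} (hQ : IsCube Q c ℓ) (ht : axisPoint n t ∈ Q)
    (hs : axisPoint n s ∉ Q) : ℓ / 2 ≤ |s - c 0| := by
  obtain ⟨-, J, hJ, rfl⟩ := hQ
  by_contra! hlt
  refine hs fun i => ?_
  by_cases hi : i = 0
  · subst hi
    rw [axisPoint_apply_zero]
    rw [abs_lt] at hlt
    exact (hJ 0).1 ⟨by linarith, by linarith⟩
  · have := ht i
    rwa [axisPoint_apply_of_ne n _ hi] at this ⊢

/-- The truncation of `f` in size and in space. -/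
noncomputable def cutoff {n : ℕ} (f : EuclideanSpace ℝ (Fin n) → ℝ≥0∞)
    (D : Set (EuclideanSpace ℝ (Fin n))) (N : ℕ) : EuclideanSpace ℝ (Fin n) → ℝ :=
  (D ∩ Metric.closedBall 0 N).indicator fun y => (min (f y) N).toReal

section Cutoff

variable {n : ℕ} (f : EuclideanSpace ℝ (Fin n) → ℝ≥0∞) (D : Set (EuclideanSpace ℝ (Fin n))) (N : ℕ)

theorem cutoff_nonneg (y : EuclideanSpace ℝ (Fin n)) : 0 ≤ cutoff f D N y :=
  indicator_nonneg (fun _ _ => ENNReal.toReal_nonneg) _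

theorem enorm_cutoff (y : EuclideanSpace ℝ (Fin n)) :
    ‖cutoff f D N y‖ₑ = (D ∩ Metric.closedBall 0 N).indicator (fun y => min (f y) N) y := by
  unfold cutoff
  by_cases hy : y ∈ D ∩ Metric.closedBall 0 N
  · rw [indicator_of_mem hy, indicator_of_mem hy, Real.enorm_eq_ofReal ENNReal.toReal_nonneg,
      ENNReal.ofReal_toReal (ne_top_of_le_ne_top (ENNReal.natCast_ne_top N) (min_le_right _ _))]
  · rw [indicator_of_notMem hy, indicator_of_notMem hy, enorm_zero]

theorem measurable_cutoff {f : EuclideanSpace ℝ (Fin n) → ℝ≥0∞} (hf : Measurable f)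
    {D : Set (EuclideanSpace ℝ (Fin n))} (hD : MeasurableSet D) : Measurable (cutoff f D N) :=
  (hf.min measurable_const).ennreal_toReal.indicator (hD.inter measurableSet_closedBall)

theorem exists_abs_cutoff_le : ∃ B : ℝ, ∀ y, |cutoff f D N y| ≤ B := by
  refine ⟨N, fun y => ?_⟩
  rw [abs_of_nonneg (cutoff_nonneg _ _ _ _)]
  refine indicator_le' (fun y _ => ?_) (fun _ _ => N.cast_nonneg) y
  exact ENNReal.toReal_le_of_le_ofReal N.cast_nonneg (by simp)

theorem isBounded_support_cutoff : Bornology.IsBounded (Function.support (cutoff f D N)) :=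
  Metric.isBounded_closedBall.subset
    ((support_indicator_subset).trans inter_subset_right)

end Cutoff

theorem enorm_integral_of_sign {α : Type*} [MeasurableSpace α] {μ : Measure α} {h : α → ℝ} {ε : ℝ}
    (hε : |ε| = 1) (hint : Integrable h μ) (hsign : ∀ᵐ y ∂μ, 0 ≤ ε * h y) :
    ‖∫ y, h y ∂μ‖ₑ = ∫⁻ y, ‖h y‖ₑ ∂μ := by
  have h1 : ∀ᵐ y ∂μ, ‖h y‖ = ε * h y := by
    filter_upwards [hsign] with y hy
    rw [← abs_of_nonneg hy, abs_mul, hε, one_mul, Real.norm_eq_abs]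
  rw [← ofReal_integral_norm_eq_lintegral_enorm hint, integral_congr_ae h1, integral_const_mul,
    Real.enorm_eq_ofReal_abs]
  congr 1
  have h2 : 0 ≤ ε * ∫ y, h y ∂μ := by
    rw [← integral_const_mul]; exact integral_nonneg_of_ae hsign
  rw [← abs_of_nonneg h2, abs_mul, hε, one_mul]

section Necessity

variable {n : ℕ} [NeZero n] {μ ν : Measure (EuclideanSpace ℝ (Fin n))}

/-- On one side of a cube the kernel has a sign, and dominates the kernel of the quadratic
condition. -/
theorem lintegral_cutoff_le {Q D : Set (EuclideanSpace ℝ (Fin n))}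
    {c : EuclideanSpace ℝ (Fin n)} {ℓ t δ ε : ℝ} (hQ : IsCube Q c ℓ) (ht : axisPoint n t ∈ Q)
    (hμ : μ (unitSegment n)ᶜ = 0) (hDQ : D ⊆ Qᶜ) (hDm : MeasurableSet D)
    (hε : ε = 1 ∨ ε = -1) (hD : ∀ y ∈ D, 0 ≤ ε * (y 0 - c 0))
    (hx : ∀ r, IntegrableOn (rieszKernel (axisPoint n t))
      ({y | δ < ‖y - axisPoint n t‖} ∩ Metric.closedBall 0 r) μ)
    {f : EuclideanSpace ℝ (Fin n) → ℝ≥0∞} (hf : Measurable f) (N : ℕ) :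
    ∫⁻ y, (D ∩ Metric.closedBall 0 N ∩ {y | δ < ‖y - axisPoint n t‖}).indicator
        (fun y => min (f y) N / ENNReal.ofReal (‖y - c‖ ^ n)) y ∂μ ≤
      2 ^ n * ‖rieszTrunc δ μ (cutoff f D N) (axisPoint n t)‖ₑ := by
  have hS := measurableSet_lt_norm_sub δ (axisPoint n t)
  have hε1 : |ε| = 1 := by rcases hε with rfl | rfl <;> simp
  have hseg : ∀ᵐ y ∂μ, y ∈ unitSegment n := by rwa [ae_iff]
  have hint := integrable_rieszKernel_mul hx (measurable_cutoff N hf hDm)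
    (exists_abs_cutoff_le f D N) (isBounded_support_cutoff f D N)
  -- A point of the axis outside the cube is at least half a side from the centre, and t is at most
  -- that far. So s - t has the sign of s - c₀, and |s - t| ≤ 2|s - c₀|, the source of the factor
  -- 2ⁿ.
  have hgeom : ∀ s, axisPoint n s ∈ D → 0 < ε * (s - t) ∧ |s - t| ≤ 2 * |s - c 0| := by
    intro s hs
    have h1 := hQ.half_le_abs_sub ht (hDQ hs)
    have h2 := hQ.abs_apply_sub_le ht 0
    have h3 := hD _ hs
    have hne : s ≠ t := fun h => hDQ hs (h ▸ ht)
    rw [axisPoint_apply_zero] at h2 h3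
    have h4 : |s - t| ≤ 2 * |s - c 0| := by
      have := abs_sub_le s (c 0) t
      rw [abs_sub_comm (c 0)] at this
      linarith
    refine ⟨?_, h4⟩
    have h5 : ε * (s - c 0) = |s - c 0| := by
      rw [← abs_of_nonneg h3, abs_mul, hε1, one_mul]
    have h6 : ε * (t - c 0) ≤ ℓ / 2 := by
      refine (le_abs_self _).trans ?_
      rwa [abs_mul, hε1, one_mul]
    have h7 : 0 ≤ ε * (s - t) := by linarith
    refine lt_of_le_of_ne h7 (Ne.symm (mul_ne_zero ?_ (sub_ne_zero.2 hne)))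
    rcases hε with rfl | rfl <;> norm_num
  have hsign : ∀ᵐ y ∂μ.restrict {y | δ < ‖y - axisPoint n t‖},
      0 ≤ ε * (rieszKernel (axisPoint n t) y * cutoff f D N y) := by
    refine ae_restrict_of_ae ?_
    filter_upwards [hseg] with y hy
    by_cases hyD : y ∈ D
    · rw [eq_axisPoint_of_mem_unitSegment hy] at hyD ⊢
      have := (hgeom _ hyD).1
      rw [rieszKernel_axisPoint, ← mul_assoc]
      refine mul_nonneg ?_ (cutoff_nonneg _ _ _ _)
      rw [lineKernel, ← mul_div_assoc]
      positivity
    · rw [cutoff, indicator_of_notMem (fun h => hyD h.1)]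
      simp
  rw [rieszTrunc, enorm_integral_of_sign hε1 hint hsign, ← lintegral_indicator hS,
    ← lintegral_const_mul' _ _ (by simp)]
  refine lintegral_mono_ae ?_
  filter_upwards [hseg] with y hy
  by_cases hyD : y ∈ D ∩ Metric.closedBall 0 N ∩ {y | δ < ‖y - axisPoint n t‖}
  swap
  · rw [indicator_of_notMem hyD]; exact zero_le
  rw [indicator_of_mem hyD, indicator_of_mem hyD.2, enorm_mul, enorm_cutoff,
    indicator_of_mem hyD.1, ← mul_assoc, div_eq_mul_inv, mul_comm]
  gcongr
  have hyD' := hyD.1.1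
  have hyc := PiLp.norm_apply_le (y - c) 0
  rw [eq_axisPoint_of_mem_unitSegment hy] at hyD'
  obtain ⟨h1, h2⟩ := hgeom _ hyD'
  have hpos : 0 < |y 0 - t| := abs_pos.2 (right_ne_zero_of_mul h1.ne')
  rw [PiLp.sub_apply, Real.norm_eq_abs] at hyc
  have hyc0 : 0 < ‖y - c‖ := by linarith
  nth_rewrite 2 [eq_axisPoint_of_mem_unitSegment hy]
  rw [enorm_rieszKernel_axisPoint, abs_lineKernel, Real.rpow_neg hpos.le, Real.rpow_natCast,
    ← ENNReal.ofReal_inv_of_pos (by positivity),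
    show (2 : ℝ≥0∞) ^ n = ENNReal.ofReal (2 ^ n) by simp [ENNReal.ofReal_pow],
    ← ENNReal.ofReal_mul (by positivity)]
  refine ENNReal.ofReal_le_ofReal ?_
  rw [← div_eq_mul_inv, le_div_iff₀ (by positivity), inv_mul_le_iff₀ (by positivity), ← mul_pow,
    mul_comm]
  gcongr
  linarith

/-- The part of the integral in the quadratic condition at distance more than `δ` from `x`, for a
bounded function of bounded support. -/
noncomputable def cutPotential (μ : Measure (EuclideanSpace ℝ (Fin n)))
    (f : EuclideanSpace ℝ (Fin n) → ℝ≥0∞) (D : Set (EuclideanSpace ℝ (Fin n)))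
    (c : EuclideanSpace ℝ (Fin n)) (δ : ℝ) (N : ℕ) (x : EuclideanSpace ℝ (Fin n)) : ℝ≥0∞ :=
  ∫⁻ y, (D ∩ Metric.closedBall 0 N ∩ {y | δ < ‖y - x‖}).indicator
    (fun y => min (f y) N / ENNReal.ofReal (‖y - c‖ ^ n)) y ∂μ

omit [NeZero n] in
theorem measurable_cutPotential [SFinite μ] {f : EuclideanSpace ℝ (Fin n) → ℝ≥0∞}
    (hf : Measurable f) {D : Set (EuclideanSpace ℝ (Fin n))} (hD : MeasurableSet D)
    (c : EuclideanSpace ℝ (Fin n)) (δ : ℝ) (N : ℕ) : Measurable (cutPotential μ f D c δ N) := by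
  have h : Measurable fun q : EuclideanSpace ℝ (Fin n) × EuclideanSpace ℝ (Fin n) =>
      {q : EuclideanSpace ℝ (Fin n) × EuclideanSpace ℝ (Fin n) |
        q.2 ∈ D ∩ Metric.closedBall 0 N ∧ δ < ‖q.2 - q.1‖}.indicator
        (fun q => min (f q.2) N / ENNReal.ofReal (‖q.2 - c‖ ^ n)) q := by
    refine Measurable.indicator ?_ ?_
    · exact ((hf.comp measurable_snd).min measurable_const).div
        ((measurable_snd.sub_const c).norm.pow_const n).ennreal_ofReal
    · exact (measurable_snd (hD.inter measurableSet_closedBall)).inter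
        (measurableSet_lt measurable_const (measurable_snd.sub measurable_fst).norm)
  exact h.lintegral_prod_right' (ν := μ)

omit [NeZero n] in
theorem monotone_cutPotential (f : EuclideanSpace ℝ (Fin n) → ℝ≥0∞)
    (D : Set (EuclideanSpace ℝ (Fin n))) (c : EuclideanSpace ℝ (Fin n)) {δ : ℕ → ℝ}
    (hδ : Antitone δ) (x : EuclideanSpace ℝ (Fin n)) :
    Monotone fun N => cutPotential μ f D c (δ N) N x := by
  intro N N' h
  refine lintegral_mono fun y => ?_
  by_cases hy : y ∈ D ∩ Metric.closedBall 0 (N : ℝ) ∩ {y | δ N < ‖y - x‖}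
  swap
  · rw [indicator_of_notMem hy]; exact zero_le
  have hy' : y ∈ D ∩ Metric.closedBall 0 (N' : ℝ) ∩ {y | δ N' < ‖y - x‖} :=
    ⟨⟨hy.1.1, Metric.closedBall_subset_closedBall (by exact_mod_cast h) hy.1.2⟩,
      (hδ h).trans_lt hy.2⟩
  rw [indicator_of_mem hy, indicator_of_mem hy']
  gcongr

open Filter Topology in
omit [NeZero n] in
theorem tendsto_cutPotential {f : EuclideanSpace ℝ (Fin n) → ℝ≥0∞} (hf : Measurable f)
    {D : Set (EuclideanSpace ℝ (Fin n))} (hD : MeasurableSet D) {c : EuclideanSpace ℝ (Fin n)}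
    (hc : c ∉ D) {δ : ℕ → ℝ} (hδ : Antitone δ) (hδ0 : ∀ ε > 0, ∃ N, δ N < ε)
    {x : EuclideanSpace ℝ (Fin n)} (hx : x ∉ D) :
    Tendsto (fun N => cutPotential μ f D c (δ N) N x) atTop
      (𝓝 (∫⁻ y in D, f y / ENNReal.ofReal (‖y - c‖ ^ n) ∂μ)) := by
  rw [← lintegral_indicator hD]
  refine lintegral_tendsto_of_tendsto_of_monotone (fun N => ?_) (ae_of_all _ fun y => ?_)
    (ae_of_all _ fun y => ?_)
  · refine (Measurable.indicator ?_ ((hD.inter measurableSet_closedBall).inter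
      (measurableSet_lt_norm_sub _ _))).aemeasurable
    exact (hf.min measurable_const).div ((measurable_id.sub_const c).norm.pow_const n).ennreal_ofReal
  · intro N N' h
    by_cases hy : y ∈ D ∩ Metric.closedBall 0 (N : ℝ) ∩ {y | δ N < ‖y - x‖}
    swap
    · simp only [indicator_of_notMem hy]; exact zero_le
    have hy' : y ∈ D ∩ Metric.closedBall 0 (N' : ℝ) ∩ {y | δ N' < ‖y - x‖} :=
      ⟨⟨hy.1.1, Metric.closedBall_subset_closedBall (by exact_mod_cast h) hy.1.2⟩,
        (hδ h).trans_lt hy.2⟩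
    simp only [indicator_of_mem hy, indicator_of_mem hy']
    gcongr
  · by_cases hy : y ∈ D
    swap
    · rw [indicator_of_notMem hy]
      have hno : ∀ N : ℕ, y ∉ D ∩ Metric.closedBall 0 (N : ℝ) ∩ {y | δ N < ‖y - x‖} :=
        fun N h => hy h.1.1
      simp only [indicator_of_notMem (hno _)]
      exact tendsto_const_nhds
    rw [indicator_of_mem hy]
    have hyx : 0 < ‖y - x‖ := norm_pos_iff.2 (sub_ne_zero.2 fun h => hx (h ▸ hy))
    have hyc : 0 < ‖y - c‖ := norm_pos_iff.2 (sub_ne_zero.2 fun h => hc (h ▸ hy))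
    obtain ⟨N₀, hN₀⟩ := hδ0 _ hyx
    obtain ⟨N₁, hN₁⟩ := exists_nat_ge ‖y‖
    have hlim : Tendsto (fun N : ℕ => min (f y) N / ENNReal.ofReal (‖y - c‖ ^ n)) atTop
        (𝓝 (f y / ENNReal.ofReal (‖y - c‖ ^ n))) := by
      refine ENNReal.Tendsto.div_const ?_ (Or.inr (ENNReal.ofReal_pos.2 (pow_pos hyc n)).ne')
      simpa using (tendsto_const_nhds (x := f y)).min ENNReal.tendsto_nat_nhds_top
    refine hlim.congr' ?_
    filter_upwards [eventually_ge_atTop (max N₀ N₁)] with N hN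
    rw [indicator_of_mem]
    refine ⟨⟨hy, ?_⟩, (hδ ((le_max_left _ _).trans hN)).trans_lt hN₀⟩
    rw [mem_closedBall_zero_iff]
    exact hN₁.trans (by exact_mod_cast (le_max_right _ _).trans hN)

/-- The quadratic condition follows from bounds for truncated Riesz transforms, uniform along a
sequence of truncations. -/
theorem quadraticAp_of_normBound [IsLocallyFiniteMeasure μ] [IsLocallyFiniteMeasure ν]
    (hμ : μ (unitSegment n)ᶜ = 0) (hν : ν (unitSegment n)ᶜ = 0) {p : ℝ} (hp : 0 < p)
    {δ : ℕ → ℝ} (hδ : Antitone δ) (hδ0 : ∀ ε > 0, ∃ N, δ N < ε) {C : ℝ≥0}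
    (hC : ∀ N, NormBound (δ N) p μ ν C) (hT : ∀ N, TruncConvergent (δ N) μ ν) :
    QuadraticAp p μ ν := by
  refine ⟨2 * 2 ^ n * C, fun M Q c ℓ f hQ hf => ?_⟩
  -- The complement of each cube is halved at its centre, so that the kernel has one sign on each
  -- half. The vector-valued bound is applied to the doubled family.
  set D : Fin M × Bool → Set (EuclideanSpace ℝ (Fin n)) := fun i =>
    (Q i.1)ᶜ ∩ {y | if i.2 then c i.1 0 ≤ y 0 else y 0 < c i.1 0} with hD
  have hDm : ∀ i, MeasurableSet (D i) := by
    have h0 : Measurable fun y : EuclideanSpace ℝ (Fin n) => y 0 :=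
      (EuclideanSpace.proj (𝕜 := ℝ) (0 : Fin n)).continuous.measurable
    rintro ⟨i, e⟩
    refine (hQ i).measurableSet.compl.inter ?_
    cases e
    · simpa using measurableSet_lt h0 measurable_const
    · simpa using measurableSet_le measurable_const h0
  set F : ℕ → Fin M × Bool → EuclideanSpace ℝ (Fin n) → ℝ := fun N i =>
    cutoff (f i.1) (D i) N with hF
  set Φ : ℕ → EuclideanSpace ℝ (Fin n) → ℝ≥0∞ := fun N x =>
    (∑ i, (Q i).indicator (cutPotential μ (f i) (Q i)ᶜ (c i) (δ N) N) x ^ 2) ^ (p / 2) with hΦ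
  have hp2 : 0 < p / 2 := by positivity
  have hnorm : ∀ N, ∀ᵐ x ∂ν, Φ N x ≤
      ((2 * 2 ^ n : ℝ≥0∞) ^ 2 * ∑ i, ‖rieszTrunc (δ N) μ (F N i) x‖ₑ ^ 2) ^ (p / 2) := by
    intro N
    have hseg : ∀ᵐ x ∂ν, x ∈ unitSegment n := by rwa [ae_iff]
    filter_upwards [hseg, hT N] with x hx hxT
    refine ENNReal.rpow_le_rpow ?_ hp2.le
    rw [Fintype.sum_prod_type, Finset.mul_sum]
    refine Finset.sum_le_sum fun i _ => ?_
    by_cases hxQ : x ∈ Q i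
    swap
    · rw [indicator_of_notMem hxQ]; simp
    rw [indicator_of_mem hxQ, Fintype.sum_bool]
    have hside : ∀ e, cutPotential μ (f i) (D (i, e)) (c i) (δ N) N x ≤
        2 ^ n * ‖rieszTrunc (δ N) μ (F N (i, e)) x‖ₑ := fun e => by
      rw [eq_axisPoint_of_mem_unitSegment hx] at hxQ hxT ⊢
      refine lintegral_cutoff_le (hQ i) hxQ hμ inter_subset_left (hDm (i, e))
        (ε := if e then 1 else -1) (by cases e <;> simp) (fun y hy => ?_) hxT (hf i) N
      have hy2 := hy.2
      cases e
      · simp only [Bool.false_eq_true, if_false, mem_ofPred_eq] at hy2 ⊢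
        linarith
      · simp only [if_true, mem_ofPred_eq] at hy2 ⊢
        linarith
    have hsum : cutPotential μ (f i) (Q i)ᶜ (c i) (δ N) N x ≤
        cutPotential μ (f i) (D (i, true)) (c i) (δ N) N x +
        cutPotential μ (f i) (D (i, false)) (c i) (δ N) N x := by
      rw [cutPotential, cutPotential, cutPotential, ← lintegral_add_left]
      · refine lintegral_mono fun y => ?_
        by_cases hy : y ∈ (Q i)ᶜ ∩ Metric.closedBall 0 (N : ℝ) ∩ {y | δ N < ‖y - x‖}
        swap
        · rw [indicator_of_notMem hy]; exact zero_le
        rw [indicator_of_mem hy]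
        rcases le_or_gt (c i 0) (y 0) with h | h
        · refine le_add_right (le_of_eq ?_)
          rw [indicator_of_mem]
          exact ⟨⟨⟨hy.1.1, by simpa using h⟩, hy.1.2⟩, hy.2⟩
        · refine le_add_left (le_of_eq ?_)
          rw [indicator_of_mem]
          exact ⟨⟨⟨hy.1.1, by simpa using h⟩, hy.1.2⟩, hy.2⟩
      · exact Measurable.indicator (((hf i).min measurable_const).div
          ((measurable_id.sub_const (c i)).norm.pow_const n).ennreal_ofReal)
          (((hDm _).inter measurableSet_closedBall).inter (measurableSet_lt_norm_sub _ _))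
    have hadd : ∀ a b : ℝ≥0∞, (a + b) ^ 2 ≤ 2 ^ 2 * (a ^ 2 + b ^ 2) := fun a b => by
      rcases le_total a b with h | h
      · calc (a + b) ^ 2 ≤ (b + b) ^ 2 := by gcongr
          _ = 2 ^ 2 * b ^ 2 := by rw [← two_mul, mul_pow]
          _ ≤ _ := by gcongr; exact le_add_self
      · calc (a + b) ^ 2 ≤ (a + a) ^ 2 := by gcongr
          _ = 2 ^ 2 * a ^ 2 := by rw [← two_mul, mul_pow]
          _ ≤ _ := by gcongr; exact le_self_add
    calc _ ≤ (2 ^ n * ‖rieszTrunc (δ N) μ (F N (i, true)) x‖ₑ +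
          2 ^ n * ‖rieszTrunc (δ N) μ (F N (i, false)) x‖ₑ) ^ 2 := by
          gcongr
          exact hsum.trans (add_le_add (hside true) (hside false))
      _ ≤ _ := hadd _ _
      _ = _ := by ring
  -- The two halves are disjoint, so doubling the family does not enlarge the square function on the
  -- right.
  have hFle : ∀ N y, ∑ i, ‖F N i y‖ₑ ^ 2 ≤ ∑ i, f i y ^ 2 := by
    intro N y
    rw [Fintype.sum_prod_type]
    refine Finset.sum_le_sum fun i _ => ?_
    rw [Fintype.sum_bool]
    simp only [hF, enorm_cutoff]
    have hle : ∀ e, (D (i, e) ∩ Metric.closedBall 0 (N : ℝ)).indicator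
        (fun y => min (f i y) N) y ≤ f i y := fun e =>
      (indicator_le_self _ _ _).trans (min_le_left _ _)
    rcases le_or_gt (c i 0) (y 0) with h | h
    · rw [indicator_of_notMem (s := D (i, false) ∩ _) fun h' => by
        have := h'.1.2
        simp only [Bool.false_eq_true, if_false, mem_ofPred_eq] at this
        linarith]
      simpa using pow_le_pow_left' (hle true) 2
    · rw [indicator_of_notMem (s := D (i, true) ∩ _) fun h' => by
        have := h'.1.2
        simp only [if_true, mem_ofPred_eq] at this
        linarith]
      simpa using pow_le_pow_left' (hle false) 2
  have hbound : ∀ N, ∫⁻ x, Φ N x ∂ν ≤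
      ((2 * 2 ^ n * C : ℝ≥0) : ℝ≥0∞) ^ p * ∫⁻ y, (∑ i, f i y ^ 2) ^ (p / 2) ∂μ := by
    intro N
    calc _ ≤ _ := lintegral_mono_ae (hnorm N)
      _ = (2 * 2 ^ n : ℝ≥0∞) ^ p *
          ∫⁻ x, (∑ i, ‖rieszTrunc (δ N) μ (F N i) x‖ₑ ^ 2) ^ (p / 2) ∂ν := by
        simp_rw [ENNReal.mul_rpow_of_nonneg _ _ hp2.le]
        rw [← ENNReal.rpow_two, ← ENNReal.rpow_mul, mul_div_cancel₀ p two_ne_zero,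
          lintegral_const_mul' _ _ (ENNReal.rpow_ne_top_of_nonneg hp.le (by finiteness))]
      _ ≤ (2 * 2 ^ n : ℝ≥0∞) ^ p * ((C : ℝ≥0∞) ^ p *
          ∫⁻ y, (∑ i, ‖F N i y‖ₑ ^ 2) ^ (p / 2) ∂μ) := by
        gcongr
        exact (hC N).vectorValued hp (hT N) (fun i => measurable_cutoff N (hf i.1) (hDm i))
          (fun i => exists_abs_cutoff_le _ _ N) (fun i => isBounded_support_cutoff _ _ N)
      _ ≤ (2 * 2 ^ n : ℝ≥0∞) ^ p * ((C : ℝ≥0∞) ^ p *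
          ∫⁻ y, (∑ i, f i y ^ 2) ^ (p / 2) ∂μ) := by
        gcongr with y
        exact hFle N y
      _ = _ := by
        rw [← mul_assoc, ← ENNReal.mul_rpow_of_nonneg _ _ hp.le]
        push_cast
        rfl
  -- Monotone convergence removes the truncations in size, in space and near x together; y never
  -- meets x or the centre, since both lie in the cube.
  have hlim : Filter.Tendsto (fun N => ∫⁻ x, Φ N x ∂ν) Filter.atTop (nhds (∫⁻ x,
      (∑ i, (Q i).indicator (fun _ => ∫⁻ y in (Q i)ᶜ, f i y / ENNReal.ofReal (‖y - c i‖ ^ n) ∂μ)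
        x ^ 2) ^ (p / 2) ∂ν)) := by
    refine lintegral_tendsto_of_tendsto_of_monotone (fun N => ?_) (ae_of_all _ fun x => ?_)
      (ae_of_all _ fun x => ?_)
    · refine (Measurable.pow_const (Finset.measurable_fun_sum _ fun i _ =>
        Measurable.pow_const ?_ _) _).aemeasurable
      exact (measurable_cutPotential (hf i) (hQ i).measurableSet.compl _ _ _).indicator
        (hQ i).measurableSet
    · intro N N' h
      simp only [hΦ]
      gcongr with i
      exact monotone_cutPotential _ _ _ hδ x h
    · refine ((ENNReal.continuous_rpow_const).tendsto _).comp (tendsto_finsetSum _ fun i _ => ?_)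
      refine ENNReal.Tendsto.pow ?_
      by_cases hx : x ∈ Q i
      · simp only [indicator_of_mem hx]
        exact tendsto_cutPotential (hf i) (hQ i).measurableSet.compl
          (fun h => h (hQ i).center_mem) hδ hδ0 (fun h => h hx)
      · simp only [indicator_of_notMem hx]
        exact tendsto_const_nhds
  have hfinal := ENNReal.rpow_le_rpow (le_of_tendsto' hlim hbound) (one_div_pos.2 hp).le
  rwa [ENNReal.mul_rpow_of_nonneg _ _ (one_div_pos.2 hp).le, one_div, ENNReal.rpow_rpow_inv hp.ne',
    ← one_div] at hfinal

theorem UniformNormInequality.quadraticAp [IsLocallyFiniteMeasure μ] [IsLocallyFiniteMeasure ν]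
    (hμ : μ (unitSegment n)ᶜ = 0) (hν : ν (unitSegment n)ᶜ = 0) {p : ℝ} (hp : 0 < p)
    (h : UniformNormInequality p μ ν) : QuadraticAp p μ ν := by
  obtain ⟨C, hC⟩ := h
  have hpos : ∀ N : ℕ, (0 : ℝ) < 1 / (N + 1) := fun N => Nat.one_div_pos_of_nat
  exact quadraticAp_of_normBound hμ hν hp (fun N N' h => Nat.one_div_le_one_div h)
    (fun ε hε => exists_nat_one_div_lt hε) (fun N => hC _ (hpos N))
    fun N => truncConvergent_of_pos (hpos N)

theorem NormInequality.quadraticAp [IsLocallyFiniteMeasure μ] [IsLocallyFiniteMeasure ν]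
    (hμ : μ (unitSegment n)ᶜ = 0) (hν : ν (unitSegment n)ᶜ = 0) {p : ℝ} (hp : 0 < p)
    (hconv : AbsConvergent μ ν) (h : NormInequality p μ ν) : QuadraticAp p μ ν := by
  obtain ⟨C, hC⟩ := h
  -- The constant sequence 0 is allowed because absolute convergence replaces the truncation of the
  -- kernel.
  exact quadraticAp_of_normBound hμ hν hp (δ := fun _ => 0) antitone_const
    (fun ε hε => ⟨0, hε⟩) (fun _ => hC) fun _ => hconv.truncConvergent 0

end Necessity

/-! ### Failure of the quadratic Muckenhoupt condition -/

theorem QuadraticAp.exists_fintype {n : ℕ} {p : ℝ} {σ ω : Measure (EuclideanSpace ℝ (Fin n))}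
    (h : QuadraticAp p σ ω) :
    ∃ A : ℝ≥0, ∀ (ι : Type) [Fintype ι] (Q : ι → Set (EuclideanSpace ℝ (Fin n)))
      (c : ι → EuclideanSpace ℝ (Fin n)) (ℓ : ι → ℝ) (f : ι → EuclideanSpace ℝ (Fin n) → ℝ≥0∞),
      (∀ i, IsCube (Q i) (c i) (ℓ i)) → (∀ i, Measurable (f i)) →
      (∫⁻ x, (∑ i, (Q i).indicator
          (fun _ => ∫⁻ y in (Q i)ᶜ, f i y / ENNReal.ofReal (‖y - c i‖ ^ n) ∂σ) x ^ 2) ^ (p / 2)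
          ∂ω) ^ (1 / p) ≤
        A * (∫⁻ y, (∑ i, f i y ^ 2) ^ (p / 2) ∂σ) ^ (1 / p) := by
  obtain ⟨A, hA⟩ := h
  refine ⟨A, fun ι _ Q c ℓ f hQ hf => ?_⟩
  have e := (Fintype.equivFin ι).symm
  have := hA (Fintype.card ι) (fun i => Q (e i)) (fun i => c (e i)) (fun i => ℓ (e i))
    (fun i => f (e i)) (fun i => hQ _) (fun i => hf _)
  have h1 : ∀ x, ∑ i, (Q (e i)).indicator (fun _ => ∫⁻ y in (Q (e i))ᶜ,
      f (e i) y / ENNReal.ofReal (‖y - c (e i)‖ ^ n) ∂σ) x ^ 2 = ∑ i, (Q i).indicator (fun _ =>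
        ∫⁻ y in (Q i)ᶜ, f i y / ENNReal.ofReal (‖y - c i‖ ^ n) ∂σ) x ^ 2 := fun x =>
    e.sum_comp fun i => (Q i).indicator (fun _ =>
        ∫⁻ y in (Q i)ᶜ, f i y / ENNReal.ofReal (‖y - c i‖ ^ n) ∂σ) x ^ 2
  have h2 : ∀ y, ∑ i, f (e i) y ^ 2 = ∑ i, f i y ^ 2 := fun y => e.sum_comp fun i => f i y ^ 2
  simpa only [h1, h2] using this

theorem not_forall_natCast_rpow_le {α β : ℝ} (hαβ : β < α) {B : ℝ≥0∞} (hB : B ≠ ⊤) :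
    ¬ ∀ N : ℕ, (N : ℝ≥0∞) ^ α ≤ B * (N : ℝ≥0∞) ^ β := by
  intro h
  have hlim := (tendsto_rpow_atTop (sub_pos.2 hαβ)).comp tendsto_natCast_atTop_atTop
  obtain ⟨N, hN, hN1⟩ := ((hlim.eventually_gt_atTop B.toReal).and
    (Filter.eventually_ge_atTop 1)).exists
  have hN0 : (N : ℝ≥0∞) ≠ 0 := by simpa using (by omega : N ≠ 0)
  have hNt : (N : ℝ≥0∞) ≠ ⊤ := ENNReal.natCast_ne_top N
  have h1 := h N
  rw [← sub_add_cancel α β, ENNReal.rpow_add _ _ hN0 hNt, ENNReal.mul_le_mul_iff_left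
    (by simp [ENNReal.rpow_eq_zero_iff, hN0, hNt]) (ENNReal.rpow_ne_top_of_ne_zero hN0 hNt)] at h1
  have h2 := ENNReal.toReal_mono hB h1
  rw [← ENNReal.toReal_rpow, ENNReal.toReal_natCast] at h2
  exact h2.not_gt hN

/-- The closed cube with centre `c` and side length `ℓ`. -/
def closedCube {n : ℕ} (c : EuclideanSpace ℝ (Fin n)) (ℓ : ℝ) : Set (EuclideanSpace ℝ (Fin n)) :=
  {x | ∀ i, x i ∈ Icc (c i - ℓ / 2) (c i + ℓ / 2)}

theorem isCube_closedCube {n : ℕ} (c : EuclideanSpace ℝ (Fin n)) {ℓ : ℝ} (hℓ : 0 < ℓ) :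
    IsCube (closedCube c ℓ) c ℓ :=
  ⟨hℓ, _, fun _ => ⟨Ioo_subset_Icc_self, Subset.rfl⟩, rfl⟩

theorem axisPoint_mem_closedCube_iff {n : ℕ} [NeZero n] {s t ℓ : ℝ} (hℓ : 0 < ℓ) :
    axisPoint n t ∈ closedCube (axisPoint n s) ℓ ↔ t ∈ Icc (s - ℓ / 2) (s + ℓ / 2) := by
  constructor
  · intro h
    simpa using h 0
  · intro h i
    by_cases hi : i = 0
    · subst hi; simpa using h
    · rw [axisPoint_apply_of_ne n _ hi, axisPoint_apply_of_ne n _ hi]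
      constructor <;> linarith

namespace IsSeparatedZeros

variable {n : ℕ} [NeZero n] {c : ℝ} {ζ : ∀ k : ℕ, (Fin k → Bool) → ℝ}
  (hζ : IsSeparatedZeros n c ζ)
include hζ

omit [NeZero n] in
theorem injective {k m : ℕ} {b b' : ℕ → Bool} (h : ζ k (word b k) = ζ m (word b' m)) :
    k = m ∧ word b k = word b' k := by
  have h1 := hζ.word_eq_of_mem_cantorInterval (h ▸ hζ.mem_interval m (word b' m))
  have h2 := hζ.word_eq_of_mem_cantorInterval (h.symm ▸ hζ.mem_interval k (word b k))
  obtain rfl := le_antisymm h2.1 h1.1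
  exact ⟨rfl, h1.2⟩

omit hζ in
theorem mass_le_sigma_singleton {p q : ℝ} (hpq : p.HolderConjugate q) (b : ℕ → Bool) (k : ℕ) :
    ENNReal.ofReal (theta n q ^ k) * 2⁻¹ ^ k ≤
      sigma n p (fun k w => axisPoint n (ζ k w)) {axisPoint n (ζ k (word b k))} := by
  rw [sigma_apply (measurableSet_singleton _), hpq.conjExponent_eq]
  refine le_trans ?_ (ENNReal.le_tsum k)
  gcongr
  rw [← coin_word_eq (word b k), ← lintegral_indicator_one (measurableSet_word_eq _)]
  refine lintegral_mono fun b' => ?_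
  by_cases hb : word b' k = word b k
  · rw [hb, indicator_of_mem (mem_singleton _)]
    exact indicator_le_self' (fun _ _ => zero_le) _
  · rw [indicator_of_notMem (by exact hb)]; exact zero_le

/-- The cubes are the children of all words of fewer than N letters, and the functions are multiples
of indicators of the parent zeros. A Cantor point lies in one child per generation, so the square
function there is at least N^(1/2). The atoms are disjoint, so the right-hand side is only of order
N^(1/p). -/
theorem not_quadraticAp {p q : ℝ} (hpq : p.HolderConjugate q) (hp : 2 < p) :
    ¬ QuadraticAp p (sigma n p fun k w => axisPoint n (ζ k w)) (omega n) := by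
  intro hQA
  obtain ⟨A, hA⟩ := hQA.exists_fintype
  set σ := sigma n p fun k w => axisPoint n (ζ k w) with hσ
  have hp0 := hpq.pos
  have hη0 := theta_pos n (q - 1)
  have hθ0 := theta_pos n q
  have hr := rate_pos n
  -- The height at which an atom of generation k produces a potential of size at least 1 on both
  -- children, while generation k contributes a fixed amount to the norm on the right.
  set a : ℕ → ℝ := fun k => (theta n (q - 1) ^ k)⁻¹ with ha
  have ha0 : ∀ k, 0 < a k := fun k => by positivity
  refine not_forall_natCast_rpow_le (α := 1 / 2) (β := 1 / p) (B := A * 2 ^ (1 / 2 : ℝ))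
    (one_div_lt_one_div_of_lt two_pos hp) (by finiteness) fun N => ?_
  have key := hA ((Σ k : Fin N, (Fin k → Bool)) × Bool)
    (fun i => closedCube (axisPoint n (leftEnd (child i.1.2 i.2) + 1 / 3 ^ (i.1.1 + 1 : ℕ) / 2))
      (1 / 3 ^ (i.1.1 + 1 : ℕ)))
    (fun i => axisPoint n (leftEnd (child i.1.2 i.2) + 1 / 3 ^ (i.1.1 + 1 : ℕ) / 2))
    (fun i => 1 / 3 ^ (i.1.1 + 1 : ℕ))
    (fun i => ({axisPoint n (ζ i.1.1 i.1.2)} : Set _).indicator fun _ => ENNReal.ofReal (a i.1.1))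
    (fun i => isCube_closedCube _ (third_pow_pos _))
    (fun i => measurable_const.indicator (measurableSet_singleton _))
  have hlower : (N : ℝ≥0∞) ^ (1 / 2 : ℝ) ≤ _ := le_trans ?_ key
  · refine hlower.trans ?_
    rw [mul_assoc]
    gcongr
    rw [one_div p, ENNReal.rpow_inv_le_iff hp0, ENNReal.mul_rpow_of_nonneg _ _ hp0.le,
      ENNReal.rpow_inv_rpow hp0.ne', ← ENNReal.rpow_mul, lintegral_sigma, hpq.conjExponent_eq]
    have hval : ∀ m (b : ℕ → Bool), ∑ i : (Σ k : Fin N, (Fin k → Bool)) × Bool,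
        ({axisPoint n (ζ i.1.1 i.1.2)} : Set (EuclideanSpace ℝ (Fin n))).indicator
          (fun _ => ENNReal.ofReal (a i.1.1)) (axisPoint n (ζ m (word b m))) ^ 2 ≤
        if m ∈ Finset.range N then 2 * ENNReal.ofReal (a m) ^ 2 else 0 := by
      intro m b
      have hne : ∀ i : Σ k : Fin N, (Fin k → Bool),
          axisPoint n (ζ m (word b m)) ∈ ({axisPoint n (ζ i.1 i.2)} : Set _) →
          m = i.1 ∧ ∀ j : Fin i.1, b j = i.2 j := by
        rintro ⟨k, w⟩ h
        obtain ⟨b', rfl⟩ := exists_word_eq w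
        have h1 := hζ.injective ((isometry_axisPoint n).injective h)
        exact ⟨h1.1, fun j => congrFun (h1.1 ▸ h1.2) j⟩
      rw [Fintype.sum_prod_type]
      simp only [Fintype.sum_bool, ← two_mul]
      split_ifs with hm
      · rw [Finset.sum_eq_single ⟨⟨m, Finset.mem_range.1 hm⟩, word b m⟩]
        · rw [indicator_of_mem (mem_singleton _)]
        · rintro ⟨⟨k, hk⟩, w⟩ - hkw
          rw [indicator_of_notMem]
          · simp
          · intro hmem
            obtain ⟨h1, h2⟩ := hne _ hmem
            dsimp only at h1 h2
            subst h1
            exact hkw (by congr 1; funext j; exact (h2 j).symm)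
        · simp
      · refine (Finset.sum_eq_zero fun i _ => ?_).le
        rw [indicator_of_notMem]
        · simp
        · intro hmem
          exact hm (Finset.mem_range.2 ((hne _ hmem).1 ▸ i.1.2))
    have hexp : ∀ m, ENNReal.ofReal (theta n q ^ m) * (2 * ENNReal.ofReal (a m) ^ 2) ^ (p / 2) =
        2 ^ (p / 2) := by
      intro m
      rw [ENNReal.mul_rpow_of_nonneg _ _ (by positivity), ← ENNReal.rpow_two, ← ENNReal.rpow_mul,
        mul_div_cancel₀ p two_ne_zero, ENNReal.ofReal_rpow_of_nonneg (ha0 m).le hp0.le,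
        mul_left_comm, ← ENNReal.ofReal_mul (by positivity)]
      -- Again (q - 1)p = q.
      have : theta n q ^ m * a m ^ p = 1 := by
        have h1 : (theta n (q - 1) ^ m) ^ p = theta n q ^ m := by
          rw [← Real.rpow_natCast, ← Real.rpow_mul hη0.le, mul_comm (m : ℝ), Real.rpow_mul hη0.le,
            Real.rpow_natCast, theta, theta, ← Real.rpow_mul hr.le]
          congr 2
          have := hpq.symm.sub_one_mul_conj
          linarith
        rw [ha, Real.inv_rpow (by positivity), h1, mul_inv_cancel₀ (by positivity)]
      rw [this, ENNReal.ofReal_one, mul_one]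
    calc _ ≤ ∑' m, if m ∈ Finset.range N then (2 : ℝ≥0∞) ^ (p / 2) else 0 := by
          refine ENNReal.tsum_le_tsum fun m => ?_
          have h1 : ∫⁻ b, (∑ i : (Σ k : Fin N, (Fin k → Bool)) × Bool,
              ({axisPoint n (ζ i.1.1 i.1.2)} : Set (EuclideanSpace ℝ (Fin n))).indicator
              (fun _ => ENNReal.ofReal (a i.1.1)) (axisPoint n (ζ m (word b m))) ^ 2) ^ (p / 2)
              ∂coin ≤
              (if m ∈ Finset.range N then 2 * ENNReal.ofReal (a m) ^ 2 else 0) ^ (p / 2) := by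
            refine (lintegral_mono fun b => ENNReal.rpow_le_rpow (hval m b)
              (by positivity)).trans_eq ?_
            simp
          refine (mul_le_mul_right h1 _).trans_eq ?_
          split_ifs with hm
          · exact hexp m
          · rw [ENNReal.zero_rpow_of_pos (by positivity), mul_zero]
      _ = _ := by
          rw [tsum_eq_sum (s := Finset.range N) (fun m hm => if_neg hm), Finset.sum_ite_mem,
            Finset.inter_self, Finset.sum_const, Finset.card_range, nsmul_eq_mul, mul_comm]
          congr 2
          ring
  · rw [one_div p, ENNReal.le_rpow_inv_iff hp0, ← ENNReal.rpow_mul, lintegral_omega,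
      show 1 / 2 * p = p / 2 by ring]
    calc (N : ℝ≥0∞) ^ (p / 2) = ∫⁻ _, (N : ℝ≥0∞) ^ (p / 2) ∂coin := by simp
      _ ≤ _ := by
        refine lintegral_mono fun b => ENNReal.rpow_le_rpow ?_ (by positivity)
        rw [Fintype.sum_prod_type, Fintype.sum_sigma]
        calc (N : ℝ≥0∞) = ∑ _k : Fin N, 1 := by simp
          _ ≤ _ := by
            refine Finset.sum_le_sum fun k _ => ?_
            refine le_trans ?_ (Finset.single_le_sum (fun _ _ => zero_le)
              (Finset.mem_univ (word b k)))
            refine le_trans ?_ (Finset.single_le_sum (fun _ _ => zero_le)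
              (Finset.mem_univ (b k)))
            dsimp only
            rw [word_succ_eq_child_iff.2 ⟨rfl, rfl⟩ |>.symm]
            have hk := third_pow_pos k
            have hk' := third_pow_succ k
            have hz := hζ.mem_interval k (word b k)
            have hgap := mem_cantorGap_word.1 (hζ.mem_gap k (word b k))
            have hmem : ∀ t, axisPoint n t ∈ closedCube (axisPoint n
                (leftEnd (word b (k + 1)) + 1 / 3 ^ (k + 1 : ℕ) / 2)) (1 / 3 ^ (k + 1 : ℕ)) ↔
                t ∈ cantorInterval (word b (k + 1)) := fun t => by
              rw [axisPoint_mem_closedCube_iff (third_pow_pos _), cantorInterval]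
              congr! 2 <;> ring
            rw [indicator_of_mem ((hmem _).2 (cantorPoint_mem_cantorInterval b _))]
            refine one_le_pow₀ ?_
            have hzQ : axisPoint n (ζ k (word b k)) ∉ closedCube (axisPoint n
                (leftEnd (word b (k + 1)) + 1 / 3 ^ (k + 1 : ℕ) / 2)) (1 / 3 ^ (k + 1 : ℕ)) := by
              rw [hmem]
              intro h
              exact absurd (hζ.word_eq_of_mem_cantorInterval h).1 (by omega)
            have hcm : leftEnd (word b (k + 1)) + 1 / 3 ^ (k + 1 : ℕ) / 2 ∈
                cantorInterval (word b k) :=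
              cantorInterval_word_anti b (show (k : ℕ) ≤ k + 1 by omega)
                ⟨by linarith [third_pow_pos (k + 1)], by linarith [third_pow_pos (k + 1)]⟩
            have hdist : |ζ k (word b k) - (leftEnd (word b (k + 1)) + 1 / 3 ^ (k + 1 : ℕ) / 2)| ≤
                1 / 3 ^ (k : ℕ) := by
              rw [cantorInterval, mem_Icc] at hz hcm
              rw [abs_le]
              constructor <;> linarith
            have hpos : 0 <
                |ζ k (word b k) - (leftEnd (word b (k + 1)) + 1 / 3 ^ (k + 1 : ℕ) / 2)| := by
              refine abs_pos.2 (sub_ne_zero.2 fun h => hzQ ((hmem _).2 ?_))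
              rw [h]
              exact ⟨by linarith [third_pow_pos (k + 1)], by linarith [third_pow_pos (k + 1)]⟩
            have hQm := (isCube_closedCube (axisPoint n
                (leftEnd (word b (k + 1)) + 1 / 3 ^ (k + 1 : ℕ) / 2))
                (third_pow_pos (k + 1))).measurableSet.compl
            rw [← lintegral_indicator hQm]
            -- An atom of mass θ(q)ᵏ2⁻ᵏ at distance at most 3⁻ᵏ has potential at least θ(q)ᵏ·`rate
            -- n`ᵏ = θ(q-1)ᵏ, the reciprocal of the height.
            calc (1 : ℝ≥0∞) = ENNReal.ofReal (a k * 3 ^ (n * k)) *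
                  (ENNReal.ofReal (theta n q ^ (k : ℕ)) * 2⁻¹ ^ (k : ℕ)) := by
                  rw [show (2⁻¹ : ℝ≥0∞) = ENNReal.ofReal 2⁻¹ by
                      rw [ENNReal.ofReal_inv_of_pos two_pos, ENNReal.ofReal_ofNat],
                    ← ENNReal.ofReal_pow (by norm_num), ← ENNReal.ofReal_mul (by positivity),
                    ← ENNReal.ofReal_mul (by have := ha0 k; positivity), ← ENNReal.ofReal_one]
                  congr 1
                  have h1 : theta n (q - 1) = theta n q * rate n := by
                    rw [theta, theta, ← Real.rpow_add_one hr.ne']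
                    congr 1; ring
                  simp only [ha]
                  rw [h1, mul_pow, rate, div_pow, pow_mul, inv_pow]
                  field_simp
              _ ≤ ENNReal.ofReal (a k * 3 ^ (n * k)) * σ {axisPoint n (ζ k (word b k))} := by
                  gcongr
                  exact mass_le_sigma_singleton hpq b k
              _ = ∫⁻ y, ({axisPoint n (ζ k (word b k))} : Set _).indicator
                    (fun _ => ENNReal.ofReal (a k * 3 ^ (n * k))) y ∂σ :=
                  (lintegral_indicator_const (measurableSet_singleton _) _).symm
              _ ≤ _ := by
                  refine lintegral_mono fun y => ?_
                  by_cases hy : y = axisPoint n (ζ k (word b k))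
                  swap
                  · rw [indicator_of_notMem (by exact hy)]; exact zero_le
                  subst hy
                  rw [indicator_of_mem (mem_singleton _), indicator_of_mem (by exact hzQ),
                    indicator_of_mem (mem_singleton _), norm_axisPoint_sub,
                    ← ENNReal.ofReal_div_of_pos (by positivity)]
                  refine ENNReal.ofReal_le_ofReal ?_
                  rw [le_div_iff₀ (by positivity)]
                  have h3 : (3 : ℝ) ^ (n * k) * (1 / 3 ^ (k : ℕ)) ^ n = 1 := by
                    rw [mul_comm n, pow_mul, ← mul_pow, mul_one_div_cancel (by positivity),
                      one_pow]
                  calc _ ≤ a k * 3 ^ (n * k) * (1 / 3 ^ (k : ℕ)) ^ n := by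
                        have := ha0 k
                        gcongr
                    _ = _ := by rw [mul_assoc, h3, mul_one]

/-- The roles are exchanged: indicators of Cantor intervals overlap N-fold at Cantor points, which
gives N^(1/2) on the right, while cubes around the zeros contain at least one unit of p-th power per
generation, which gives N^(1/p) on the left. The masses of `sigma n q` involve the conjugate of q,
so its generation m has total mass θ(p)ᵐ. -/
theorem not_quadraticAp_dual {p q : ℝ} (hpq : p.HolderConjugate q) (hp : p < 2) :
    ¬ QuadraticAp p (omega n) (sigma n q fun k w => axisPoint n (ζ k w)) := by
  intro hQA
  obtain ⟨A, hA⟩ := hQA.exists_fintype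
  have hp0 := hpq.pos
  have hθ0 := theta_pos n p
  have hr := rate_pos n
  have hc := hζ.pos
  refine not_forall_natCast_rpow_le (α := 1 / p) (β := 1 / 2) (B := A)
    (one_div_lt_one_div_of_lt hp0 hp) (by finiteness) fun N => ?_
  have hcm : ∀ k : ℕ, 0 < c * (1 / 3 ^ k) := fun k => mul_pos hc (third_pow_pos k)
  have h0 : Measurable fun y : EuclideanSpace ℝ (Fin n) => y 0 :=
    (EuclideanSpace.proj (𝕜 := ℝ) (0 : Fin n)).continuous.measurable
  -- The side c·3⁻ᵏ keeps each cube within half the separation of its zero along the axis, so ω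
  -- lives outside all the cubes.
  have key := hA (Σ k : Fin N, (Fin k → Bool))
    (fun i => closedCube (axisPoint n (ζ i.1 i.2)) (c * (1 / 3 ^ (i.1 : ℕ))))
    (fun i => axisPoint n (ζ i.1 i.2)) (fun i => c * (1 / 3 ^ (i.1 : ℕ)))
    (fun i => {y | y 0 ∈ cantorInterval i.2}.indicator fun _ => 1)
    (fun i => isCube_closedCube _ (hcm _))
    (fun i => measurable_const.indicator (show MeasurableSet
      {y : EuclideanSpace ℝ (Fin n) | y 0 ∈ cantorInterval i.2} from h0 (by exact measurableSet_Icc)))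
  have hlower : (N : ℝ≥0∞) ^ (1 / p) ≤ _ := le_trans ?_ key
  · refine hlower.trans ?_
    gcongr
    rw [one_div p, ENNReal.rpow_inv_le_iff hp0, ← ENNReal.rpow_mul, lintegral_omega,
      show 1 / 2 * p = p / 2 by ring]
    calc _ ≤ ∫⁻ _, (N : ℝ≥0∞) ^ (p / 2) ∂coin := by
          refine lintegral_mono fun b => ENNReal.rpow_le_rpow ?_ (by positivity)
          rw [Fintype.sum_sigma]
          calc _ ≤ ∑ _k : Fin N, (1 : ℝ≥0∞) := by
                refine Finset.sum_le_sum fun k _ => ?_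
                rw [Finset.sum_eq_single (word b k)]
                · refine pow_le_one₀ zero_le ?_
                  exact indicator_le_self _ _ _
                · intro w _ hw
                  rw [indicator_of_notMem]
                  · simp
                  · intro hmem
                    rw [mem_ofPred_eq, axisPoint_apply_zero,
                      cantorPoint_mem_cantorInterval_iff] at hmem
                    exact hw (funext fun j => (hmem j).symm)
                · simp
            _ = _ := by simp
      _ = _ := by simp
  · refine ENNReal.rpow_le_rpow ?_ (by positivity)
    rw [lintegral_sigma, hpq.symm.conjExponent_eq]
    refine le_trans ?_ (ENNReal.sum_le_tsum (Finset.range N))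
    calc (N : ℝ≥0∞) = ∑ _m ∈ Finset.range N, 1 := by simp
      _ ≤ _ := by
        refine Finset.sum_le_sum fun m hm => ?_
        -- At a zero of generation m the interval of its word yields a potential of at least
        -- 2⁻ᵐ3^(nm) = `rate n`ᵐ, with p-th power θ(p)⁻ᵐ; the mass θ(p)ᵐ of the generation makes
        -- this one unit.
        have hone : (1 : ℝ≥0∞) = ENNReal.ofReal (theta n p ^ m) *
            ∫⁻ _, ENNReal.ofReal ((theta n p ^ m)⁻¹) ∂coin := by
          rw [lintegral_const, measure_univ, mul_one, ← ENNReal.ofReal_mul (by positivity),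
            mul_inv_cancel₀ (by positivity), ENNReal.ofReal_one]
        refine hone.trans_le (mul_le_mul_right (lintegral_mono fun b => ?_) _)
        rw [← rate_pow_rpow, ← ENNReal.ofReal_rpow_of_nonneg (by positivity) hp0.le,
          show p = 2 * (p / 2) by ring, ENNReal.rpow_mul, mul_div_cancel_left₀ _ two_ne_zero,
          ENNReal.rpow_two]
        refine ENNReal.rpow_le_rpow ?_ (by positivity)
        refine le_trans ?_ (Finset.single_le_sum (fun _ _ => zero_le)
          (Finset.mem_univ ⟨⟨m, Finset.mem_range.1 hm⟩, word b m⟩))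
        dsimp only
        rw [indicator_of_mem ((axisPoint_mem_closedCube_iff (hcm m)).2
          ⟨by linarith [hcm m], by linarith [hcm m]⟩)]
        refine pow_le_pow_left₀ zero_le ?_ 2
        rw [← lintegral_indicator (isCube_closedCube _ (hcm m)).measurableSet.compl,
          lintegral_omega]
        calc _ = ∫⁻ b', {b' | word b' m = word b m}.indicator
                (fun _ => ENNReal.ofReal (3 ^ (n * m))) b' ∂coin := by
              rw [lintegral_indicator_const (measurableSet_word_eq _), coin_word_eq, rate, div_pow,
                show (2⁻¹ : ℝ≥0∞) = ENNReal.ofReal 2⁻¹ by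
                  rw [ENNReal.ofReal_inv_of_pos two_pos, ENNReal.ofReal_ofNat],
                ← ENNReal.ofReal_pow (by norm_num), ← ENNReal.ofReal_mul (by positivity), pow_mul,
                inv_pow, div_eq_mul_inv]
          _ ≤ _ := by
              refine lintegral_mono fun b' => ?_
              by_cases hb : word b' m = word b m
              swap
              · rw [indicator_of_notMem (by exact hb)]; exact zero_le
              have hsep := hζ.sep m (word b m) b'
              have hnear := hζ.abs_sub_le b' m
              rw [hb] at hnear
              have hpos := (hcm m).trans_le hsep
              rw [indicator_of_mem (by exact hb), indicator_of_mem, indicator_of_mem,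
                norm_axisPoint_sub, ← ENNReal.ofReal_one,
                ← ENNReal.ofReal_div_of_pos (by positivity)]
              · refine ENNReal.ofReal_le_ofReal ?_
                rw [le_div_iff₀ (by positivity)]
                have h3 : (3 : ℝ) ^ (n * m) * (1 / 3 ^ m) ^ n = 1 := by
                  rw [mul_comm n, pow_mul, ← mul_pow, mul_one_div_cancel (by positivity), one_pow]
                calc _ ≤ (3 : ℝ) ^ (n * m) * (1 / 3 ^ m) ^ n := by gcongr
                  _ = _ := h3
              · rw [mem_ofPred_eq, axisPoint_apply_zero, ← hb]
                exact cantorPoint_mem_cantorInterval b' m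
              · rw [mem_compl_iff, axisPoint_mem_closedCube_iff (hcm m)]
                intro h
                have : |cantorPoint b' - ζ m (word b m)| ≤ c * (1 / 3 ^ m) / 2 :=
                  abs_le.2 ⟨by linarith [h.1], by linarith [h.2]⟩
                linarith [hcm m]

end IsSeparatedZeros

/-! ### The counterexamples -/

theorem cantorInterval_subset_Icc {k : ℕ} (w : Fin k → Bool) : cantorInterval w ⊆ Icc 0 1 := by
  obtain ⟨b, rfl⟩ := exists_word_eq w
  refine (cantorInterval_word_anti b (Nat.zero_le k)).trans ?_
  simp [cantorInterval, leftEnd]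

theorem omega_compl_unitSegment (n : ℕ) [NeZero n] : omega n (unitSegment n)ᶜ = 0 := by
  rw [← mem_ae_iff]
  refine (ae_omega_iff n).2 (ae_of_all _ fun b => ?_)
  exact mem_image_of_mem _ (cantorPoint_mem_Icc b)

theorem IsSeparatedZeros.sigma_compl_unitSegment {n : ℕ} [NeZero n] {c : ℝ}
    {ζ : ∀ k : ℕ, (Fin k → Bool) → ℝ} (hζ : IsSeparatedZeros n c ζ) (p : ℝ) :
    sigma n p (fun k w => axisPoint n (ζ k w)) (unitSegment n)ᶜ = 0 := by
  rw [← mem_ae_iff]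
  exact ae_sigma_of_forall fun k w =>
    mem_image_of_mem _ (cantorInterval_subset_Icc w (hζ.mem_interval k w))

end TwoWeightRiesz

open TwoWeightRiesz in
/-- Let `1 < p < ∞`. The pair `(σ_p, ω)` satisfies the hypotheses of the `T1` theorem, and so does
`(ω, σ_{p'})`; the norm inequality fails for the first pair if `p > 2`, and for the second (dual) one
if `p < 2`, in both cases together with the quadratic Muckenhoupt condition. The latter is
necessary for the norm inequality for all measures on the segment. -/
theorem mainTheorem2 (n : ℕ) [NeZero n] (p : ℝ) (hp : 1 < p) :
    (∃ z, IsZeroSelection n z) ∧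
    (∀ z, IsZeroSelection n z →
      -- both measures are locally finite and live on the segment
      (omega n (unitSegment n)ᶜ = 0 ∧ IsLocallyFiniteMeasure (omega n) ∧
        sigma n p z (unitSegment n)ᶜ = 0 ∧ IsLocallyFiniteMeasure (sigma n p z)) ∧
      -- the integrals defining `R₁` converge absolutely
      (AbsConvergent (sigma n p z) (omega n) ∧ AbsConvergent (omega n) (sigma n p z)) ∧
      T1Conditions p (sigma n p z) (omega n) ∧
      T1Conditions p (omega n) (sigma n p.conjExponent z) ∧
      (2 < p →
        ¬ QuadraticAp p (sigma n p z) (omega n) ∧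
        ¬ NormInequality p (sigma n p z) (omega n) ∧
        ¬ UniformNormInequality p (sigma n p z) (omega n)) ∧
      (p < 2 →
        ¬ QuadraticAp p (omega n) (sigma n p.conjExponent z) ∧
        ¬ NormInequality p (omega n) (sigma n p.conjExponent z) ∧
        ¬ UniformNormInequality p (omega n) (sigma n p.conjExponent z))) ∧
    (∀ μ ν : Measure (EuclideanSpace ℝ (Fin n)),
      IsLocallyFiniteMeasure μ → IsLocallyFiniteMeasure ν →
      μ (unitSegment n)ᶜ = 0 → ν (unitSegment n)ᶜ = 0 →
      UniformNormInequality p μ ν → QuadraticAp p μ ν) := by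
  have hpq := Real.HolderConjugate.conjExponent hp
  have hp' : 1 < p.conjExponent := hpq.symm.lt
  refine ⟨exists_isZeroSelection n, fun z hz => ?_, fun μ ν hμf hνf hμ hν h =>
    h.quadraticAp hμ hν hpq.pos⟩
  obtain ⟨c, ζ, hζ, rfl⟩ := hz.exists_isSeparatedZeros
  have hω := omega_compl_unitSegment n
  have hσ := fun r => hζ.sigma_compl_unitSegment r
  have := isFiniteMeasure_sigma (z := fun k w => axisPoint n (ζ k w)) hp
  have := isFiniteMeasure_sigma (z := fun k w => axisPoint n (ζ k w)) hp'
  refine ⟨⟨hω, inferInstance, hσ p, inferInstance⟩,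
    ⟨hζ.absConvergent_sigma_omega hp, hζ.absConvergent_omega_sigma p⟩, hζ.t1Conditions hp,
    (hζ.t1Conditions hp').symm hp, fun h2 => ?_, fun h2 => ?_⟩
  · have hA := hζ.not_quadraticAp hpq h2
    exact ⟨hA, fun h => hA (h.quadraticAp (hσ p) hω hpq.pos (hζ.absConvergent_sigma_omega hp)),
      fun h => hA (h.quadraticAp (hσ p) hω hpq.pos)⟩
  · have hA := hζ.not_quadraticAp_dual hpq h2
    exact ⟨hA, fun h => hA (h.quadraticAp hω (hσ _) hpq.pos (hζ.absConvergent_omega_sigma _)),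
      fun h => hA (h.quadraticAp hω (hσ _) hpq.pos)⟩
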